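/- Let $n\ge 0$. Let $T^*\mathbb R^n$ have coordinates $(x,p)=(x_1,\dots,x_n,p_1,\dots,p_n)$ and Liouville form $p\,dx=\sum_i p_i\,dx_i$, and let $J^1\mathbb R^n=\mathbb R\times T^*\mathbb R^n$ have coordinates $(x_0,x,p)$ and the contact structure $\xi=\ker(dx_0+p\,dx)$. Let $\pi(x_0,x,p)=(x_0,x)$ be the front projection $J^1\mathbb R^n\to\mathbb R\times\mathbb R^n$. Define $h_0=0$ and $h_i(x_1,\dots,x_i)=x_1-h_{i-1}(x_2,\dots,x_i)^2$, and let $${}^n\Gamma=\bigcup_{i=0}^n\{x_0=h_i(x_1,\dots,x_i)^2\}\subset\mathbb R\times\mathbb R^n .$$ Let ${}^nL=\bigcup_{i=0}^n{}^nL_i\subset T^*\mathbb R^n$ be the extended $A_{n+1}$ Lagrangian, where ${}^nL_0=\{p=0\}$ is the zero section and, for $1\le i\le n$, ${}^nL_i$ is the conormal bundle of the hypersurface $\{x_1=h_{i-1}(x_2,\dots,x_i)^2\}\subset\mathbb R^n$. A Weinstein hypersurface embedding of an open set $U\subset T^*\mathbb R^n$ into $J^1\mathbb R^n$ is a smooth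 embedding $\varphi:U\to J^1\mathbb R^n$ such that $\varphi^*\beta=p\,dx$ for some contact form $\beta$ that defines $\xi$ near $\varphi(U)$. Given $0\in U$, say that $\varphi$ is transverse if for every $i$ the image $\varphi({}^nL_i\cap U)$ is transverse to the fibers of the projection $J^1\mathbb R^n\to\mathbb R^n$, $(x_0,x,p)\mapsto x$. The front germ $\Upsilon$ of $\varphi$ is the germ at the central point $\pi(\varphi(0))$ of $\pi(\varphi({}^nL\cap W))$, where $W$ is a sufficiently small neighborhood of $0$ (for transverse $\varphi$ it does not depend on $W$). (1) Let $\varphi$ be a transverse Weinstein hypersurface embedding of an open neighborhood $U$ of $0$ in $T^*\mathbb R^n$ (for example $U=T^*\mathbb R^n$). Then there is a diffeomorphism $\psi:\mathbb R\times\mathbb R^n\to\mathbb R\times\mathbb R^n$ that takes the central point to $0$ and the front germ $\Upsilon$ to the germ of ${}^n\Gamma$ at $0$. (2) Let $Y$ be a smooth (finite-dimensional, Hausdorff, second countable) manifold without boundary, $\mathcal U\subset Y\times T^*\mathbb R^n$ an open neighborhood of $Y\times\{0\}$ with slices $\mathcal U_y$, and let $\varphi^y:\mathcal U_y\to J^1\mathbb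 R^n$ ($y\in Y$) be transverse Weinstein hypersurface embeddings that depend smoothly on $(y,z)\in\mathcal U$. Let $K\subset Y$ be closed, possibly empty, and suppose that on a neighborhood of $K\times\{0\}$ in $Y\times T^*\mathbb R^n$ the map $\varphi^y$ coincides with the standard embedding $(x,p)\mapsto(p_1^2/4,\;x_1-p_1/2,\;x_2,\dots,x_n,\;p)$, whose front is ${}^n\Gamma$ (for $n=0$: with the embedding of the point $T^*\mathbb R^0$ as $0\in\mathbb R=J^1\mathbb R^0$). Then there are diffeomorphisms $\psi^y:\mathbb R\times\mathbb R^n\to\mathbb R\times\mathbb R^n$, depending smoothly on $(y,q)\in Y\times(\mathbb R\times\mathbb R^n)$, such that each $\psi^y$ takes the central point $\pi(\varphi^y(0))$ to $0$ and the front germ $\Upsilon^y$ of $\varphi^y$ to the germ of ${}^n\Gamma$ at $0$, with neighborhoods that can be chosen locally uniformly in $y$, and such that $\psi^y=\mathrm{Id}$ for all $y$ in a neighborhood of $K$. -/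

import Mathlib

open Set Filter Topology
open scoped ContDiff Manifold

namespace ArborealFront

/-- `T*ℝⁿ`, with points `(x, p)`. The coordinates `x₁, …, xₙ` are `x 0, …, x (n-1)`. -/
abbrev Cot (n : ℕ) : Type := (Fin n → ℝ) × (Fin n → ℝ)

/-- `J¹ℝⁿ = ℝ × T*ℝⁿ`, with points `(x₀, x, p)`. -/
abbrev J1 (n : ℕ) : Type := ℝ × (Fin n → ℝ) × (Fin n → ℝ)

/-- The target `ℝ × ℝⁿ` of the front projection, with points `(x₀, x)`. -/
abbrev FrontSpace (n : ℕ) : Type := ℝ × (Fin n → ℝ)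

/-- The Liouville form `p dx` at `z`, evaluated on the tangent vector `w`. -/
def liouvilleForm {n : ℕ} (z w : Cot n) : ℝ := ∑ i, z.2 i * w.1 i

/-- The contact form `dx₀ + p dx` at `q`, evaluated on the tangent vector `w`. -/
def contactForm {n : ℕ} (q w : J1 n) : ℝ := w.1 + ∑ i, q.2.2 i * w.2.1 i

/-- The front projection `J¹ℝⁿ → ℝ × ℝⁿ`. -/
def frontProj {n : ℕ} (q : J1 n) : FrontSpace n := (q.1, q.2.1)

/-- The projection `J¹ℝⁿ → ℝⁿ`. -/
def baseProj (n : ℕ) : J1 n →ₗ[ℝ] (Fin n → ℝ) :=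
  LinearMap.fst ℝ (Fin n → ℝ) (Fin n → ℝ) ∘ₗ LinearMap.snd ℝ ℝ ((Fin n → ℝ) × (Fin n → ℝ))

/-- `h₀ = 0` and `hᵢ(x₁, …, xᵢ) = x₁ - hᵢ₋₁(x₂, …, xᵢ)²`. -/
def h : (i : ℕ) → (Fin i → ℝ) → ℝ
  | 0, _ => 0
  | i + 1, x => x 0 - (h i (Fin.tail x)) ^ 2

/-- The function `hᵢ²` of the first `i` coordinates, as a function on `ℝⁿ`, for `0 ≤ i ≤ n`. -/
def hSq (n : ℕ) (i : Fin (n + 1)) (x : Fin n → ℝ) : ℝ :=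
  (h i (fun k => x (Fin.castLE (Nat.lt_succ_iff.mp i.isLt) k))) ^ 2

/-- The model front `ⁿΓ = ⋃ᵢ {x₀ = hᵢ²}`. -/
def modelFront (n : ℕ) : Set (FrontSpace n) :=
  ⋃ i : Fin (n + 1), {q | q.1 = hSq n i q.2}

/-- The conormal Lagrangian in `T*ℝᵐ⁺¹` of the graph `{x₁ = f(x₂, …, xₘ₊₁)}`:
`x₁ = f` and `pₖ = - p₁ ∂f/∂xₖ` for `k ≥ 2`. -/
def conormalGraph {m : ℕ} (f : (Fin m → ℝ) → ℝ) : Set (Cot (m + 1)) :=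
  {z | z.1 0 = f (Fin.tail z.1) ∧
    ∀ k : Fin m, z.2 k.succ = - z.2 0 * fderiv ℝ f (Fin.tail z.1) (Pi.single k 1)}

/-- The smooth pieces `ⁿLᵢ`, `0 ≤ i ≤ n`: the zero section for `i = 0`, and the conormal of the
graph `{x₁ = hᵢ₋₁(x₂, …, xᵢ)²}` in `ℝⁿ` for `i ≥ 1`. -/
def lagPiece : (n : ℕ) → Fin (n + 1) → Set (Cot n)
  | 0, _ => {z | z.2 = 0}
  | m + 1, i => Fin.cases {z | z.2 = 0} (fun j : Fin (m + 1) => conormalGraph (hSq m j)) i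

/-- The extended `A_{n+1}` Lagrangian `ⁿL = ⋃ᵢ ⁿLᵢ`. -/
def extLag (n : ℕ) : Set (Cot n) := ⋃ i : Fin (n + 1), lagPiece n i

/-- The standard embedding `T*ℝⁿ → J¹ℝⁿ` of the model,
`(x, p) ↦ (p₁² / 4, x₁ - p₁ / 2, x₂, …, xₙ, p)`. It is the inclusion `{0} × T*ℝⁿ ⊆ J¹ℝⁿ` followed
by the contactomorphism of `J¹ℝⁿ` that takes `{0} × ⁿLᵢ` to the Legendrian with front
`{x₀ = hᵢ²}`. -/
noncomputable def stdEmbedding : (n : ℕ) → Cot n → J1 n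
  | 0, z => (0, z.1, z.2)
  | _ + 1, z => (z.2 0 ^ 2 / 4, Function.update z.1 0 (z.1 0 - z.2 0 / 2), z.2)

/-- `φ` restricts on the open set `U` to an embedding as a Weinstein hypersurface: a smooth
embedding such that `φ^* β = p dx` for some contact form `β = f · (dx₀ + p dx)` that defines the
standard contact structure on a neighbourhood `V` of the image. -/
structure IsWeinsteinEmbeddingOn {n : ℕ} (φ : Cot n → J1 n) (U : Set (Cot n)) : Prop where
  smooth : ContDiffOn ℝ ∞ φ U
  immersion : ∀ z ∈ U, Function.Injective (fderiv ℝ φ z)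
  embedding : IsEmbedding (U.domRestrict φ)
  contact : ∃ (V : Set (J1 n)) (f : J1 n → ℝ), IsOpen V ∧ φ '' U ⊆ V ∧ ContDiffOn ℝ ∞ f V ∧
    (∀ q ∈ V, f q ≠ 0) ∧
    ∀ z ∈ U, ∀ w : Cot n, f (φ z) * contactForm (φ z) (fderiv ℝ φ z w) = liouvilleForm z w

/-- The tangent space at `z` of a submanifold `S`, spanned by velocities of smooth curves in `S`. -/
def tangentSpan {E : Type*} [NormedAddCommGroup E] [NormedSpace ℝ E] (S : Set E) (z : E) :
    Submodule ℝ E :=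
  Submodule.span ℝ {v | ∃ γ : ℝ → E, ContDiff ℝ ∞ γ ∧ (∀ t, γ t ∈ S) ∧ γ 0 = z ∧ deriv γ 0 = v}

/-- The image under `φ` of `ⁿL ∩ U` (that is, of each of its smooth pieces) is transverse to the
fibres of `J¹ℝⁿ → ℝⁿ`. -/
def TransverseToFibersOn {n : ℕ} (φ : Cot n → J1 n) (U : Set (Cot n)) : Prop :=
  ∀ i : Fin (n + 1), ∀ z ∈ lagPiece n i ∩ U,
    (tangentSpan (lagPiece n i) z).map (fderiv ℝ φ z).toLinearMap ⊔ LinearMap.ker (baseProj n) = ⊤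

/-- The front `π(φ(ⁿL ∩ W))`. -/
def front {n : ℕ} (φ : Cot n → J1 n) (W : Set (Cot n)) : Set (FrontSpace n) :=
  frontProj '' (φ '' (extLag n ∩ W))

/-- `ψ` takes the central point `π(φ(0))` to the origin and the germ there of the front of `φ` to
the germ at the origin of `ⁿΓ`. The front of the germ of `φ` along `ⁿL` at `0` is represented by
`π(φ(ⁿL ∩ W))` for every sufficiently small neighbourhood `W` of `0`. -/
def TakesFrontGermToModel {n : ℕ} (φ : Cot n → J1 n) (ψ : FrontSpace n → FrontSpace n) : Prop :=
  ψ (frontProj (φ 0)) = 0 ∧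
  ∃ W₀ ∈ 𝓝 (0 : Cot n), ∀ W ∈ 𝓝 (0 : Cot n), W ⊆ W₀ →
    ∃ O ∈ 𝓝 (0 : FrontSpace n), (ψ '' front φ W) ∩ O = modelFront n ∩ O

/-- The parametric form of `TakesFrontGermToModel`: every `ψ y` takes the front germ of `φ y` to
that of `ⁿΓ`, with neighbourhoods that can be chosen locally uniformly in the parameter. -/
def TakesFrontGermsToModel {n : ℕ} {Y : Type*} [TopologicalSpace Y] (φ : Y → Cot n → J1 n)
    (ψ : Y → FrontSpace n → FrontSpace n) : Prop :=
  (∀ y, ψ y (frontProj (φ y 0)) = 0) ∧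
  ∀ y₀ : Y, ∃ N ∈ 𝓝 y₀, ∃ W₀ ∈ 𝓝 (0 : Cot n), ∀ W ∈ 𝓝 (0 : Cot n), W ⊆ W₀ →
    ∃ O ∈ 𝓝 (0 : FrontSpace n), ∀ y ∈ N, (ψ y '' front (φ y) W) ∩ O = modelFront n ∩ O

end ArborealFront

/-! The Liouville form vanishes on every piece ⁿLᵢ, so φ(ⁿLᵢ) is Legendrian. By transversality it
projects locally diffeomorphically to ℝⁿ near the central point, and its front is the graph of a
function fᵢ with dfᵢ = -p. The problem is then about n + 1 functions on one germ of ℝⁿ: to find a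
sign ε and coordinates X with ε (fᵢ - f₀) = hᵢ(X)² for all i. The map (x₀, x) ↦ (ε (x₀ - f₀(x)),
X(x)) straightens the front.

The coordinates come from undoing the recursion for h. Put g₀ᵢ = -ε (fᵢ - f₀), and for i > a let
g_{a+1,i} be a smooth square root of g_{a,a} - g_{a,i}. In the model, g_{a+1,i} is h_{i-a} in the
coordinates that start with the a-th one (counted from 0). So X_a = g_{a+1,a+1}, and the relations
between the roots become the recursion for h (`IsLocalFamily.exists_normalForm`).

A smooth root exists once the difference is the square of a defining function times a positive
factor. Where two pieces meet, their front functions share a 1-jet (`FrontData.vanishing_sub`),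
which gives divisibility by the square for a = 0. Divisibility passes to later roots because A² - B²
= (A - B)(A + B), and A + B restricts to the hypersurface with nonzero differential
(`vanishing_of_isRoot`). For a = 0 the factor is nonzero at the centre by a Hessian computation from
the contact condition (`tangency_nondegenerate`). Its value does not depend on i, because all
conormals contain the same fibre over the origin, so one ε serves all i. For a ≥ 1 positivity is
forced by the incidence with the zero section along a parabola (`pos_of_isRoot`).

Each root is normalized to increase along the image of the a-th direction of the zero section. This
makes the germ of (ε, f₀, X) unique (`IsSolution.unique`). Hence solutions found in charts of Y
agree near the section of central points and glue, and they give the identity where the family is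
standard. Finally, the family of germs extends to diffeomorphisms of the whole fibre: keep the
linear part and cut off the remainder, which is a small perturbation of a linear isomorphism
(`exists_family_diffeomorph`). -/

namespace ArborealFront

/-! ### Division by powers of a defining function, square roots and local inverses. -/

section Analysis

variable {P F : Type} [NormedAddCommGroup P] [NormedSpace ℝ P]
  [NormedAddCommGroup F] [NormedSpace ℝ F]

theorem hasFDerivAt_intervalIntegral_of_contDiff [FiniteDimensional ℝ P]
    {g : P × ℝ → F} (hg : ContDiff ℝ 1 g) (p : P) :
    HasFDerivAt (fun p => ∫ t in (0 : ℝ)..1, g (p, t))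
      (∫ t in (0 : ℝ)..1, (fderiv ℝ g (p, t)).comp (ContinuousLinearMap.inl ℝ P ℝ)) p := by
  have hcont : Continuous fun a : P × ℝ =>
      (fderiv ℝ g a).comp (ContinuousLinearMap.inl ℝ P ℝ) :=
    (hg.continuous_fderiv one_ne_zero).clm_comp continuous_const
  have : ProperSpace P := FiniteDimensional.proper ℝ P
  obtain ⟨C, hC⟩ := ((isCompact_closedBall p 1).prod (isCompact_Icc (a := (0 : ℝ)) (b := 1)))
    |>.exists_bound_of_continuousOn hcont.continuousOn
  refine intervalIntegral.hasFDerivAt_integral_of_dominated_of_fderiv_le (𝕜 := ℝ)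
    (bound := fun _ => C) (F' := fun p t => (fderiv ℝ g (p, t)).comp
      (ContinuousLinearMap.inl ℝ P ℝ)) (Metric.closedBall_mem_nhds p one_pos) ?_ ?_ ?_ ?_ ?_ ?_
  · exact Eventually.of_forall fun q =>
      (hg.continuous.comp (by fun_prop : Continuous fun t : ℝ => (q, t))).aestronglyMeasurable
  · exact (hg.continuous.comp (by fun_prop : Continuous fun t : ℝ => (p, t))).intervalIntegrable _ _
  · exact (hcont.comp (by fun_prop : Continuous fun t : ℝ => (p, t))).aestronglyMeasurable
  · refine Eventually.of_forall fun t ht q hq => hC (q, t) ⟨hq, ?_⟩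
    rw [uIoc_of_le zero_le_one] at ht
    exact ⟨ht.1.le, ht.2⟩
  · exact intervalIntegrable_const
  · refine Eventually.of_forall fun t _ q _ => ?_
    have h1 : HasFDerivAt g (fderiv ℝ g (q, t)) (q, t) :=
      (hg.differentiable one_ne_zero _).hasFDerivAt
    exact h1.comp q (hasFDerivAt_prodMk_left q t)

/-- Integrals of smooth functions over `[0, 1]` depend smoothly on parameters. -/
theorem contDiff_intervalIntegral [FiniteDimensional ℝ P] {F : Type} [NormedAddCommGroup F]
    [NormedSpace ℝ F] {g : P × ℝ → F} (hg : ContDiff ℝ ∞ g) :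
    ContDiff ℝ ∞ fun p => ∫ t in (0 : ℝ)..1, g (p, t) := by
  rw [contDiff_infty]
  intro k
  -- The target varies in the induction: the derivative is again such an integral, with values in
  -- linear maps.
  induction k generalizing F with
  | zero =>
    rw [Nat.cast_zero, contDiff_zero, continuous_iff_continuousAt]
    exact fun p => (hasFDerivAt_intervalIntegral_of_contDiff (hg.of_le (by simp)) p).continuousAt
  | succ k ih =>
    rw [Nat.cast_succ, contDiff_succ_iff_hasFDerivAt]
    · refine ⟨_, ih (g := fun a => (fderiv ℝ g a).comp (ContinuousLinearMap.inl ℝ P ℝ)) ?_,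
        fun p => hasFDerivAt_intervalIntegral_of_contDiff (hg.of_le (by simp)) p⟩
      exact (hg.fderiv_right (m := ∞) (by simp)).clm_comp contDiff_const

/-- A germ of a smooth function is the germ of a globally defined smooth function. -/
theorem exists_contDiff_eventuallyEq [FiniteDimensional ℝ P] {f : P → F} {p : P}
    (hf : ∀ᶠ q in 𝓝 p, ContDiffAt ℝ ∞ f q) : ∃ g : P → F, ContDiff ℝ ∞ g ∧ g =ᶠ[𝓝 p] f := by
  obtain ⟨r, hr, hball⟩ := Metric.eventually_nhds_iff_ball.1 hf
  let χ : ContDiffBump p := ⟨r / 4, r / 2, by positivity, by linarith⟩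
  refine ⟨fun q => χ q • f q, ?_, ?_⟩
  · rw [contDiff_iff_contDiffAt]
    intro q
    by_cases hq : q ∈ Metric.ball p r
    · exact χ.contDiff.contDiffAt.smul (hball q hq)
    · have : (fun q => χ q • f q) =ᶠ[𝓝 q] fun _ => 0 := by
        have hopen : (Metric.closedBall p (r / 2))ᶜ ∈ 𝓝 q :=
          Metric.isClosed_closedBall.isOpen_compl.mem_nhds (by
            simp only [Metric.mem_ball, not_lt, mem_compl_iff, Metric.mem_closedBall, not_le] at hq ⊢
            linarith)
        filter_upwards [hopen] with a ha
        rw [χ.zero_of_le_dist, zero_smul]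
        simp only [mem_compl_iff, Metric.mem_closedBall, not_le] at ha
        exact ha.le
      exact contDiffAt_const.congr_of_eventuallyEq this
  · filter_upwards [χ.eventuallyEq_one] with q hq
    simp [hq]

/-- Hadamard's lemma: a smooth function that vanishes on the hypersurface `{σ = 0}` is divisible
by `σ`. -/
theorem exists_eq_mul_of_vanishing [FiniteDimensional ℝ P] {f σ : P → ℝ} {e o : P}
    (hf : ContDiff ℝ ∞ f) (hσ : ContDiff ℝ ∞ σ) (hσe : ∀ p (c : ℝ), σ (p + c • e) = σ p + c)
    (ho : σ o = 0) (hz : ∀ᶠ p in 𝓝 o, σ p = 0 → f p = 0) :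
    ∃ u : P → ℝ, ContDiff ℝ ∞ u ∧ (∀ᶠ p in 𝓝 o, f p = σ p * u p) ∧
      ∀ p, σ p = 0 → u p = fderiv ℝ f p e := by
  have hr : Continuous fun p => p - σ p • e := by
    have := hσ.continuous
    fun_prop
  -- The integral runs over the segment from p - σ(p) e, the projection of p to {σ = 0} along e, to
  -- p. On it f has velocity σ(p) df(e).
  refine ⟨fun p => ∫ t in (0 : ℝ)..1, fderiv ℝ f (p - ((1 - t) * σ p) • e) e, ?_, ?_, ?_⟩
  · refine contDiff_intervalIntegral
      (g := fun a : P × ℝ => fderiv ℝ f (a.1 - ((1 - a.2) * σ a.1) • e) e) ?_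
    have h1 : ContDiff ℝ ∞ (fderiv ℝ f) := hf.fderiv_right (by simp)
    have h2 : ContDiff ℝ ∞ fun a : P × ℝ => a.1 - ((1 - a.2) * σ a.1) • e := by
      have := hσ.comp (contDiff_fst (E := P) (F := ℝ) (𝕜 := ℝ))
      fun_prop
    exact (h1.comp h2).clm_apply contDiff_const
  · have hr0 : Tendsto (fun p => p - σ p • e) (𝓝 o) (𝓝 o) := by
      simpa [ho] using hr.tendsto o
    filter_upwards [hr0.eventually hz] with p hp
    have h0 : f (p - σ p • e) = 0 := by
      apply hp
      have := hσe p (-σ p)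
      rwa [neg_smul, ← sub_eq_add_neg, add_neg_cancel] at this
    have hd : ∀ t ∈ uIcc (0 : ℝ) 1, HasDerivAt (fun t : ℝ => f (p - ((1 - t) * σ p) • e))
        (σ p * fderiv ℝ f (p - ((1 - t) * σ p) • e) e) t := by
      intro t _
      have h1 : HasDerivAt (fun t : ℝ => p - ((1 - t) * σ p) • e) (σ p • e) t := by
        have h3 : HasDerivAt (fun t : ℝ => (1 - t) * σ p) (-1 * σ p) t :=
          ((hasDerivAt_id t).const_sub 1).mul_const _
        have h4 := (h3.smul_const e).const_sub p
        convert h4 using 1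
        simp
      have h2 := ((hf.differentiable (by simp)) (p - ((1 - t) * σ p) • e)).hasFDerivAt
      have h3 := h2.comp_hasDerivAt t h1
      rw [map_smul, smul_eq_mul] at h3
      exact h3
    have hint := intervalIntegral.integral_eq_sub_of_hasDerivAt hd ?_
    · rw [intervalIntegral.integral_const_mul] at hint
      rw [hint]
      simp [h0]
    · apply Continuous.intervalIntegrable
      have h1 : Continuous (fderiv ℝ f) := hf.continuous_fderiv (by simp)
      have h2 : Continuous fun t : ℝ => p - ((1 - t) * σ p) • e := by fun_prop
      exact continuous_const.mul ((h1.comp h2).clm_apply continuous_const)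
  · intro p hp
    simp [hp]

/-- A smooth function that vanishes to second order on the hypersurface `{σ = 0}` is divisible
by `σ ^ 2`. -/
theorem exists_eq_sq_mul_of_vanishing [FiniteDimensional ℝ P] {f σ : P → ℝ} {e o : P}
    (hf : ContDiff ℝ ∞ f) (hσ : ContDiff ℝ ∞ σ) (hσe : ∀ p (c : ℝ), σ (p + c • e) = σ p + c)
    (ho : σ o = 0) (hz : ∀ᶠ p in 𝓝 o, σ p = 0 → f p = 0 ∧ fderiv ℝ f p e = 0) :
    ∃ u : P → ℝ, ContDiff ℝ ∞ u ∧ ∀ᶠ p in 𝓝 o, f p = σ p ^ 2 * u p := by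
  obtain ⟨v, hv, hfv, hv0⟩ := exists_eq_mul_of_vanishing hf hσ hσe ho
    (hz.mono fun p hp h => (hp h).1)
  obtain ⟨u, hu, hvu, -⟩ := exists_eq_mul_of_vanishing hv hσ hσe ho
    (hz.mono fun p hp h => by rw [hv0 p h, (hp h).2])
  refine ⟨u, hu, ?_⟩
  filter_upwards [hfv, hvu] with p h1 h2
  rw [h1, h2]; ring

/-- If `a * C = 0` where `C` has nonvanishing derivative along the fibres, then `a = 0`. -/
theorem eventually_eq_zero_of_mul_eq_zero {Y : Type*} [TopologicalSpace Y] {C a : Y → P → ℝ}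
    {y₁ : Y} {p₁ : P} (hC : ∀ᶠ z in 𝓝 (y₁, p₁), fderiv ℝ (C z.1) z.2 ≠ 0)
    (ha : ∀ᶠ z in 𝓝 (y₁, p₁), ContinuousAt (a z.1) z.2)
    (hmul : ∀ᶠ z in 𝓝 (y₁, p₁), a z.1 z.2 * C z.1 z.2 = 0) :
    ∀ᶠ z in 𝓝 (y₁, p₁), a z.1 z.2 = 0 := by
  filter_upwards [hC, ha, hmul.eventually_nhds] with z hz hcz hmz
  have hm' : ∀ᶠ q in 𝓝 z.2, a z.1 q * C z.1 q = 0 := by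
    have : Tendsto (fun q : P => (z.1, q)) (𝓝 z.2) (𝓝 z) := by
      have : Continuous (fun q : P => (z.1, q)) := by fun_prop
      exact this.tendsto z.2
    exact this.eventually hmz
  -- A nonzero value of a would persist nearby and force C to vanish on an open set, against its
  -- nonzero differential.
  by_contra hne
  apply hz
  have : C z.1 =ᶠ[𝓝 z.2] fun _ => 0 := by
    filter_upwards [hm', hcz.eventually_ne hne] with q h1 h2
    exact (mul_eq_zero.1 h1).resolve_left h2
  rw [this.fderiv_eq]
  simp

/-- The case without parameters. -/
theorem eventually_eq_zero_of_mul_eq_zero' {C a : P → ℝ} {p₁ : P}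
    (hC : ContDiff ℝ ∞ C) (hC' : fderiv ℝ C p₁ ≠ 0) (ha : Continuous a)
    (hmul : ∀ᶠ z in 𝓝 p₁, a z * C z = 0) : ∀ᶠ z in 𝓝 p₁, a z = 0 := by
  have hne : ∀ᶠ z in 𝓝 p₁, fderiv ℝ C z ≠ 0 :=
    (hC.continuous_fderiv (by simp)).continuousAt.eventually_ne hC'
  have key := eventually_eq_zero_of_mul_eq_zero (Y := Unit) (C := fun _ => C) (a := fun _ => a)
    (y₁ := ()) (p₁ := p₁)
  rw [nhds_prod_eq] at key
  have hs : Tendsto (Prod.snd : Unit × P → P) (𝓝 () ×ˢ 𝓝 p₁) (𝓝 p₁) := tendsto_snd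
  have h := key (hs.eventually hne) (Eventually.of_forall fun z => ha.continuousAt)
    (hs.eventually hmul)
  rw [← nhds_prod_eq] at h
  have : Continuous (fun q : P => ((), q)) := by fun_prop
  exact (this.tendsto p₁).eventually h

/-- If `A ^ 2 - B ^ 2` vanishes to second order on a hypersurface to which `A + B` restricts with
nonzero differential, then so does `A - B`. -/
theorem vanishing_sub_of_vanishing_sq_sub {A B σ : P → ℝ} {e o w : P}
    (hA : ContDiff ℝ ∞ A) (hB : ContDiff ℝ ∞ B)
    (hσ : ContDiff ℝ ∞ σ) (hσe : ∀ p (c : ℝ), σ (p + c • e) = σ p + c) (ho : σ o = 0)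
    (hw : fderiv ℝ σ o w = 0) (hAB : fderiv ℝ A o w + fderiv ℝ B o w ≠ 0)
    (hz : ∀ᶠ p in 𝓝 o, σ p = 0 → A p ^ 2 - B p ^ 2 = 0 ∧
      fderiv ℝ (fun p => A p ^ 2 - B p ^ 2) p e = 0) :
    ∀ᶠ p in 𝓝 o, σ p = 0 → A p - B p = 0 ∧ fderiv ℝ (fun p => A p - B p) p e = 0 := by
  -- Composition with the projection r onto {σ = 0} turns restrictions to the hypersurface into
  -- functions near o. The differential of A + B stays nonzero since w is tangent to the
  -- hypersurface.
  set r : P → P := fun p => p - σ p • e with hrdef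
  have hr : ContDiff ℝ ∞ r := contDiff_id.sub (hσ.smul contDiff_const)
  have hro : r o = o := by simp [hrdef, ho]
  have hrσ : ∀ p, σ (r p) = 0 := fun p => by
    have := hσe p (-σ p)
    rwa [neg_smul, ← sub_eq_add_neg, add_neg_cancel] at this
  have hrt : Tendsto r (𝓝 o) (𝓝 o) := by simpa [hro] using hr.continuous.tendsto o
  have hAd : Differentiable ℝ A := hA.differentiable (by simp)
  have hBd : Differentiable ℝ B := hB.differentiable (by simp)
  have hr' : HasFDerivAt r (ContinuousLinearMap.id ℝ P - (fderiv ℝ σ o).smulRight e) o :=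
    (hasFDerivAt_id o).sub
      (((hσ.differentiable (by simp)) o).hasFDerivAt.smul_const e)
  have hC : ContDiff ℝ ∞ fun p => A (r p) + B (r p) := (hA.comp hr).add (hB.comp hr)
  have hC' : fderiv ℝ (fun p => A (r p) + B (r p)) o ≠ 0 := by
    intro h0
    apply hAB
    have h1 : HasFDerivAt (fun p => A (r p) + B (r p)) _ o :=
      ((hAd (r o)).hasFDerivAt.comp o hr').add ((hBd (r o)).hasFDerivAt.comp o hr')
    rw [hro] at h1
    rw [h1.fderiv] at h0
    have := DFunLike.congr_fun h0 w
    simpa [hw] using this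
  have hz' := hrt.eventually hz
  have hval : ∀ᶠ p in 𝓝 o, A (r p) - B (r p) = 0 := by
    refine eventually_eq_zero_of_mul_eq_zero' hC hC'
      ((hA.continuous.comp hr.continuous).sub (hB.continuous.comp hr.continuous)) ?_
    filter_upwards [hz'] with p hp
    rw [← (hp (hrσ p)).1]; ring
  have hdA : Continuous (fderiv ℝ A) := hA.continuous_fderiv (by simp)
  have hdB : Continuous (fderiv ℝ B) := hB.continuous_fderiv (by simp)
  have hder : ∀ᶠ p in 𝓝 o, fderiv ℝ A (r p) e - fderiv ℝ B (r p) e = 0 := by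
    refine eventually_eq_zero_of_mul_eq_zero' hC hC'
      (((hdA.comp hr.continuous).clm_apply continuous_const).sub
        ((hdB.comp hr.continuous).clm_apply continuous_const)) ?_
    filter_upwards [hz', hval] with p hp hv
    have h1 := (hp (hrσ p)).2
    have h2 : HasFDerivAt (fun p => A p ^ 2 - B p ^ 2) _ (r p) :=
      ((hAd (r p)).hasFDerivAt.pow 2).sub ((hBd (r p)).hasFDerivAt.pow 2)
    rw [h2.fderiv] at h1
    simp at h1
    have h3 : A (r p) = B (r p) := sub_eq_zero.1 hv
    rw [h3] at h1 ⊢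
    linarith
  filter_upwards [hval, hder] with p h1 h2 hp
  have hrp : r p = p := by simp [hrdef, hp]
  rw [hrp] at h1 h2
  refine ⟨h1, ?_⟩
  rw [fderiv_fun_sub (hAd p) (hBd p)]
  simpa using h2

/-- The inverse function theorem, with germs of inverses represented by global smooth maps. -/
theorem exists_contDiff_local_inverse [FiniteDimensional ℝ P] {f : P → P} (hf : ContDiff ℝ ∞ f)
    {o : P} (hinj : Function.Injective (fderiv ℝ f o)) :
    ∃ g : P → P, ContDiff ℝ ∞ g ∧ (∀ᶠ p in 𝓝 o, g (f p) = p) ∧ ∀ᶠ q in 𝓝 (f o), f (g q) = q := by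
  have : CompleteSpace P := FiniteDimensional.complete ℝ P
  -- Smoothness of the inverse is needed on a whole neighbourhood, hence invertibility of the
  -- derivative at nearby points too.
  have hequiv : ∀ᶠ p in 𝓝 o, ∃ L : P ≃L[ℝ] P, HasFDerivAt f (L : P →L[ℝ] P) p := by
    let L₀ : P ≃L[ℝ] P := (LinearEquiv.ofInjectiveEndo (fderiv ℝ f o).toLinearMap hinj)
      |>.toContinuousLinearEquiv
    have hL₀ : (L₀ : P →L[ℝ] P) = fderiv ℝ f o := by ext; rfl
    have := (hf.continuous_fderiv (by simp)).continuousAt.preimage_mem_nhds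
      (by rw [← hL₀]; exact L₀.nhds)
    filter_upwards [this] with p ⟨L, hL⟩
    exact ⟨L, hL ▸ (hf.differentiable (by simp) p).hasFDerivAt⟩
  obtain ⟨L, hL⟩ := hequiv.self_of_nhds
  let Φ := hf.contDiffAt.toOpenPartialHomeomorph f hL (by simp)
  have hΦ : ∀ p, Φ p = f p := fun p => rfl
  have hos : o ∈ Φ.source := hf.contDiffAt.mem_toOpenPartialHomeomorph_source hL (by simp)
  have hot : f o ∈ Φ.target := Φ.map_source hos
  have hsymm : Tendsto Φ.symm (𝓝 (f o)) (𝓝 o) := by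
    have := Φ.symm.continuousAt (x := f o) hot
    rw [ContinuousAt] at this
    rwa [← hΦ o, Φ.left_inv hos] at this
  have hsm : ∀ᶠ q in 𝓝 (f o), ContDiffAt ℝ ∞ Φ.symm q := by
    filter_upwards [Φ.open_target.mem_nhds hot, hsymm.eventually hequiv] with q hq ⟨L', hL'⟩
    exact Φ.contDiffAt_symm hq hL' hf.contDiffAt
  obtain ⟨g, hg, hge⟩ := exists_contDiff_eventuallyEq hsm
  refine ⟨g, hg, ?_, ?_⟩
  · filter_upwards [(hf.continuous.tendsto o).eventually hge, Φ.open_source.mem_nhds hos]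
      with p h1 h2
    rw [h1]; exact Φ.left_inv h2
  · filter_upwards [hge, Φ.open_target.mem_nhds hot] with q h1 h2
    rw [h1]; exact Φ.right_inv h2

/-- A positive multiple of a square is, near a point of the zero set, the square of a smooth
function. -/
theorem exists_sq_eq [FiniteDimensional ℝ P] {f σ u : P → ℝ} {o : P}
    (hσ : ContDiff ℝ ∞ σ) (hu : ContDiff ℝ ∞ u) (ho : σ o = 0) (huo : 0 < u o)
    (hfu : ∀ᶠ p in 𝓝 o, f p = σ p ^ 2 * u p) :
    ∃ G : P → ℝ, ContDiff ℝ ∞ G ∧ G o = 0 ∧ (∀ᶠ p in 𝓝 o, G p ^ 2 = f p) ∧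
      ∃ c : ℝ, 0 < c ∧ fderiv ℝ G o = c • fderiv ℝ σ o := by
  have hpos : ∀ᶠ p in 𝓝 o, 0 < u p := hu.continuous.continuousAt.eventually (lt_mem_nhds huo)
  have hsq : ∀ᶠ p in 𝓝 o, ContDiffAt ℝ ∞ (fun p => σ p * √(u p)) p := by
    filter_upwards [hpos] with p hp
    exact hσ.contDiffAt.mul (hu.contDiffAt.sqrt hp.ne')
  obtain ⟨G, hG, hGe⟩ := exists_contDiff_eventuallyEq hsq
  refine ⟨G, hG, ?_, ?_, √(u o), Real.sqrt_pos.2 huo, ?_⟩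
  · rw [hGe.self_of_nhds]
    simp [ho]
  · filter_upwards [hGe, hfu, hpos] with p h1 h2 h3
    rw [h1, h2, mul_pow, Real.sq_sqrt h3.le]
  · rw [hGe.fderiv_eq, fderiv_fun_mul (hσ.differentiable (by simp) o)
      ((hu.contDiffAt.sqrt huo.ne').differentiableAt (n := ∞) (by simp)), ho]
    simp

end Analysis

/-! ### The model functions and the parametrization of the Lagrangian pieces. -/

section Model

variable {n : ℕ}

/-- The `a`-th coordinate on `ℝⁿ`, and zero for `a ≥ n`. -/
noncomputable def co (a : ℕ) : (Fin n → ℝ) →L[ℝ] ℝ :=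
  if h : a < n then ContinuousLinearMap.proj (R := ℝ) (φ := fun _ : Fin n => ℝ) ⟨a, h⟩ else 0

/-- The `a`-th standard basis vector of `ℝⁿ`, and zero for `a ≥ n`. -/
noncomputable def ev (a : ℕ) : Fin n → ℝ :=
  if h : a < n then Pi.single ⟨a, h⟩ 1 else 0

theorem co_of_lt {a : ℕ} (h : a < n) (x : Fin n → ℝ) : co a x = x ⟨a, h⟩ := by
  simp [co, h]

theorem co_val (k : Fin n) (x : Fin n → ℝ) : co k x = x k := co_of_lt k.isLt x

theorem co_ev_self {a : ℕ} (h : a < n) : co a (ev a : Fin n → ℝ) = 1 := by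
  simp [co_of_lt h, ev, h]

theorem co_ev_of_ne {a b : ℕ} (h : a ≠ b) : co a (ev b : Fin n → ℝ) = 0 := by
  by_cases ha : a < n
  · by_cases hb : b < n
    · rw [co_of_lt ha, ev, dif_pos hb, Pi.single_apply, if_neg]
      simpa [Fin.ext_iff] using h
    · simp [ev, hb]
  · simp [co, ha]

theorem ev_val (k : Fin n) : (ev k : Fin n → ℝ) = Pi.single k 1 := by
  simp [ev]

theorem ext_co {x y : Fin n → ℝ} (h : ∀ a < n, co a x = co a y) : x = y := by
  funext k
  simpa [co_val] using h k k.isLt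

/-- `H l a` is the function `h_l` in the `l` coordinates that start with the `a`-th one. -/
noncomputable def H : ℕ → ℕ → (Fin n → ℝ) → ℝ
  | 0, _, _ => 0
  | l + 1, a, x => co a x - H l (a + 1) x ^ 2

theorem H_zero_left (a : ℕ) (x : Fin n → ℝ) : H 0 a x = 0 := rfl

theorem H_succ (l a : ℕ) (x : Fin n → ℝ) : H (l + 1) a x = co a x - H l (a + 1) x ^ 2 := rfl

theorem contDiff_H (l a : ℕ) : ContDiff ℝ ∞ (H l a : (Fin n → ℝ) → ℝ) := by
  induction l generalizing a with
  | zero => exact contDiff_const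
  | succ l ih => exact (co a).contDiff.sub ((ih (a + 1)).pow 2)

theorem differentiable_H (l a : ℕ) : Differentiable ℝ (H l a : (Fin n → ℝ) → ℝ) :=
  (contDiff_H l a).differentiable (by simp)

theorem H_congr {l a : ℕ} {x y : Fin n → ℝ} (h : ∀ j, a ≤ j → j < a + l → co j x = co j y) :
    H l a x = H l a y := by
  induction l generalizing a with
  | zero => rfl
  | succ l ih =>
    rw [H_succ, H_succ, h a le_rfl (by omega), ih fun j h1 h2 => h j (by omega) (by omega)]

theorem H_zero_right (l a : ℕ) : H l a (0 : Fin n → ℝ) = 0 := by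
  induction l generalizing a with
  | zero => rfl
  | succ l ih => simp [H_succ, ih]

theorem H_eq_zero {l a : ℕ} {x : Fin n → ℝ} (h : ∀ j, a ≤ j → j < a + l → co j x = 0) :
    H l a x = 0 := by
  rw [H_congr (y := 0) (by simpa using h), H_zero_right]

theorem H_add_smul_ev_of_lt {l a b : ℕ} (h : b < a) (x : Fin n → ℝ) (c : ℝ) :
    H l a (x + c • ev b) = H l a x :=
  H_congr fun j h1 _ => by simp [co_ev_of_ne (show j ≠ b by omega)]

theorem H_succ_add_smul_ev {l a : ℕ} (h : a < n) (x : Fin n → ℝ) (c : ℝ) :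
    H (l + 1) a (x + c • ev a) = H (l + 1) a x + c := by
  rw [H_succ, H_succ, H_add_smul_ev_of_lt (by omega)]
  simp [co_ev_self h]
  ring

theorem fderiv_H_succ (l a : ℕ) (x : Fin n → ℝ) :
    fderiv ℝ (H (l + 1) a) x = co a - (2 * H l (a + 1) x) • fderiv ℝ (H l (a + 1)) x := by
  have h1 : HasFDerivAt (fun x => co a x - H l (a + 1) x ^ 2) _ x :=
    (co a).hasFDerivAt.sub ((differentiable_H l (a + 1) x).hasFDerivAt.pow 2)
  have h2 : (H (l + 1) a : (Fin n → ℝ) → ℝ) = fun x => co a x - H l (a + 1) x ^ 2 := rfl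
  rw [h2, h1.fderiv]
  simp

theorem fderiv_H_of_eq_zero {l a : ℕ} {x : Fin n → ℝ} (h : H l (a + 1) x = 0) :
    fderiv ℝ (H (l + 1) a) x = co a := by
  rw [fderiv_H_succ, h]; simp

theorem fderiv_H_ev {l a : ℕ} (ha : a < n) (x : Fin n → ℝ) :
    fderiv ℝ (H (l + 1) a) x (ev a) = 1 := by
  have h1 := (differentiable_H (l + 1) a x).hasFDerivAt
  have h2 : HasDerivAt (fun c : ℝ => x + c • (ev a : Fin n → ℝ)) (ev a) 0 := by
    simpa using ((hasDerivAt_id (0 : ℝ)).smul_const (ev a : Fin n → ℝ)).const_add x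
  have h3 : HasDerivAt (fun c : ℝ => H (l + 1) a (x + c • ev a))
      (fderiv ℝ (H (l + 1) a) x (ev a)) 0 := by
    refine HasFDerivAt.comp_hasDerivAt (l := H (l + 1) a) 0 ?_ h2
    simpa using h1
  have h4 : HasDerivAt (fun c : ℝ => H (l + 1) a (x + c • ev a)) 1 0 := by
    simp only [H_succ_add_smul_ev ha]
    simpa using (hasDerivAt_id (0 : ℝ)).const_add (H (l + 1) a x)
  exact h3.unique h4

/-- Where the inner function vanishes, the model functions have the same `1`-jet. -/
theorem H_jet_eq {l m b : ℕ} {w : Fin n → ℝ} (h : H l (b + (m + 1)) w = 0) :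
    H (m + 1 + l) b w = H (m + 1) b w ∧
      fderiv ℝ (H (m + 1 + l) b) w = fderiv ℝ (H (m + 1) b) w := by
  -- The inner function enters only through its square, whose 1-jet vanishes wherever the function
  -- does. The outer levels carry equal jets to equal jets.
  induction m generalizing b with
  | zero =>
    have e : 0 + 1 + l = l + 1 := by omega
    simp only [zero_add] at h
    rw [e, fderiv_H_succ, fderiv_H_succ, H_succ, H_succ, h]
    simp [H_zero_left]
  | succ m ih =>
    obtain ⟨h1, h2⟩ := ih (b := b + 1) (by rwa [show b + 1 + (m + 1) = b + (m + 1 + 1) by omega])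
    have e : m + 1 + 1 + l = (m + 1 + l) + 1 := by omega
    rw [e, fderiv_H_succ, fderiv_H_succ, H_succ, H_succ (m + 1), h1, h2]
    exact ⟨rfl, rfl⟩

/-- Passing to `H` keeps all functions on the fixed space ℝⁿ, so that the recursion shifts a
starting index instead of shortening the tuple. -/
theorem h_eq_H {l a : ℕ} (hl : a + l ≤ n) (x : Fin n → ℝ) :
    h l (fun k : Fin l => x ⟨a + k, by omega⟩) = H l a x := by
  induction l generalizing a with
  | zero => rfl
  | succ l ih =>
    rw [h, H_succ, co_of_lt (by omega), ← ih (by omega)]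
    congr 2
    congr 1
    funext k
    simp only [Fin.tail]
    congr 1
    ext
    simp
    omega

theorem hSq_eq (i : Fin (n + 1)) (x : Fin n → ℝ) : hSq n i x = H i 0 x ^ 2 := by
  rw [hSq, ← h_eq_H (by omega)]
  congr 2
  funext k
  congr 1
  ext
  simp

theorem contDiff_hSq (i : Fin (n + 1)) : ContDiff ℝ ∞ (hSq n i) := by
  have : hSq n i = fun x => H i 0 x ^ 2 := funext (hSq_eq i)
  rw [this]
  exact (contDiff_H i 0).pow 2

theorem co_tail (a : ℕ) (x : Fin (n + 1) → ℝ) : co a (Fin.tail x) = co (a + 1) x := by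
  by_cases h : a < n
  · rw [co_of_lt h, co_of_lt (by omega)]
    rfl
  · simp [co, h]

theorem H_tail (l a : ℕ) (x : Fin (n + 1) → ℝ) : H l a (Fin.tail x) = H l (a + 1) x := by
  induction l generalizing a with
  | zero => rfl
  | succ l ih => rw [H_succ, H_succ, ih, co_tail]

theorem hSq_tail (j : Fin (n + 1)) (x : Fin (n + 1) → ℝ) :
    hSq n j (Fin.tail x) = H j 1 x ^ 2 := by
  rw [hSq_eq, H_tail]

/-- H (j + 1) 0 = x₁ - hⱼ(x₂, …)² is a defining function of the hypersurface, so its gradient spans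
the conormal line. This ties `ell` to `conormalGraph`. -/
theorem fderiv_H_single_succ (j : Fin (n + 1)) (x : Fin (n + 1) → ℝ) (k : Fin n) :
    fderiv ℝ (H (j + 1) 0) x (Pi.single k.succ 1) =
      - fderiv ℝ (hSq n j) (Fin.tail x) (Pi.single k 1) := by
  let T : (Fin (n + 1) → ℝ) →L[ℝ] (Fin n → ℝ) :=
    ContinuousLinearMap.pi fun k => ContinuousLinearMap.proj k.succ
  have h1 : HasFDerivAt (fun x => hSq n j (T x)) ((fderiv ℝ (hSq n j) (T x)).comp T) x :=
    (((contDiff_hSq j).differentiable (by simp)) (T x)).hasFDerivAt.comp x T.hasFDerivAt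
  have h2 : HasFDerivAt (H (j + 1) 0)
      (co 0 - (fderiv ℝ (hSq n j) (T x)).comp T) x := by
    have := (co 0 : (Fin (n + 1) → ℝ) →L[ℝ] ℝ).hasFDerivAt (x := x) |>.sub h1
    have he : (H (j + 1) 0 : (Fin (n + 1) → ℝ) → ℝ) = ⇑(co 0) - fun x => hSq n j (T x) := by
      funext x
      rw [H_succ, Pi.sub_apply, show T x = Fin.tail x from rfl, hSq_tail]
    rw [he]
    exact this
  rw [h2.fderiv]
  have h3 : T (Pi.single k.succ 1) = Pi.single k 1 := by
    funext i
    simp [T, Pi.single_apply]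
  simp only [sub_apply, ContinuousLinearMap.comp_apply, h3, zero_sub,
    show co 0 (Pi.single k.succ (1 : ℝ) : Fin (n + 1) → ℝ) = 0 by simp [co]]
  rfl

/-- The vector of values of a linear functional on the standard basis. -/
def gradVec (L : (Fin n → ℝ) →L[ℝ] ℝ) : Fin n → ℝ := fun k => L (Pi.single k 1)

theorem gradVec_co_zero : gradVec (co 0 : (Fin n → ℝ) →L[ℝ] ℝ) = ev 0 := by
  funext k
  by_cases hn : 0 < n
  · rw [gradVec, co_of_lt hn, ev, dif_pos hn, Pi.single_apply, Pi.single_apply]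
    simp [eq_comm]
  · exact absurd (Nat.lt_of_le_of_lt (Nat.zero_le _) k.isLt) hn

theorem sum_gradVec_mul (L : (Fin n → ℝ) →L[ℝ] ℝ) (x : Fin n → ℝ) :
    ∑ k, gradVec L k * x k = L x := by
  conv_rhs => rw [← Finset.univ_sum_single x, map_sum]
  refine Finset.sum_congr rfl fun k _ => ?_
  have : Pi.single k (x k) = x k • (Pi.single k 1 : Fin n → ℝ) := by
    rw [← Pi.single_smul, smul_eq_mul, mul_one]
  rw [this, map_smul, smul_eq_mul, mul_comm]
  rfl

/-- The parametrization of the pieces `ⁿLᵢ`: of the zero section by `x`, and of the conormal of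
the hypersurface `{hᵢ = 0}` by `(p₁, x₂, …, xₙ)`. -/
noncomputable def ell : ℕ → (Fin n → ℝ) → Cot n
  | 0, w => (w, 0)
  | i + 1, w => (w - H (i + 1) 0 w • ev 0, co 0 w • gradVec (fderiv ℝ (H (i + 1) 0) w))

/-- The linear left inverse of the parametrization. -/
noncomputable def lam : ℕ → Cot n →L[ℝ] (Fin n → ℝ)
  | 0 => ContinuousLinearMap.fst ℝ _ _
  | _ + 1 => ContinuousLinearMap.fst ℝ _ _ +
      ((co 0).comp (ContinuousLinearMap.snd ℝ _ _) -
        (co 0).comp (ContinuousLinearMap.fst ℝ _ _)).smulRight (ev 0)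

/-- For i ≥ 1, since ∂H/∂x₁ = 1, the first momentum of `ell i w` is w₁, and w is recovered from x by
putting p₁ in place of x₁. -/
theorem lam_ell {i : ℕ} (hi : i ≤ n) (w : Fin n → ℝ) : lam i (ell i w) = w := by
  cases i with
  | zero => rfl
  | succ i =>
    have hn : 0 < n := by omega
    have h1 : co 0 (gradVec (fderiv ℝ (H (i + 1) 0) w)) = 1 := by
      rw [co_of_lt hn, gradVec]
      have := fderiv_H_ev (l := i) hn w
      rwa [ev, dif_pos hn] at this
    simp only [lam, ell, add_apply, ContinuousLinearMap.smulRight_apply, sub_apply,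
      ContinuousLinearMap.comp_apply, ContinuousLinearMap.coe_fst', ContinuousLinearMap.coe_snd',
      map_smul, map_sub, h1, co_ev_self hn, smul_eq_mul, mul_one]
    module

theorem ell_mem_lagPiece (i : Fin (n + 1)) (w : Fin n → ℝ) : ell i w ∈ lagPiece n i := by
  cases n with
  | zero =>
    obtain rfl : i = 0 := Fin.fin_one_eq_zero i
    rfl
  | succ m =>
    refine Fin.cases ?_ (fun j => ?_) i
    · rfl
    · have ht : Fin.tail (w - H (j + 1) 0 w • ev 0) = Fin.tail w := by
        funext k
        simp [Fin.tail, ev]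
      refine ⟨?_, fun k => ?_⟩
      · change (w - H (j + 1) 0 w • ev 0 : Fin (m + 1) → ℝ) 0 =
          hSq m j (Fin.tail (w - H (j + 1) 0 w • ev 0))
        rw [ht, hSq_tail, H_succ]
        simp [ev, co]
      · change co 0 w * gradVec (fderiv ℝ (H (j + 1) 0) w) k.succ =
          - (co 0 w * gradVec (fderiv ℝ (H (j + 1) 0) w) 0) *
          fderiv ℝ (hSq m j) (Fin.tail (w - H (j + 1) 0 w • ev 0)) (Pi.single k 1)
        have h1 : gradVec (fderiv ℝ (H (j + 1) 0) w) 0 = 1 := by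
          exact fderiv_H_ev (l := (j : ℕ)) (Nat.succ_pos m) w
        rw [ht, h1, gradVec, fderiv_H_single_succ]
        ring

/-- With `ell_mem_lagPiece` and `lam_ell`, this makes `ell i` a global parametrization of ⁿLᵢ by ℝⁿ.
-/
theorem eq_ell_lam_of_mem {i : Fin (n + 1)} {z : Cot n} (hz : z ∈ lagPiece n i) :
    z = ell i (lam i z) := by
  cases n with
  | zero => exact Subsingleton.elim _ _
  | succ m =>
    revert hz
    refine Fin.cases (fun hz => ?_) (fun j hz => ?_) i
    · exact Prod.ext rfl hz
    · obtain ⟨h1, h2⟩ := hz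
      have hc0 : ∀ x : Fin (m + 1) → ℝ, co 0 x = x 0 := fun x => co_of_lt (Nat.succ_pos m) x
      set w := lam (j + 1) z with hw
      have hw' : w = z.1 + (z.2 0 - z.1 0) • ev 0 := by
        simp [hw, lam, hc0]
      have hw0 : co 0 w = z.2 0 := by
        rw [hw', map_add, map_smul, co_ev_self (Nat.succ_pos m), hc0]
        simp
      have ht : Fin.tail w = Fin.tail z.1 := by
        rw [hw']
        funext k
        simp [Fin.tail, ev]
      have hH : H (j + 1) 0 w = z.2 0 - z.1 0 := by
        rw [H_succ, hw0, ← hSq_tail, ht, ← h1]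
      change z = (w - H (j + 1) 0 w • ev 0, co 0 w • gradVec (fderiv ℝ (H (j + 1) 0) w))
      refine Prod.ext ?_ ?_
      · change z.1 = w - H (j + 1) 0 w • ev 0
        rw [hH, hw']
        simp
      · change z.2 = co 0 w • gradVec (fderiv ℝ (H (j + 1) 0) w)
        rw [hw0]
        funext k
        refine Fin.cases ?_ (fun k => ?_) k
        · have h1 : gradVec (fderiv ℝ (H (j + 1) 0) w) 0 = 1 := by
            exact fderiv_H_ev (l := (j : ℕ)) (Nat.succ_pos m) w
          simp [h1]
        · rw [h2 k, Pi.smul_apply, gradVec, fderiv_H_single_succ, ht]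
          simp

theorem contDiff_gradVec {P : Type*} [NormedAddCommGroup P] [NormedSpace ℝ P]
    {f : P → (Fin n → ℝ) →L[ℝ] ℝ} (hf : ContDiff ℝ ∞ f) : ContDiff ℝ ∞ fun p => gradVec (f p) :=
  contDiff_pi.2 fun _ => hf.clm_apply contDiff_const

theorem contDiff_ell (i : ℕ) : ContDiff ℝ ∞ (ell i : (Fin n → ℝ) → Cot n) := by
  cases i with
  | zero => exact contDiff_id.prodMk contDiff_const
  | succ i =>
    exact (contDiff_id.sub ((contDiff_H (i + 1) 0).smul contDiff_const)).prodMk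
      ((co 0).contDiff.smul (contDiff_gradVec ((contDiff_H (i + 1) 0).fderiv_right (by simp))))

theorem ell_zero_right (i : ℕ) : ell i (0 : Fin n → ℝ) = 0 := by
  cases i with
  | zero => rfl
  | succ i => simp [ell, H_zero_right]

theorem fderiv_ell_zero (w v : Fin n → ℝ) : fderiv ℝ (ell 0) w v = (v, 0) := by
  have h1 : HasFDerivAt (fun w : Fin n → ℝ => ((w, 0) : Cot n))
      ((ContinuousLinearMap.id ℝ _).prod 0) w :=
    (hasFDerivAt_id w).prodMk (hasFDerivAt_const _ _)
  have h2 : (ell 0 : (Fin n → ℝ) → Cot n) = fun w => (w, 0) := rfl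
  rw [h2, h1.fderiv]
  rfl

theorem fderiv_ell_succ (i : ℕ) (w v : Fin n → ℝ) :
    (fderiv ℝ (ell (i + 1)) w v).1 = v - fderiv ℝ (H (i + 1) 0) w v • ev 0 := by
  have h1 : HasFDerivAt (fun w : Fin n → ℝ => (ell (i + 1) w).1)
      ((ContinuousLinearMap.fst ℝ _ _).comp (fderiv ℝ (ell (i + 1)) w)) w :=
    (ContinuousLinearMap.fst ℝ (Fin n → ℝ) (Fin n → ℝ)).hasFDerivAt.comp w
      (((contDiff_ell (i + 1)).differentiable (by simp)) w).hasFDerivAt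
  have h2 : HasFDerivAt (fun w : Fin n → ℝ => (ell (i + 1) w).1)
      (ContinuousLinearMap.id ℝ _ - (fderiv ℝ (H (i + 1) 0) w).smulRight (ev 0)) w :=
    (hasFDerivAt_id w).sub ((differentiable_H (i + 1) 0 w).hasFDerivAt.smul_const _)
  have := DFunLike.congr_fun (h1.unique h2) v
  simpa using this

/-- Every defining function has differential dx₁ at the origin, so all conormals have the same
tangent space there. -/
theorem fderiv_ell_succ_zero (i : ℕ) (v : Fin n → ℝ) :
    fderiv ℝ (ell (i + 1)) 0 v = (v - co 0 v • ev 0, co 0 v • ev 0) := by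
  have hH : fderiv ℝ (H (i + 1) 0) (0 : Fin n → ℝ) = co 0 := fderiv_H_of_eq_zero (H_zero_right _ _)
  refine Prod.ext ?_ ?_
  · rw [fderiv_ell_succ, hH]
  · have h1 : HasFDerivAt (fun w : Fin n → ℝ => (ell (i + 1) w).2)
        ((ContinuousLinearMap.snd ℝ _ _).comp (fderiv ℝ (ell (i + 1)) 0)) 0 :=
      (ContinuousLinearMap.snd ℝ (Fin n → ℝ) (Fin n → ℝ)).hasFDerivAt.comp 0
        (((contDiff_ell (i + 1)).differentiable (by simp)) 0).hasFDerivAt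
    have h3 : ContDiff ℝ ∞ fun w : Fin n → ℝ => gradVec (fderiv ℝ (H (i + 1) 0) w) :=
      contDiff_gradVec ((contDiff_H (i + 1) 0).fderiv_right (by simp))
    have h2 : HasFDerivAt (fun w : Fin n → ℝ => (ell (i + 1) w).2) _ 0 :=
      (co 0 : (Fin n → ℝ) →L[ℝ] ℝ).hasFDerivAt.smul ((h3.differentiable (by simp)) 0).hasFDerivAt
    have := DFunLike.congr_fun (h1.unique h2) v
    simpa [hH, gradVec_co_zero] using this

/-- The Liouville form vanishes on the pieces of the Lagrangian. -/
theorem liouvilleForm_ell {i : ℕ} (hi : i ≤ n) (w v : Fin n → ℝ) :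
    liouvilleForm (ell i w) (fderiv ℝ (ell i) w v) = 0 := by
  cases i with
  | zero => simp [liouvilleForm, ell]
  | succ i =>
    have hn : 0 < n := by omega
    rw [liouvilleForm, fderiv_ell_succ]
    have : ∀ k, (ell (i + 1) w).2 k * (v - fderiv ℝ (H (i + 1) 0) w v • ev 0 : Fin n → ℝ) k =
        co 0 w * (gradVec (fderiv ℝ (H (i + 1) 0) w) k *
          (v - fderiv ℝ (H (i + 1) 0) w v • ev 0 : Fin n → ℝ) k) := fun k => by
      simp only [ell, Pi.smul_apply, smul_eq_mul]
      ring
    -- The momentum is a multiple of dH, and dH kills the base velocity v - dH(v) e₀ because dH(e₀)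
    -- = 1.
    rw [Finset.sum_congr rfl fun k _ => this k, ← Finset.mul_sum, sum_gradVec_mul, map_sub, map_smul,
      fderiv_H_ev hn]
    simp

/-- A point `ell i w` with i ≥ 1 depends only on the 1-jet of H i 0 at w, and `H_jet_eq` compares
these jets. This is the intersection locus of two conormals. -/
theorem ell_eq_ell {a l : ℕ} {w : Fin n → ℝ} (h : H l (a + 1) w = 0) :
    ell (a + 1 + l) w = ell (a + 1) w := by
  obtain ⟨h1, h2⟩ := H_jet_eq (l := l) (m := a) (b := 0) (w := w) (by simpa using h)
  have e : a + 1 + l = (a + l) + 1 := by omega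
  rw [e] at h1 h2 ⊢
  rw [ell, ell, h1, h2]

/-- A conormal meets the zero section where p₁ = 0. -/
theorem ell_of_co_zero (i : ℕ) {w : Fin n → ℝ} (h : co 0 w = 0) :
    ell (i + 1) w = ell 0 (w - H (i + 1) 0 w • ev 0) := by
  simp [ell, h]

/-- The fibre over the origin is the same line for all conormals. The coefficient of tangency with
the zero section is read off on this line. -/
theorem ell_smul_ev (hn : 0 < n) (i : ℕ) (t : ℝ) :
    ell (i + 1) (t • ev 0 : Fin n → ℝ) = (0, t • ev 0) := by
  have h1 : H (i + 1) 0 (t • ev 0 : Fin n → ℝ) = t := by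
    have := H_succ_add_smul_ev (l := i) hn 0 t
    simpa [H_zero_right] using this
  have h2 : H i (0 + 1) (t • ev 0 : Fin n → ℝ) = 0 := by
    have := H_add_smul_ev_of_lt (l := i) (show 0 < 0 + 1 by omega) (0 : Fin n → ℝ) t
    simpa [H_zero_right] using this
  rw [ell, h1, fderiv_H_of_eq_zero h2, gradVec_co_zero, map_smul, co_ev_self hn]
  simp

/-- The intersection with the conormal, seen from the zero section: it lies over the hypersurface
itself. -/
theorem ell_of_H_eq_zero {i : ℕ} (hn : 0 < n) {x : Fin n → ℝ} (h : H (i + 1) 0 x = 0) :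
    ell (i + 1) (x - co 0 x • ev 0) = ell 0 x := by
  have h0 : co 0 (x - co 0 x • ev 0) = 0 := by simp [co_ev_self hn]
  have h1 : H (i + 1) 0 (x - co 0 x • ev 0) = - co 0 x := by
    have := H_succ_add_smul_ev (l := i) hn x (-co 0 x)
    rw [h, neg_smul, ← sub_eq_add_neg] at this
    simpa using this
  rw [ell_of_co_zero i h0, h1]
  simp

theorem mem_modelFront_iff {q : FrontSpace n} :
    q ∈ modelFront n ↔ ∃ i ≤ n, q.1 = H i 0 q.2 ^ 2 := by
  simp only [modelFront, mem_iUnion, mem_ofPred_eq, hSq_eq]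
  constructor
  · rintro ⟨i, hi⟩
    exact ⟨i, by omega, hi⟩
  · rintro ⟨i, hin, hi⟩
    exact ⟨⟨i, by omega⟩, hi⟩

theorem mem_extLag_iff {z : Cot n} : z ∈ extLag n ↔ ∃ i ≤ n, ∃ w, z = ell i w := by
  simp only [extLag, mem_iUnion]
  constructor
  · rintro ⟨i, hi⟩
    exact ⟨i, by omega, _, eq_ell_lam_of_mem hi⟩
  · rintro ⟨i, hin, w, rfl⟩
    exact ⟨⟨i, by omega⟩, ell_mem_lagPiece (⟨i, by omega⟩ : Fin (n + 1)) w⟩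

/-- The tangent space at the origin of a piece of the Lagrangian. -/
theorem tangentSpan_lagPiece_le (i : Fin (n + 1)) :
    tangentSpan (lagPiece n i) 0 ≤ LinearMap.range (fderiv ℝ (ell (n := n) i) 0).toLinearMap := by
  refine Submodule.span_le.2 ?_
  rintro v ⟨γ, hγ, hmem, h0, rfl⟩
  have hd : HasDerivAt γ (deriv γ 0) 0 := (hγ.differentiable (by simp) 0).hasDerivAt
  have h1 : HasDerivAt (fun t => lam (n := n) i (γ t)) (lam i (deriv γ 0)) 0 :=
    (lam (n := n) i).hasFDerivAt.comp_hasDerivAt 0 hd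
  have h2 : HasFDerivAt (ell (n := n) i) (fderiv ℝ (ell (n := n) i) 0) (lam (n := n) i (γ 0)) := by
    rw [h0, map_zero]
    exact (((contDiff_ell i).differentiable (by simp)) 0).hasFDerivAt
  have h3 := h2.comp_hasDerivAt 0 h1
  have h4 : (ell (n := n) i ∘ fun t => lam (n := n) i (γ t)) = γ :=
    funext fun t => (eq_ell_lam_of_mem (hmem t)).symm
  rw [h4] at h3
  exact ⟨_, h3.unique hd⟩

end Model

/-! ### Nondegenerate tangency of the conormal fronts with the front of the zero section. -/

section Hessian

variable {n : ℕ}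

/-- The linear functional `ν ↦ ∑ pₖ νₖ`. -/
noncomputable def dotL (p : Fin n → ℝ) : (Fin n → ℝ) →L[ℝ] ℝ :=
  ∑ k, p k • ContinuousLinearMap.proj (R := ℝ) (φ := fun _ : Fin n => ℝ) k

theorem dotL_apply (p ν : Fin n → ℝ) : dotL p ν = ∑ k, p k * ν k := by
  simp [dotL]

theorem contDiff_dotL {P : Type*} [NormedAddCommGroup P] [NormedSpace ℝ P] {f : P → Fin n → ℝ}
    (hf : ContDiff ℝ ∞ f) : ContDiff ℝ ∞ fun p => dotL (f p) :=
  ContDiff.sum fun k _ => (contDiff_pi.1 hf k).smul contDiff_const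

theorem contactForm_eq (q w : J1 n) : contactForm q w = w.1 + dotL q.2.2 w.2.1 := by
  rw [contactForm, dotL_apply]

theorem hasDerivAt_comp_smul {P F : Type*} [NormedAddCommGroup P] [NormedSpace ℝ P]
    [NormedAddCommGroup F] [NormedSpace ℝ F] {G : P → F} (hG : ContDiff ℝ ∞ G) (w : P) (t : ℝ) :
    HasDerivAt (fun t : ℝ => G (t • w)) (fderiv ℝ G (t • w) w) t := by
  have h1 : HasDerivAt (fun t : ℝ => t • w) w t := by
    simpa using (hasDerivAt_id t).smul_const w
  exact (hG.differentiable (by simp) (t • w)).hasFDerivAt.comp_hasDerivAt t h1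

theorem hasDerivAt_clm_comp_smul {P F : Type*} [NormedAddCommGroup P] [NormedSpace ℝ P]
    [NormedAddCommGroup F] [NormedSpace ℝ F] {G : P → F →L[ℝ] ℝ} (hG : ContDiff ℝ ∞ G) (w : P)
    (v : F) : HasDerivAt (fun t : ℝ => G (t • w) v) (fderiv ℝ G 0 w v) 0 := by
  have h1 := hasDerivAt_comp_smul hG w 0
  rw [zero_smul] at h1
  exact (ContinuousLinearMap.apply ℝ ℝ v).hasFDerivAt.comp_hasDerivAt (0 : ℝ) h1

/-- A function with vanishing `1`-jet whose restriction to a line through the origin is `t² u(t)`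
has second derivative `2 u(0)` along the line. -/
theorem sndDeriv_eq_of_eq_sq_mul {P : Type*} [NormedAddCommGroup P] [NormedSpace ℝ P] {Q : P → ℝ}
    (hQ : ContDiff ℝ ∞ Q) {u : ℝ → ℝ} (hu : ContDiff ℝ ∞ u) {w : P}
    (h : ∀ᶠ t : ℝ in 𝓝 0, Q (t • w) = t ^ 2 * u t) :
    fderiv ℝ (fderiv ℝ Q) 0 w w = 2 * u 0 := by
  have h1 : ∀ᶠ t : ℝ in 𝓝 0, fderiv ℝ Q (t • w) w = 2 * t * u t + t ^ 2 * deriv u t := by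
    filter_upwards [h.eventually_nhds] with t ht
    have h3 : HasDerivAt (fun t : ℝ => t ^ 2 * u t) (2 * t * u t + t ^ 2 * deriv u t) t :=
      ((hasDerivAt_pow 2 t).fun_mul (hu.differentiable (by simp) t).hasDerivAt).congr_deriv (by simp)
    exact (hasDerivAt_comp_smul hQ w t).unique (h3.congr_of_eventuallyEq ht)
  have h4 := hasDerivAt_clm_comp_smul (hQ.fderiv_right (m := ∞) (by simp)) w w
  have hu' : ContDiff ℝ ∞ (deriv u) := ((contDiff_infty_iff_deriv).1 hu).2
  have h5 : HasDerivAt (fun t : ℝ => 2 * t * u t + t ^ 2 * deriv u t) (2 * u 0) 0 := by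
    have a1 : HasDerivAt (fun t : ℝ => 2 * t) (2 * 1) 0 := (hasDerivAt_id (0 : ℝ)).const_mul 2
    exact ((a1.fun_mul (hu.differentiable (by simp) 0).hasDerivAt).fun_add
      ((hasDerivAt_pow 2 (0 : ℝ)).fun_mul (hu'.differentiable (by simp) 0).hasDerivAt)).congr_deriv
      (by simp)
  exact h4.unique (h5.congr_of_eventuallyEq h1)

/-- The fronts of the zero section and of a conormal have nondegenerate quadratic tangency. -/
theorem tangency_nondegenerate {φ : Cot n → J1 n} (hφ : ContDiff ℝ ∞ φ)
    {f₀ : (Fin n → ℝ) → ℝ} (hf₀ : ContDiff ℝ ∞ f₀) {k : Cot n → ℝ} (hk : ContinuousAt k 0)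
    (hk0 : k 0 ≠ 0)
    (hcontact : ∀ᶠ z in 𝓝 (0 : Cot n), ∀ w,
      contactForm (φ z) (fderiv ℝ φ z w) = k z * liouvilleForm z w)
    (hjet : ∀ᶠ x in 𝓝 (0 : Fin n → ℝ), fderiv ℝ f₀ (φ (x, 0)).2.1 = - dotL (φ (x, 0)).2.2)
    {v : Fin n → ℝ} (hv : (fderiv ℝ φ 0 (v, 0)).2.1 = (fderiv ℝ φ 0 (0, ev 0)).2.1)
    (hv0 : co 0 v ≠ 0) {u : ℝ → ℝ} (hu : ContDiff ℝ ∞ u)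
    (hQu : ∀ᶠ t : ℝ in 𝓝 0,
      (φ (0, t • ev 0)).1 - f₀ (φ (0, t • ev 0)).2.1 = t ^ 2 * u t) : u 0 ≠ 0 := by
  set Q : Cot n → ℝ := fun z => (φ z).1 - f₀ (φ z).2.1 with hQdef
  have hbase : ContDiff ℝ ∞ fun z => (φ z).2.1 := hφ.snd.fst
  have hQ : ContDiff ℝ ∞ Q := hφ.fst.sub (hf₀.comp hbase)
  set M : Cot n → (Fin n → ℝ) →L[ℝ] ℝ := fun z => dotL (φ z).2.2 + fderiv ℝ f₀ (φ z).2.1 with hMdef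
  have hM : ContDiff ℝ ∞ M :=
    (contDiff_dotL hφ.snd.snd).add ((hf₀.fderiv_right (m := ∞) (by simp)).comp hbase)
  have hφd : Differentiable ℝ φ := hφ.differentiable (by simp)
  -- The contact condition replaces dx₀ by k λ - p dx, with λ the Liouville form. The covector M = p
  -- + df₀ that remains vanishes on the zero section.
  have hdQ : ∀ᶠ z in 𝓝 (0 : Cot n), ∀ w,
      fderiv ℝ Q z w = k z * liouvilleForm z w - M z (fderiv ℝ φ z w).2.1 := by
    filter_upwards [hcontact] with z hz w
    have h1 := (hφd z).hasFDerivAt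
    have h2 : HasFDerivAt Q _ z :=
      h1.fst.sub (((hf₀.differentiable (by simp)) (φ z).2.1).hasFDerivAt.comp z h1.snd.fst)
    rw [h2.fderiv, ← hz w, contactForm_eq]
    simp only [hMdef, sub_apply, add_apply, ContinuousLinearMap.comp_apply,
      ContinuousLinearMap.coe_fst', ContinuousLinearMap.coe_snd']
    ring
  have hM0 : ∀ᶠ x in 𝓝 (0 : Fin n → ℝ), M (x, 0) = 0 := by
    filter_upwards [hjet] with x hx
    simp [hMdef, hx]
  have hd2 : ∀ w w' : Cot n, HasDerivAt (fun t : ℝ => fderiv ℝ Q (t • w) w')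
      (fderiv ℝ (fderiv ℝ Q) 0 w w') 0 := fun w w' =>
    hasDerivAt_clm_comp_smul (hQ.fderiv_right (m := ∞) (by simp)) w w'
  have hlt : ∀ w : Cot n, Tendsto (fun t : ℝ => t • w) (𝓝 0) (𝓝 0) := fun w => by
    have : Continuous fun t : ℝ => t • w := by fun_prop
    simpa using this.tendsto 0
  set w₁ : Cot n := (0, ev 0) with hw₁
  -- Symmetry of the Hessian is the key. Since (v, 0) and w₁ have the same base image, the M-term is
  -- the same in D²Q(w₁, (v, 0)), which is 0 by symmetry, and in D²Q(w₁, w₁). Hence D²Q(w₁, w₁) =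
  -- -k(0) · co 0 v.
  have hsymm : fderiv ℝ (fderiv ℝ Q) 0 w₁ (v, 0) = fderiv ℝ (fderiv ℝ Q) 0 (v, 0) w₁ :=
    (hQ.contDiffAt (x := 0)).isSymmSndFDerivAt
      (by rw [minSmoothness_of_isRCLikeNormedField]; exact WithTop.coe_le_coe.2 (le_top (a := (2 : ℕ∞)))) w₁ (v, 0)
  have hzero : fderiv ℝ (fderiv ℝ Q) 0 (v, 0) w₁ = 0 := by
    refine (hd2 (v, 0) w₁).unique ((hasDerivAt_const (0 : ℝ) (0 : ℝ)).congr_of_eventuallyEq ?_)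
    have hx : Tendsto (fun t : ℝ => t • v) (𝓝 0) (𝓝 0) := by
      have : Continuous fun t : ℝ => t • v := by fun_prop
      simpa using this.tendsto 0
    filter_upwards [(hlt (v, 0)).eventually hdQ, hx.eventually hM0] with t h1 h2
    rw [h1, show t • ((v, 0) : Cot n) = (t • v, 0) by simp, h2]
    simp [liouvilleForm]
  have hformula : ∀ w : Cot n, fderiv ℝ (fderiv ℝ Q) 0 w₁ w =
      k 0 * co 0 w.1 - fderiv ℝ M 0 w₁ (fderiv ℝ φ 0 w).2.1 := by
    intro w
    have h1 : HasDerivAt (fun t : ℝ => k (t • w₁) * liouvilleForm (t • w₁) w)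
        (k 0 * co 0 w.1) 0 := by
      have hl : ∀ t : ℝ, liouvilleForm (t • w₁) w = t * co 0 w.1 := by
        intro t
        rw [liouvilleForm]
        have : ∀ i, (t • w₁).2 i * w.1 i = t * (gradVec (co 0) i * w.1 i) := fun i => by
          rw [gradVec_co_zero]
          simp [hw₁, mul_assoc]
        rw [Finset.sum_congr rfl fun i _ => this i, ← Finset.mul_sum, sum_gradVec_mul]
      simp only [hl]
      -- Only continuity of k at the origin is available; the factor t makes the product
      -- differentiable at 0.
      rw [hasDerivAt_iff_tendsto_slope]
      have hk' : Tendsto (fun t : ℝ => k (t • w₁) * co 0 w.1) (𝓝[≠] 0) (𝓝 (k 0 * co 0 w.1)) :=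
        ((hk.tendsto.comp (hlt w₁)).mul_const _).mono_left nhdsWithin_le_nhds
      refine hk'.congr' ?_
      filter_upwards [self_mem_nhdsWithin] with t ht
      have ht' : t ≠ 0 := ht
      simp only [slope_def_field]
      field_simp
      simp
      ring
    have h2 : HasDerivAt (fun t : ℝ => M (t • w₁) (fderiv ℝ φ (t • w₁) w).2.1)
        (fderiv ℝ M 0 w₁ (fderiv ℝ φ 0 w).2.1) 0 := by
      have hMd := hasDerivAt_comp_smul hM w₁ 0
      have hb : ContDiff ℝ ∞ fun z => (fderiv ℝ φ z w).2.1 :=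
        ((hφ.fderiv_right (m := ∞) (by simp)).clm_apply contDiff_const).snd.fst
      have hbd := hasDerivAt_comp_smul hb w₁ 0
      have hM00 : M 0 = 0 := hM0.self_of_nhds
      refine (hMd.clm_apply hbd).congr_deriv ?_
      rw [zero_smul, hM00]
      simp
    refine (hd2 w₁ w).unique ((h1.sub h2).congr_of_eventuallyEq ?_)
    filter_upwards [(hlt w₁).eventually hdQ] with t ht
    rw [ht]
    rfl
  have e1 := hformula (v, 0)
  have e2 := hformula w₁
  rw [hsymm, hzero] at e1
  simp only [hv] at e1
  have e3 : fderiv ℝ (fderiv ℝ Q) 0 w₁ w₁ = 2 * u 0 := by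
    refine sndDeriv_eq_of_eq_sq_mul hQ hu ?_
    filter_upwards [hQu] with t ht
    rw [hQdef, hw₁]
    simpa using ht
  intro hu0
  rw [e3, hu0] at e2
  have : k 0 * co 0 v = 0 := by
    simp only [hw₁, map_zero] at e2
    linarith
  exact (mul_ne_zero hk0 hv0) this

end Hessian

/-! ### Fronts of the pieces as graphs, for a local family. -/

section LocalFamily

variable {n : ℕ} {E : Type} [NormedAddCommGroup E] [NormedSpace ℝ E]

/-- The derivative at the origin of the composition of an embedding with the projection to the
base. -/
noncomputable def dbase (Φ : E × Cot n → J1 n) (y₁ : E) : Cot n →L[ℝ] (Fin n → ℝ) :=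
  (ContinuousLinearMap.fst ℝ _ _).comp ((ContinuousLinearMap.snd ℝ _ _).comp
    ((fderiv ℝ Φ (y₁, 0)).comp (ContinuousLinearMap.inr ℝ E (Cot n))))

theorem dbase_apply (Φ : E × Cot n → J1 n) (y₁ : E) (w : Cot n) :
    dbase Φ y₁ w = (fderiv ℝ Φ (y₁, 0) (0, w)).2.1 := rfl

/-- The properties near `(y₁, 0)` of a smooth family of transverse Weinstein hypersurface
embeddings. -/
structure IsLocalFamily (Φ : E × Cot n → J1 n) (k : E × Cot n → ℝ) (y₁ : E) : Prop where
  smooth : ContDiff ℝ ∞ Φ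
  contact : ∀ᶠ a in 𝓝 (y₁, (0 : Cot n)), ∀ w,
    contactForm (Φ a) (fderiv ℝ Φ a (0, w)) = k a * liouvilleForm a.2 w
  cont : ContinuousAt (fun z => k (y₁, z)) 0
  ne : k (y₁, 0) ≠ 0
  transverse : ∀ i ≤ n, Function.Injective fun w => dbase Φ y₁ (fderiv ℝ (ell i) 0 w)

/-- The projection to the base of the image of the `i`-th piece. -/
noncomputable def baseMap {E : Type*} (Φ : E × Cot n → J1 n) (i : ℕ) (p : E × (Fin n → ℝ)) :
    E × (Fin n → ℝ) :=
  (p.1, (Φ (p.1, ell i p.2)).2.1)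

/-- The common value of the base maps at the origin. -/
def center {E : Type*} (Φ : E × Cot n → J1 n) (y₁ : E) : E × (Fin n → ℝ) := (y₁, (Φ (y₁, 0)).2.1)

theorem baseMap_zero {E : Type*} (Φ : E × Cot n → J1 n) (i : ℕ) (y₁ : E) :
    baseMap Φ i (y₁, 0) = center Φ y₁ := by
  simp [baseMap, center, ell_zero_right]

/-- Local inverses `K i` of the base maps, and the functions `f i` whose graphs are the fronts of
the pieces. -/
structure FrontData (Φ : E × Cot n → J1 n) (y₁ : E) (f : ℕ → E × (Fin n → ℝ) → ℝ)
    (K : ℕ → E × (Fin n → ℝ) → E × (Fin n → ℝ)) : Prop where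
  contDiff_inv : ∀ i ≤ n, ContDiff ℝ ∞ (K i)
  left_inv : ∀ i ≤ n, ∀ᶠ p in 𝓝 (y₁, 0), K i (baseMap Φ i p) = p
  right_inv : ∀ i ≤ n, ∀ᶠ q in 𝓝 (center Φ y₁), baseMap Φ i (K i q) = q
  contDiff : ∀ i ≤ n, ContDiff ℝ ∞ (f i)
  val : ∀ i ≤ n, ∀ᶠ p in 𝓝 (y₁, 0), f i (baseMap Φ i p) = (Φ (p.1, ell i p.2)).1
  jet : ∀ i ≤ n, ∀ᶠ p in 𝓝 (y₁, 0), ∀ ν,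
    fderiv ℝ (f i) (baseMap Φ i p) (0, ν) = - dotL (Φ (p.1, ell i p.2)).2.2 ν

variable {Φ : E × Cot n → J1 n} {k : E × Cot n → ℝ} {y₁ : E}

theorem contDiff_comp_ell (hΦ : ContDiff ℝ ∞ Φ) (i : ℕ) :
    ContDiff ℝ ∞ fun p : E × (Fin n → ℝ) => Φ (p.1, ell i p.2) :=
  hΦ.comp (contDiff_fst.prodMk ((contDiff_ell i).comp contDiff_snd))

theorem hasFDerivAt_comp_ell (hΦ : ContDiff ℝ ∞ Φ) (i : ℕ) (p : E × (Fin n → ℝ)) :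
    HasFDerivAt (fun p : E × (Fin n → ℝ) => Φ (p.1, ell i p.2))
      ((fderiv ℝ Φ (p.1, ell i p.2)).comp ((ContinuousLinearMap.fst ℝ E (Fin n → ℝ)).prod
        ((fderiv ℝ (ell i) p.2).comp (ContinuousLinearMap.snd ℝ E (Fin n → ℝ))))) p := by
  have h1 : HasFDerivAt (fun p : E × (Fin n → ℝ) => (p.1, ell i p.2)) _ p :=
    hasFDerivAt_fst.prodMk
      ((((contDiff_ell i).differentiable (by simp)) p.2).hasFDerivAt.comp p hasFDerivAt_snd)
  exact (hΦ.differentiable (by simp) _).hasFDerivAt.comp p h1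

theorem contDiff_baseMap (hΦ : ContDiff ℝ ∞ Φ) (i : ℕ) : ContDiff ℝ ∞ (baseMap Φ i) :=
  contDiff_fst.prodMk (contDiff_comp_ell hΦ i).snd.fst

theorem fderiv_baseMap (hΦ : ContDiff ℝ ∞ Φ) (i : ℕ) (p : E × (Fin n → ℝ)) (α : E)
    (w : Fin n → ℝ) : fderiv ℝ (baseMap Φ i) p (α, w) =
      (α, (fderiv ℝ Φ (p.1, ell i p.2) (α, fderiv ℝ (ell i) p.2 w)).2.1) := by
  have h1 : HasFDerivAt (baseMap Φ i) _ p :=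
    hasFDerivAt_fst.prodMk (hasFDerivAt_comp_ell hΦ i p).snd.fst
  rw [h1.fderiv]
  rfl

theorem fderiv_baseMap_zero (hΦ : ContDiff ℝ ∞ Φ) (i : ℕ) (w : Fin n → ℝ) :
    fderiv ℝ (baseMap Φ i) (y₁, 0) (0, w) = (0, dbase Φ y₁ (fderiv ℝ (ell i) 0 w)) := by
  rw [fderiv_baseMap hΦ, dbase_apply, ell_zero_right]

theorem tendsto_baseMap (hΦ : ContDiff ℝ ∞ Φ) (i : ℕ) :
    Tendsto (baseMap Φ i) (𝓝 (y₁, 0)) (𝓝 (center Φ y₁)) := by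
  rw [← baseMap_zero Φ i]
  exact (contDiff_baseMap hΦ i).continuous.tendsto _

/-- Transversality makes each base map a local diffeomorphism over the parameters, and fᵢ is x₀
composed with its inverse. The jet formula is the Legendrian condition: the Liouville form vanishes
on the piece, so dx₀ = -p dx on its image. -/
theorem IsLocalFamily.exists_frontData [FiniteDimensional ℝ E] (hΦ : IsLocalFamily Φ k y₁) :
    ∃ f K, FrontData Φ y₁ f K := by
  have key : ∀ i, ∃ (f : E × (Fin n → ℝ) → ℝ) (K : E × (Fin n → ℝ) → E × (Fin n → ℝ)), i ≤ n →
      ContDiff ℝ ∞ K ∧ (∀ᶠ p in 𝓝 (y₁, 0), K (baseMap Φ i p) = p) ∧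
      (∀ᶠ q in 𝓝 (center Φ y₁), baseMap Φ i (K q) = q) ∧ ContDiff ℝ ∞ f ∧
      (∀ᶠ p in 𝓝 (y₁, 0), f (baseMap Φ i p) = (Φ (p.1, ell i p.2)).1) ∧
      (∀ᶠ p in 𝓝 (y₁, 0), ∀ ν,
        fderiv ℝ f (baseMap Φ i p) (0, ν) = - dotL (Φ (p.1, ell i p.2)).2.2 ν) := by
    intro i
    by_cases hi : i ≤ n
    swap
    -- Default values for i > n, so that the choice below is made for all i.
    · exact ⟨0, id, fun h => absurd h hi⟩
    have hB := contDiff_baseMap hΦ.smooth i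
    have hinj : Function.Injective (fderiv ℝ (baseMap Φ i) (y₁, 0)) := by
      rw [injective_iff_map_eq_zero]
      rintro ⟨α, w⟩ h
      rw [fderiv_baseMap hΦ.smooth] at h
      obtain ⟨h1, h2⟩ := Prod.mk.inj h
      subst h1
      rw [ell_zero_right, ← dbase_apply] at h2
      have : w = 0 := hΦ.transverse i hi (by simpa using h2)
      rw [this]
      rfl
    obtain ⟨K, hK, hKl, hKr⟩ := exists_contDiff_local_inverse hB hinj
    rw [baseMap_zero] at hKr
    have hf : ContDiff ℝ ∞ fun q => (Φ ((K q).1, ell i (K q).2)).1 :=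
      ((contDiff_comp_ell hΦ.smooth i).comp hK).fst
    refine ⟨fun q => (Φ ((K q).1, ell i (K q).2)).1, K, fun _ => ⟨hK, hKl, hKr, hf, ?_, ?_⟩⟩
    · filter_upwards [hKl] with p hp
      rw [hp]
    · have htend : Tendsto (fun p : E × (Fin n → ℝ) => (p.1, ell i p.2)) (𝓝 (y₁, 0))
          (𝓝 (y₁, (0 : Cot n))) := by
        have : Continuous fun p : E × (Fin n → ℝ) => (p.1, ell i p.2) :=
          continuous_fst.prodMk ((contDiff_ell i).continuous.comp continuous_snd)
        simpa [ell_zero_right] using this.tendsto (y₁, 0)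
      filter_upwards [hKl, (tendsto_baseMap hΦ.smooth i).eventually hKr.eventually_nhds,
        htend.eventually hΦ.contact] with p hp hq hc ν
      have hid : HasFDerivAt (fun q => baseMap Φ i (K q))
          (ContinuousLinearMap.id ℝ (E × (Fin n → ℝ))) (baseMap Φ i p) :=
        (hasFDerivAt_id _).congr_of_eventuallyEq hq
      have hKd := (hK.differentiable (by simp) (baseMap Φ i p)).hasFDerivAt
      have hBd : HasFDerivAt (baseMap Φ i) (fderiv ℝ (baseMap Φ i) p) (K (baseMap Φ i p)) := by
        rw [hp]
        exact (hB.differentiable (by simp) p).hasFDerivAt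
      have h1 := DFunLike.congr_fun ((hBd.comp _ hKd).unique hid) (0, ν)
      have hfd : HasFDerivAt (fun q => (Φ ((K q).1, ell i (K q).2)).1) _ (baseMap Φ i p) :=
        (((hp.symm ▸ hasFDerivAt_comp_ell hΦ.smooth i p :
          HasFDerivAt (fun p : E × (Fin n → ℝ) => Φ (p.1, ell i p.2)) _ (K (baseMap Φ i p)))).comp _
            hKd).fst
      rw [hfd.fderiv]
      obtain ⟨α, w, hαw⟩ : ∃ α w, fderiv ℝ K (baseMap Φ i p) (0, ν) = (α, w) := ⟨_, _, rfl⟩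
      rw [ContinuousLinearMap.comp_apply, hαw, fderiv_baseMap hΦ.smooth,
        ContinuousLinearMap.id_apply] at h1
      obtain ⟨h2, h3⟩ := Prod.mk.inj h1
      -- The base map covers the identity of the parameters, so a fibre direction (0, ν) comes from
      -- a fibre direction (0, w), to which the contact condition applies.
      subst h2
      have h4 := hc (fderiv ℝ (ell i) p.2 w)
      rw [liouvilleForm_ell hi, mul_zero, contactForm_eq, h3] at h4
      simp only [ContinuousLinearMap.comp_apply, hαw, hp, ContinuousLinearMap.prod_apply,
        ContinuousLinearMap.coe_fst', ContinuousLinearMap.coe_snd']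
      linarith
  choose f K hfK using key
  exact ⟨f, K, fun i hi => (hfK i hi).1, fun i hi => (hfK i hi).2.1, fun i hi => (hfK i hi).2.2.1,
    fun i hi => (hfK i hi).2.2.2.1, fun i hi => (hfK i hi).2.2.2.2.1,
    fun i hi => (hfK i hi).2.2.2.2.2⟩

variable {f : ℕ → E × (Fin n → ℝ) → ℝ} {K : ℕ → E × (Fin n → ℝ) → E × (Fin n → ℝ)}

/-- Where two pieces meet, the functions that define their fronts have the same `1`-jet. -/
theorem FrontData.vanishing_sub (hΦ : IsLocalFamily Φ k y₁) (hf : FrontData Φ y₁ f K)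
    {i a : ℕ} (hi : i ≤ n) (ha : a ≤ n) {s : E × (Fin n → ℝ) → ℝ}
    {w' : E × (Fin n → ℝ) → Fin n → ℝ} (hw' : Tendsto w' (𝓝 (y₁, 0)) (𝓝 0))
    (hs : ∀ p, s p = 0 → ell i p.2 = ell a (w' p)) (e : Fin n → ℝ) :
    ∀ᶠ p in 𝓝 (y₁, 0), s p = 0 → f i (baseMap Φ i p) - f a (baseMap Φ i p) = 0 ∧
      fderiv ℝ (fun p => f i (baseMap Φ i p) - f a (baseMap Φ i p)) p (0, e) = 0 := by
  have ht : Tendsto (fun p : E × (Fin n → ℝ) => (p.1, w' p)) (𝓝 (y₁, 0)) (𝓝 (y₁, 0)) :=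
    ((continuous_fst (X := E) (Y := Fin n → ℝ)).tendsto (y₁, 0)).prodMk_nhds hw'
  filter_upwards [hf.val i hi, ht.eventually (hf.val a ha), hf.jet i hi,
    ht.eventually (hf.jet a ha)] with p h1 h2 h3 h4 hp
  have hB : baseMap Φ a (p.1, w' p) = baseMap Φ i p := by
    simp only [baseMap, hs p hp]
  rw [hB] at h2 h4
  simp only [← hs p hp] at h2 h4
  refine ⟨by rw [h1, h2, sub_self], ?_⟩
  have hBd := ((contDiff_baseMap hΦ.smooth i).differentiable (by simp) p).hasFDerivAt
  have h5 : HasFDerivAt (fun p => f i (baseMap Φ i p) - f a (baseMap Φ i p)) _ p :=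
    (((hf.contDiff i hi).differentiable (by simp) _).hasFDerivAt.comp p hBd).sub
    (((hf.contDiff a ha).differentiable (by simp) _).hasFDerivAt.comp p hBd)
  rw [h5.fderiv]
  simp only [sub_apply, ContinuousLinearMap.comp_apply, fderiv_baseMap hΦ.smooth, h3, h4, sub_self]

/-- The derivative at the origin of the base map of the zero section. -/
noncomputable def dbaseZero (Φ : E × Cot n → J1 n) (y₁ : E) (w : Fin n → ℝ) : Fin n → ℝ :=
  dbase Φ y₁ (w, 0)

/-- The common derivative at the origin of the base maps of the conormals. -/
noncomputable def dbaseConormal (Φ : E × Cot n → J1 n) (y₁ : E) (w : Fin n → ℝ) : Fin n → ℝ :=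
  dbase Φ y₁ (w - co 0 w • ev 0, co 0 w • ev 0)

/-- At the origin the zero section and the conormals are tangent along the hyperplane {p₁ = x₁ = 0},
which corresponds to co 0 w = 0 in both parametrizations. -/
theorem dbaseConormal_eq_of_co {w : Fin n → ℝ} (h : co 0 w = 0) :
    dbaseConormal Φ y₁ w = dbaseZero Φ y₁ w := by
  simp [dbaseConormal, dbaseZero, h]

theorem fderiv_baseMap_conormal (hΦ : ContDiff ℝ ∞ Φ) (i : ℕ) (w : Fin n → ℝ) :
    fderiv ℝ (baseMap Φ (i + 1)) (y₁, 0) (0, w) = (0, dbaseConormal Φ y₁ w) := by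
  rw [fderiv_baseMap_zero hΦ, fderiv_ell_succ_zero]
  rfl

theorem fderiv_baseMap_zeroSection (hΦ : ContDiff ℝ ∞ Φ) (w : Fin n → ℝ) :
    fderiv ℝ (baseMap Φ 0) (y₁, 0) (0, w) = (0, dbaseZero Φ y₁ w) := by
  rw [fderiv_baseMap_zero hΦ, fderiv_ell_zero]
  rfl

theorem IsLocalFamily.bijective_dbaseZero (hΦ : IsLocalFamily Φ k y₁) :
    Function.Bijective (dbaseZero Φ y₁) := by
  have hinj : Function.Injective (dbaseZero Φ y₁) := fun a b hab => by
    apply hΦ.transverse 0 (Nat.zero_le _)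
    simpa [fderiv_ell_zero, dbaseZero] using hab
  refine ⟨hinj, ?_⟩
  exact LinearMap.surjective_of_injective
    (f := ((dbase Φ y₁).comp (ContinuousLinearMap.inl ℝ _ _)).toLinearMap) hinj

theorem IsLocalFamily.bijective_dbaseConormal (hn : 0 < n) (hΦ : IsLocalFamily Φ k y₁) :
    Function.Bijective (dbaseConormal Φ y₁) := by
  have hinj : Function.Injective (dbaseConormal Φ y₁) := fun a b hab => by
    apply hΦ.transverse 1 hn
    simp only
    rw [fderiv_ell_succ_zero, fderiv_ell_succ_zero]
    exact hab
  refine ⟨hinj, ?_⟩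
  have := LinearMap.surjective_of_injective
    (f := ((dbase Φ y₁).comp (fderiv ℝ (ell 1) 0)).toLinearMap) (hΦ.transverse 1 hn)
  intro v
  obtain ⟨w, hw⟩ := this v
  refine ⟨w, ?_⟩
  have h2 : dbase Φ y₁ (fderiv ℝ (ell 1) 0 w) = v := hw
  rw [fderiv_ell_succ_zero] at h2
  exact h2

/-- Second-order vanishing on {s = 0} gives s² u in the coordinates of the piece; the root s √u is
carried to the base by the local inverse, and its differential is a positive multiple of ds.
Positivity of u is left as a hypothesis because it has different causes for a = 0 and for a ≥ 1. -/
theorem FrontData.exists_root_of_vanishing [FiniteDimensional ℝ E]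
    (hΦ : IsLocalFamily Φ k y₁) (hf : FrontData Φ y₁ f K) {i a : ℕ} (hi : i + 1 ≤ n)
    {F s : E × (Fin n → ℝ) → ℝ} (hF : ContDiff ℝ ∞ F)
    (hs : ContDiff ℝ ∞ s) (hse : ∀ p (c : ℝ), s (p + c • (0, ev a)) = s p + c)
    (hs0 : s (y₁, 0) = 0) (hsd : ∀ w, fderiv ℝ s (y₁, 0) (0, w) = co a w)
    (hz : ∀ᶠ p in 𝓝 (y₁, 0), s p = 0 → F (baseMap Φ (i + 1) p) = 0 ∧
      fderiv ℝ (fun p => F (baseMap Φ (i + 1) p)) p (0, ev a) = 0)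
    (hpos : ∀ u : E × (Fin n → ℝ) → ℝ, ContDiff ℝ ∞ u →
      (∀ᶠ p in 𝓝 (y₁, 0), F (baseMap Φ (i + 1) p) = s p ^ 2 * u p) → 0 < u (y₁, 0)) :
    ∃ G : E × (Fin n → ℝ) → ℝ, ContDiff ℝ ∞ G ∧ G (center Φ y₁) = 0 ∧
      (∀ᶠ q in 𝓝 (center Φ y₁), G q ^ 2 = F q) ∧ ∃ c : ℝ, 0 < c ∧
      ∀ w, fderiv ℝ G (center Φ y₁) (0, dbaseConormal Φ y₁ w) = c * co a w := by
  have hB := contDiff_baseMap hΦ.smooth (i + 1)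
  obtain ⟨u, hu, hFu⟩ := exists_eq_sq_mul_of_vanishing (hF.comp hB) hs hse hs0 hz
  obtain ⟨G, hG, hG0, hGF, c, hc, hGc⟩ := exists_sq_eq hs hu hs0 (hpos u hu hFu) hFu
  have hKc : K (i + 1) (center Φ y₁) = (y₁, 0) := by
    have := (hf.left_inv (i + 1) hi).self_of_nhds
    rwa [baseMap_zero] at this
  have hK := hf.contDiff_inv (i + 1) hi
  have hKt : Tendsto (K (i + 1)) (𝓝 (center Φ y₁)) (𝓝 (y₁, 0)) := by
    rw [← hKc]
    exact hK.continuous.tendsto _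
  refine ⟨fun q => G (K (i + 1) q), hG.comp hK, (congrArg G hKc).trans hG0, ?_, c, hc, fun w => ?_⟩
  · filter_upwards [hKt.eventually hGF, hf.right_inv (i + 1) hi] with q h1 h2
    rw [h1, Function.comp_apply, h2]
  · have h1 : HasFDerivAt (fun p => G (K (i + 1) (baseMap Φ (i + 1) p))) (fderiv ℝ G (y₁, 0))
        (y₁, 0) := by
      refine (hG.differentiable (by simp) _).hasFDerivAt.congr_of_eventuallyEq ?_
      filter_upwards [hf.left_inv (i + 1) hi] with p hp
      rw [hp]
    have h2 : HasFDerivAt (fun p => G (K (i + 1) (baseMap Φ (i + 1) p))) _ (y₁, 0) :=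
      ((hG.comp hK).differentiable (by simp) _).hasFDerivAt.comp (y₁, 0)
        (hB.differentiable (by simp) _).hasFDerivAt
    have h3 := DFunLike.congr_fun (h1.unique h2) (0, w)
    rw [ContinuousLinearMap.comp_apply, fderiv_baseMap_conormal hΦ.smooth, baseMap_zero, hGc] at h3
    have h4 : c * co a w = c • fderiv ℝ s (y₁, 0) (0, w) := by rw [hsd, smul_eq_mul]
    rw [h4]
    exact h3.symm

end LocalFamily

/-! ### Iterated square roots and their agreement to first order. -/

section Roots

variable {n : ℕ} {E : Type} [NormedAddCommGroup E] [NormedSpace ℝ E]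

/-- `g (a + 1) i` is a smooth square root of `g a a - g a i`, normalized to first order. -/
structure IsRoot (Φ : E × Cot n → J1 n) (y₁ : E) (g : ℕ → ℕ → E × (Fin n → ℝ) → ℝ)
    (a i : ℕ) : Prop where
  smooth : ContDiff ℝ ∞ (g (a + 1) i)
  zero : g (a + 1) i (center Φ y₁) = 0
  sq : ∀ᶠ q in 𝓝 (center Φ y₁), g (a + 1) i q ^ 2 = g a a q - g a i q
  deriv : ∃ c : ℝ, ∀ w,
    fderiv ℝ (g (a + 1) i) (center Φ y₁) (0, dbaseConormal Φ y₁ w) = c * co a w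
  pos : 0 < fderiv ℝ (g (a + 1) i) (center Φ y₁) (0, dbaseZero Φ y₁ (ev a))

variable {Φ : E × Cot n → J1 n} {k : E × Cot n → ℝ} {y₁ : E}
  {f : ℕ → E × (Fin n → ℝ) → ℝ} {K : ℕ → E × (Fin n → ℝ) → E × (Fin n → ℝ)} {ε : ℝ}
  {g : ℕ → ℕ → E × (Fin n → ℝ) → ℝ}

theorem smooth_of_isRoot (hf : FrontData Φ y₁ f K)
    (hg0 : ∀ i ≤ n, g 0 i = fun q => -(ε * (f i q - f 0 q)))
    {m : ℕ} (hroot : ∀ a < m, ∀ i, a < i → i ≤ n → IsRoot Φ y₁ g a i) {a i : ℕ} (ha : a ≤ m)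
    (hai : a ≤ i) (hi : i ≤ n) : ContDiff ℝ ∞ (g a i) := by
  cases a with
  | zero =>
    rw [hg0 i hi]
    exact (contDiff_const.mul ((hf.contDiff i hi).sub (hf.contDiff 0 (Nat.zero_le _)))).neg
  | succ a => exact (hroot a ha i hai hi).smooth

theorem contDiff_H_snd (l a : ℕ) : ContDiff ℝ ∞ fun p : E × (Fin n → ℝ) => H l a p.2 :=
  (contDiff_H l a).comp contDiff_snd

theorem fderiv_H_snd (l a : ℕ) (w : Fin n → ℝ) :
    fderiv ℝ (fun p : E × (Fin n → ℝ) => H (l + 1) a p.2) (y₁, 0) (0, w) = co a w := by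
  have h1 : HasFDerivAt (fun p : E × (Fin n → ℝ) => H (l + 1) a p.2) _ (y₁, 0) :=
    ((differentiable_H (l + 1) a) ((y₁, (0 : Fin n → ℝ)).2)).hasFDerivAt.comp (y₁, 0)
      hasFDerivAt_snd
  rw [h1.fderiv, ContinuousLinearMap.comp_apply]
  simp only [ContinuousLinearMap.coe_snd']
  rw [fderiv_H_of_eq_zero (H_zero_right _ _)]

/-- All conormals have the same base derivative at the origin, so the index i does not matter. -/
theorem fderiv_comp_baseMap_conormal (hΦ : ContDiff ℝ ∞ Φ) {G : E × (Fin n → ℝ) → ℝ}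
    (hG : ContDiff ℝ ∞ G) (i : ℕ) (w : Fin n → ℝ) :
    fderiv ℝ (fun p => G (baseMap Φ (i + 1) p)) (y₁, 0) (0, w) =
      fderiv ℝ G (center Φ y₁) (0, dbaseConormal Φ y₁ w) := by
  have h1 : HasFDerivAt (fun p => G (baseMap Φ (i + 1) p)) _ (y₁, 0) :=
    (hG.differentiable (by simp) _).hasFDerivAt.comp (y₁, 0)
      ((contDiff_baseMap hΦ (i + 1)).differentiable (by simp) _).hasFDerivAt
  rw [h1.fderiv, ContinuousLinearMap.comp_apply, fderiv_baseMap_conormal hΦ, baseMap_zero]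

/-- The iterated square roots for two conormals agree to first order where the conormals meet. -/
theorem vanishing_of_isRoot (hΦ : IsLocalFamily Φ k y₁) (hf : FrontData Φ y₁ f K)
    (hg0 : ∀ i ≤ n, g 0 i = fun q => -(ε * (f i q - f 0 q)))
    {a l : ℕ} (hi : a + 1 + (l + 1) ≤ n)
    (hroot : ∀ a' < a + 1, ∀ i, a' < i → i ≤ n → IsRoot Φ y₁ g a' i) {b : ℕ} (hb : b ≤ a + 1) :
    ∀ᶠ p in 𝓝 (y₁, (0 : Fin n → ℝ)), H (l + 1) (a + 1) p.2 = 0 →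
      g b (a + 1) (baseMap Φ (a + 1 + (l + 1)) p) -
        g b (a + 1 + (l + 1)) (baseMap Φ (a + 1 + (l + 1)) p) = 0 ∧
      fderiv ℝ (fun p => g b (a + 1) (baseMap Φ (a + 1 + (l + 1)) p) -
        g b (a + 1 + (l + 1)) (baseMap Φ (a + 1 + (l + 1)) p)) p (0, ev (a + 1)) = 0 := by
  have hn : 0 < n := by omega
  set i := a + 1 + (l + 1) with hidef
  have hB := contDiff_baseMap hΦ.smooth i
  -- At b = 0 this is the common 1-jet of two fronts. In the step, g b b cancels in the difference
  -- of the two squares, which leaves the difference of level b up to sign.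
  induction b with
  | zero =>
    have := hf.vanishing_sub hΦ hi (show a + 1 ≤ n by omega)
      (s := fun p => H (l + 1) (a + 1) p.2) (w' := Prod.snd) (continuous_snd.tendsto _)
      (fun p hp => ell_eq_ell hp) (ev (a + 1))
    filter_upwards [this] with p hp hs
    obtain ⟨h1, h2⟩ := hp hs
    have he : (fun p => g 0 (a + 1) (baseMap Φ i p) - g 0 i (baseMap Φ i p)) =
        fun p => ε * (f i (baseMap Φ i p) - f (a + 1) (baseMap Φ i p)) := by
      rw [hg0 (a + 1) (by omega), hg0 i hi]
      funext p
      ring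
    refine ⟨(congrFun he p).trans (by rw [h1, mul_zero]), ?_⟩
    rw [he]
    have hd : DifferentiableAt ℝ (fun p => f i (baseMap Φ i p) - f (a + 1) (baseMap Φ i p)) p :=
      ((((hf.contDiff i hi).comp hB).sub ((hf.contDiff (a + 1) (by omega)).comp hB)).differentiable
        (by simp)) p
    rw [fderiv_const_mul hd]
    simp [h2]
  | succ b ih =>
    have hr1 := hroot b (by omega) (a + 1) (by omega) (by omega)
    have hr2 := hroot b (by omega) i (by omega) hi
    -- In conormal coordinates both differentials are multiples of co b, and both are positive on
    -- one common vector. The two multiples therefore have the same sign and cannot cancel.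
    have hpos : fderiv ℝ (fun p => g (b + 1) (a + 1) (baseMap Φ i p)) (y₁, 0) (0, ev b) +
        fderiv ℝ (fun p => g (b + 1) i (baseMap Φ i p)) (y₁, 0) (0, ev b) ≠ 0 := by
      rw [show i = a + 1 + l + 1 by omega] at hr2 ⊢
      rw [fderiv_comp_baseMap_conormal hΦ.smooth hr1.smooth,
        fderiv_comp_baseMap_conormal hΦ.smooth hr2.smooth]
      obtain ⟨c₁, hc₁⟩ := hr1.deriv
      obtain ⟨c₂, hc₂⟩ := hr2.deriv
      obtain ⟨r, hr⟩ := (hΦ.bijective_dbaseConormal hn).2 (dbaseZero Φ y₁ (ev b))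
      have p1 := hr1.pos
      have p2 := hr2.pos
      rw [← hr, hc₁] at p1
      rw [← hr, hc₂] at p2
      rw [hc₁, hc₂, co_ev_self (by omega)]
      intro h0
      rw [show c₁ = - c₂ by linarith] at p1
      linarith
    refine vanishing_sub_of_vanishing_sq_sub (hr1.smooth.comp hB) (hr2.smooth.comp hB)
      (contDiff_H_snd (l + 1) (a + 1)) (fun p c => ?_) (by simp [H_zero_right])
      (w := (0, ev b)) ?_ hpos ?_
    · simp [H_succ_add_smul_ev (show a + 1 < n by omega)]
    · rw [fderiv_H_snd, co_ev_of_ne (by omega)]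
    · have ht := tendsto_baseMap (y₁ := y₁) hΦ.smooth i
      have he : ∀ᶠ p in 𝓝 (y₁, 0), g (b + 1) (a + 1) (baseMap Φ i p) ^ 2 -
          g (b + 1) i (baseMap Φ i p) ^ 2 =
          - (g b (a + 1) (baseMap Φ i p) - g b i (baseMap Φ i p)) := by
        filter_upwards [ht.eventually hr1.sq, ht.eventually hr2.sq] with p h1 h2
        rw [h1, h2]
        ring
      filter_upwards [ih (by omega), he.eventually_nhds] with p hp hep hs
      obtain ⟨h1, h2⟩ := hp hs
      refine ⟨hep.self_of_nhds.trans (by rw [h1, neg_zero]), ?_⟩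
      have : (fun p => g (b + 1) (a + 1) (baseMap Φ i p) ^ 2 -
          g (b + 1) i (baseMap Φ i p) ^ 2) =ᶠ[𝓝 p]
          fun p => - (g b (a + 1) (baseMap Φ i p) - g b i (baseMap Φ i p)) := hep
      rw [this.fderiv_eq, fderiv_fun_neg]
      simp [h2]

/-- Vanishing of the iterated square roots on the zero section. -/
theorem eq_zero_of_isRoot (hΦ : IsLocalFamily Φ k y₁) (hf : FrontData Φ y₁ f K)
    (hg0 : ∀ i ≤ n, g 0 i = fun q => -(ε * (f i q - f 0 q))) {m : ℕ}
    (hroot : ∀ a < m, ∀ i, a < i → i ≤ n → IsRoot Φ y₁ g a i) {a i : ℕ} (ham : a ≤ m)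
    (hai : a ≤ i) (hi : i ≤ n) :
    ∀ᶠ x in 𝓝 (0 : Fin n → ℝ), H i 0 x = 0 → (∀ j, j + 1 < a → co j x = 0) →
      g a i (baseMap Φ 0 (y₁, x)) = 0 := by
  have htx : Tendsto (fun x : Fin n → ℝ => (y₁, x)) (𝓝 0) (𝓝 (y₁, 0)) := by
    have : Continuous fun x : Fin n → ℝ => (y₁, x) := by fun_prop
    exact this.tendsto 0
  -- Over {hᵢ = 0} the zero section meets ⁿLᵢ, so fᵢ = f₀ there. At later levels both terms under
  -- the root vanish; for g a a this uses that the coordinates before the a-th one are zero.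
  induction a generalizing i with
  | zero =>
    cases i with
    | zero => simp [hg0 0 hi]
    | succ i =>
      have ht : Tendsto (fun x : Fin n → ℝ => (y₁, x - co 0 x • ev 0)) (𝓝 0) (𝓝 (y₁, 0)) := by
        have : Continuous fun x : Fin n → ℝ => (y₁, x - co 0 x • (ev 0 : Fin n → ℝ)) := by fun_prop
        simpa using this.tendsto 0
      filter_upwards [ht.eventually (hf.val (i + 1) hi),
        htx.eventually (hf.val 0 (Nat.zero_le _))] with x h1 h2 hx _
      have he := ell_of_H_eq_zero (show 0 < n by omega) hx
      have hb : baseMap Φ (i + 1) (y₁, x - co 0 x • ev 0) = baseMap Φ 0 (y₁, x) := by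
        simp only [baseMap, he]
      rw [hb] at h1
      simp only [he] at h1
      rw [hg0 (i + 1) hi]
      simp only [h1, h2, sub_self, mul_zero, neg_zero]
  | succ a ih =>
    have hr := hroot a (by omega) i (by omega) hi
    filter_upwards [(((tendsto_baseMap hΦ.smooth 0).comp htx).eventually hr.sq),
      ih (by omega) (i := i) (by omega) hi, ih (by omega) (i := a) le_rfl (by omega)]
      with x h1 h2 h3 hx hco
    rw [Function.comp_apply, h2 hx fun j hj => hco j (by omega),
      h3 (H_eq_zero fun j _ hj => hco j (by omega)) fun j hj => hco j (by omega)] at h1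
    simpa using h1

end Roots

/-! ### Positivity under the root, tested along a parabola. -/

section Roots

variable {n : ℕ} {E : Type} [NormedAddCommGroup E] [NormedSpace ℝ E]
variable {Φ : E × Cot n → J1 n} {k : E × Cot n → ℝ} {y₁ : E}
  {f : ℕ → E × (Fin n → ℝ) → ℝ} {K : ℕ → E × (Fin n → ℝ) → E × (Fin n → ℝ)} {ε : ℝ}
  {g : ℕ → ℕ → E × (Fin n → ℝ) → ℝ}

/-- If a function vanishes along the line `τ w`, then along the parabola `τ w + τ² v` it grows like
its derivative in the direction `v` times `τ²`. -/
theorem tendsto_div_sq_of_vanishing {V : Type*} [NormedAddCommGroup V] [NormedSpace ℝ V]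
    {G : V → ℝ} (hG : ContDiff ℝ ∞ G) {v w : V} (h0 : ∀ᶠ τ : ℝ in 𝓝 0, G (τ • w) = 0) :
    Tendsto (fun τ : ℝ => G (τ • w + τ ^ 2 • v) / τ ^ 2) (𝓝[≠] 0) (𝓝 (fderiv ℝ G 0 v)) := by
  have hs := ((hG.contDiffAt (x := 0)).hasStrictFDerivAt (by simp)).isLittleO
  have hcurve : Tendsto (fun τ : ℝ => (τ • w + τ ^ 2 • v, τ • w)) (𝓝 0) (𝓝 ((0 : V), (0 : V))) := by
    have : Continuous fun τ : ℝ => (τ • w + τ ^ 2 • v, τ • w) := by fun_prop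
    simpa using this.tendsto 0
  have h1 := (hs.comp_tendsto hcurve).mono (nhdsWithin_le_nhds (s := {0}ᶜ))
  have h2 : (fun τ : ℝ => G (τ • w + τ ^ 2 • v) - τ ^ 2 * fderiv ℝ G 0 v) =o[𝓝[≠] 0]
      fun τ : ℝ => τ ^ 2 := by
    refine (h1.congr' ?_ EventuallyEq.rfl).trans_isBigO ?_
    · filter_upwards [h0.filter_mono nhdsWithin_le_nhds] with τ hτ
      simp [hτ]
    · refine Asymptotics.IsBigO.of_bound ‖v‖ (Eventually.of_forall fun τ => ?_)
      simp [norm_smul, mul_comm]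
  have h3 := h2.tendsto_div_nhds_zero
  have h4 := h3.add_const (fderiv ℝ G 0 v)
  rw [zero_add] at h4
  refine h4.congr' ?_
  filter_upwards [self_mem_nhdsWithin] with τ hτ
  have : τ ≠ 0 := hτ
  field_simp
  ring

/-- The factor of the square is positive for `a ≥ 1`. -/
theorem pos_of_isRoot (hΦ : IsLocalFamily Φ k y₁) (hf : FrontData Φ y₁ f K)
    (hg0 : ∀ i ≤ n, g 0 i = fun q => -(ε * (f i q - f 0 q)))
    {a l : ℕ} (hi : a + 1 + (l + 1) ≤ n)
    (hroot : ∀ a' < a + 1, ∀ i, a' < i → i ≤ n → IsRoot Φ y₁ g a' i)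
    {u : E × (Fin n → ℝ) → ℝ} (hu : ContDiff ℝ ∞ u)
    (hFu : ∀ᶠ p in 𝓝 (y₁, (0 : Fin n → ℝ)), g (a + 1) (a + 1) (baseMap Φ (a + 1 + (l + 1)) p) -
        g (a + 1) (a + 1 + (l + 1)) (baseMap Φ (a + 1 + (l + 1)) p) =
        H (l + 1) (a + 1) p.2 ^ 2 * u p) : 0 < u (y₁, 0) := by
  set i := a + 1 + (l + 1) with hidef
  -- The test curve on the zero section is the parabola x_a = τ², x_{a+1} = τ, on which H (l + 2) a
  -- and then hᵢ vanish. There g (a + 1) i is zero, while g (a + 1) (a + 1), zero on the line τ w,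
  -- grows like τ² times its positive derivative along v. Comparison with H² u ~ τ² u(y₁, 0) gives
  -- the sign of u.
  set v : Fin n → ℝ := ev a with hv
  set w : Fin n → ℝ := ev (a + 1) with hw
  have hB0 := contDiff_baseMap hΦ.smooth 0
  have hKi := hf.contDiff_inv i hi
  have hKc : K i (center Φ y₁) = (y₁, 0) := by
    have := (hf.left_inv i hi).self_of_nhds
    rwa [baseMap_zero] at this
  have hins : ContDiff ℝ ∞ fun x : Fin n → ℝ => (y₁, x) := contDiff_const.prodMk contDiff_id
  have hr := hroot a (by omega) (a + 1) (by omega) (by omega)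
  have hcurve : Tendsto (fun τ : ℝ => τ • w + τ ^ 2 • v) (𝓝 0) (𝓝 0) := by
    have : Continuous fun τ : ℝ => τ • w + τ ^ 2 • v := by fun_prop
    simpa using this.tendsto 0
  have hline : Tendsto (fun τ : ℝ => τ • w) (𝓝 0) (𝓝 0) := by
    have : Continuous fun τ : ℝ => τ • w := by fun_prop
    simpa using this.tendsto 0
  -- the first of the two functions, on the zero section
  have hlim1 : Tendsto (fun τ : ℝ => g (a + 1) (a + 1) (baseMap Φ 0 (y₁, τ • w + τ ^ 2 • v)) / τ ^ 2)
      (𝓝[≠] 0) (𝓝 (fderiv ℝ (g (a + 1) (a + 1)) (center Φ y₁) (0, dbaseZero Φ y₁ v))) := by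
    have hG : ContDiff ℝ ∞ fun x => g (a + 1) (a + 1) (baseMap Φ 0 (y₁, x)) :=
      hr.smooth.comp (hB0.comp hins)
    have hz : ∀ᶠ τ : ℝ in 𝓝 0, g (a + 1) (a + 1) (baseMap Φ 0 (y₁, τ • w)) = 0 := by
      filter_upwards [hline.eventually (eq_zero_of_isRoot hΦ hf hg0 hroot (a := a + 1)
        (i := a + 1) le_rfl le_rfl (by omega))] with τ hτ
      have hco : ∀ j < a + 1, co j (τ • w) = 0 := fun j hj => by
        rw [map_smul, hw, co_ev_of_ne (by omega), smul_zero]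
      exact hτ (H_eq_zero fun j _ hj => hco j (by omega)) fun j hj => hco j (by omega)
    have h1 := tendsto_div_sq_of_vanishing hG (v := v) hz
    have h2 : HasFDerivAt (fun x => g (a + 1) (a + 1) (baseMap Φ 0 (y₁, x))) _ 0 :=
      (hr.smooth.differentiable (by simp) _).hasFDerivAt.comp 0
        ((hB0.differentiable (by simp) _).hasFDerivAt.comp (0 : Fin n → ℝ)
          (hasFDerivAt_prodMk_right y₁ (0 : Fin n → ℝ)))
    rw [h2.fderiv] at h1
    simp only [ContinuousLinearMap.comp_apply, ContinuousLinearMap.inr_apply] at h1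
    rwa [fderiv_baseMap_zeroSection hΦ.smooth, baseMap_zero] at h1
  -- the second function vanishes along the curve
  have hz2 : ∀ᶠ τ : ℝ in 𝓝 0, g (a + 1) i (baseMap Φ 0 (y₁, τ • w + τ ^ 2 • v)) = 0 := by
    filter_upwards [hcurve.eventually (eq_zero_of_isRoot hΦ hf hg0 hroot (a := a + 1)
      (i := i) le_rfl (by omega) hi)] with τ hτ
    have hco : ∀ j, j ≠ a → j ≠ a + 1 → co j (τ • w + τ ^ 2 • v) = 0 := fun j h1 h2 => by
      rw [map_add, map_smul, map_smul, hw, hv, co_ev_of_ne h1, co_ev_of_ne h2]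
      simp
    have hHa : H (l + 1) (a + 1) (τ • w + τ ^ 2 • v) = τ := by
      rw [H_succ, H_eq_zero fun j h1 _ => hco j (by omega) (by omega), map_add, map_smul, map_smul,
        hw, hv, co_ev_self (by omega), co_ev_of_ne (by omega)]
      simp
    have hHa' : H (l + 1 + 1) a (τ • w + τ ^ 2 • v) = 0 := by
      rw [H_succ, hHa, map_add, map_smul, map_smul, hw, hv, co_ev_self (by omega),
        co_ev_of_ne (by omega)]
      simp
    have hall : ∀ m b, b + m = a → H (m + (l + 1 + 1)) b (τ • w + τ ^ 2 • v) = 0 := by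
      intro m
      induction m with
      | zero =>
        intro b hb
        obtain rfl : b = a := by omega
        rw [zero_add]
        exact hHa'
      | succ m ih =>
        intro b hb
        rw [show m + 1 + (l + 1 + 1) = m + (l + 1 + 1) + 1 by omega, H_succ, ih (b + 1) (by omega),
          hco b (by omega) (by omega)]
        simp
    refine hτ ?_ fun j hj => hco j (by omega) (by omega)
    rw [show i = a + (l + 1 + 1) by omega]
    exact hall a 0 (by omega)
  -- the defining function of the hypersurface along the curve
  set c : ℝ → E × (Fin n → ℝ) := fun τ => K i (baseMap Φ 0 (y₁, τ • w + τ ^ 2 • v)) with hc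
  have hc0 : c 0 = (y₁, 0) := by
    simp only [hc, zero_smul, ne_eq, OfNat.ofNat_ne_zero, not_false_eq_true, zero_pow, add_zero]
    rw [baseMap_zero, hKc]
  have hcc : ContDiff ℝ ∞ c :=
    hKi.comp (hB0.comp (contDiff_const.prodMk (by fun_prop)))
  have hct : Tendsto c (𝓝 0) (𝓝 (y₁, 0)) := by
    rw [← hc0]
    exact hcc.continuous.tendsto 0
  have hbt : Tendsto (fun τ : ℝ => baseMap Φ 0 (y₁, τ • w + τ ^ 2 • v)) (𝓝 0)
      (𝓝 (center Φ y₁)) :=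
    (tendsto_baseMap hΦ.smooth 0).comp (tendsto_const_nhds.prodMk_nhds hcurve)
  -- The curve c is the parabola seen in the coordinates of ⁿLᵢ. Its velocity is still w: as a + 1 ≥
  -- 1, the zero section and the conormals have the same base derivative on w.
  have hcd : HasDerivAt c (0, w) 0 := by
    have hx : HasDerivAt (fun τ : ℝ => (y₁, τ • w + τ ^ 2 • v)) (0, w) 0 := by
      have h1 : HasDerivAt (fun τ : ℝ => τ • w) ((1 : ℝ) • w) 0 :=
        (hasDerivAt_id (0 : ℝ)).smul_const w
      have h2 : HasDerivAt (fun τ : ℝ => τ ^ 2 • v) (((2 : ℕ) * (0 : ℝ) ^ (2 - 1)) • v) 0 :=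
        (hasDerivAt_pow 2 (0 : ℝ)).smul_const v
      exact ((hasDerivAt_const (0 : ℝ) y₁).prodMk (h1.fun_add h2)).congr_deriv (by simp)
    have hBd := (hB0.differentiable (by simp) (y₁, (0 : ℝ) • w + (0 : ℝ) ^ 2 • v)).hasFDerivAt
    have hKd := (hKi.differentiable (by simp)
      (baseMap Φ 0 (y₁, (0 : ℝ) • w + (0 : ℝ) ^ 2 • v))).hasFDerivAt
    have h3 := hKd.comp_hasDerivAt (0 : ℝ) (hBd.comp_hasDerivAt (0 : ℝ) hx)
    refine h3.congr_deriv ?_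
    simp only [zero_smul, ne_eq, OfNat.ofNat_ne_zero, not_false_eq_true, zero_pow, add_zero]
    rw [fderiv_baseMap_zeroSection hΦ.smooth, ← dbaseConormal_eq_of_co (w := w)
      (by rw [hw, co_ev_of_ne (by omega)]), ← fderiv_baseMap_conormal hΦ.smooth (a + 1 + l),
      baseMap_zero, ← baseMap_zero Φ i]
    have h4 : HasFDerivAt (fun p => K i (baseMap Φ i p)) (ContinuousLinearMap.id ℝ _) (y₁, 0) :=
      (hasFDerivAt_id _).congr_of_eventuallyEq (hf.left_inv i hi)
    have h5 := (hKi.differentiable (by simp) _).hasFDerivAt.comp (y₁, (0 : Fin n → ℝ))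
      ((contDiff_baseMap hΦ.smooth i).differentiable (by simp) _).hasFDerivAt
    exact DFunLike.congr_fun (h5.unique h4) (0, w)
  have hm : HasDerivAt (fun τ => H (l + 1) (a + 1) (c τ).2) 1 0 := by
    have h1 : HasFDerivAt (fun p : E × (Fin n → ℝ) => H (l + 1) (a + 1) p.2) _ (c 0) :=
      ((contDiff_H_snd (l + 1) (a + 1)).differentiable (by simp) (c 0)).hasFDerivAt
    have h2 := h1.comp_hasDerivAt (0 : ℝ) hcd
    refine h2.congr_deriv ?_
    rw [hc0, fderiv_H_snd, hw, co_ev_self (by omega)]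
  have hm0 : H (l + 1) (a + 1) (c 0).2 = 0 := by rw [hc0, H_zero_right]
  have hlim2 : Tendsto (fun τ : ℝ => (H (l + 1) (a + 1) (c τ).2 / τ) ^ 2 * u (c τ)) (𝓝[≠] 0)
      (𝓝 (1 ^ 2 * u (y₁, 0))) := by
    refine Tendsto.mul (Tendsto.pow ?_ 2)
      ((hu.continuous.tendsto _).comp (hct.mono_left nhdsWithin_le_nhds))
    have := hasDerivAt_iff_tendsto_slope.1 hm
    refine this.congr fun τ => ?_
    rw [slope_def_field, hm0]
    simp
  have heq : (fun τ : ℝ => g (a + 1) (a + 1) (baseMap Φ 0 (y₁, τ • w + τ ^ 2 • v)) / τ ^ 2)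
      =ᶠ[𝓝[≠] 0] fun τ : ℝ => (H (l + 1) (a + 1) (c τ).2 / τ) ^ 2 * u (c τ) := by
    refine Eventually.filter_mono nhdsWithin_le_nhds ?_
    filter_upwards [hz2, hct.eventually hFu, hbt.eventually (hf.right_inv i hi)] with τ h1 h2 h3
    rw [h3, h1, sub_zero] at h2
    rw [h2]
    ring
  have := tendsto_nhds_unique (hlim1.congr' heq) hlim2
  rw [one_pow, one_mul] at this
  rw [← this]
  exact hr.pos

end Roots

/-! ### Existence of all roots and the normal form. -/

section Roots

variable {n : ℕ} {E : Type} [NormedAddCommGroup E] [NormedSpace ℝ E]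
variable {Φ : E × Cot n → J1 n} {k : E × Cot n → ℝ} {y₁ : E}
  {f : ℕ → E × (Fin n → ℝ) → ℝ} {K : ℕ → E × (Fin n → ℝ) → E × (Fin n → ℝ)} {ε : ℝ}
  {g : ℕ → ℕ → E × (Fin n → ℝ) → ℝ}

theorem contDiff_co_snd (a : ℕ) : ContDiff ℝ ∞ fun p : E × (Fin n → ℝ) => co a p.2 :=
  (co a).contDiff.comp contDiff_snd

/-- Where p₁ = 0 the conormal point lies on the zero section, so the two Legendrians share it and
the front functions share a 1-jet. -/
theorem FrontData.vanishing_sub_zeroSection (hΦ : IsLocalFamily Φ k y₁)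
    (hf : FrontData Φ y₁ f K) {i : ℕ} (hi : i + 1 ≤ n) (e : Fin n → ℝ) :
    ∀ᶠ p in 𝓝 (y₁, (0 : Fin n → ℝ)), co 0 p.2 = 0 →
      f (i + 1) (baseMap Φ (i + 1) p) - f 0 (baseMap Φ (i + 1) p) = 0 ∧
      fderiv ℝ (fun p => f (i + 1) (baseMap Φ (i + 1) p) - f 0 (baseMap Φ (i + 1) p)) p (0, e) = 0 := by
  refine hf.vanishing_sub hΦ hi (Nat.zero_le _) (s := fun p => co 0 p.2)
    (w' := fun p => p.2 - H (i + 1) 0 p.2 • ev 0) ?_ (fun p hp => ell_of_co_zero i hp) e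
  have : Continuous fun p : E × (Fin n → ℝ) => p.2 - H (i + 1) 0 p.2 • (ev 0 : Fin n → ℝ) :=
    (contDiff_snd.sub ((contDiff_H_snd (i + 1) 0).smul contDiff_const)).continuous
  simpa [H_zero_right] using this.tendsto (y₁, 0)

/-- The coefficient of the quadratic tangency of the fronts of the conormals with the front of the
zero section is nonzero and the same for all conormals. -/
theorem FrontData.exists_tangency_coefficient [FiniteDimensional ℝ E] (hn : 0 < n)
    (hΦ : IsLocalFamily Φ k y₁) (hf : FrontData Φ y₁ f K) :
    ∃ L : ℝ, L ≠ 0 ∧ ∀ i, i + 1 ≤ n → ∀ u : E × (Fin n → ℝ) → ℝ, ContDiff ℝ ∞ u →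
      (∀ᶠ p in 𝓝 (y₁, (0 : Fin n → ℝ)),
        f (i + 1) (baseMap Φ (i + 1) p) - f 0 (baseMap Φ (i + 1) p) = co 0 p.2 ^ 2 * u p) →
      u (y₁, 0) = L := by
  have hins : ContDiff ℝ ∞ fun z : Cot n => (y₁, z) := contDiff_const.prodMk contDiff_id
  have hφ : ContDiff ℝ ∞ fun z : Cot n => Φ (y₁, z) := hΦ.smooth.comp hins
  have hf₀ : ContDiff ℝ ∞ fun q : Fin n → ℝ => f 0 (y₁, q) :=
    (hf.contDiff 0 (Nat.zero_le _)).comp (contDiff_const.prodMk contDiff_id)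
  have hφd : ∀ z w, fderiv ℝ (fun z : Cot n => Φ (y₁, z)) z w = fderiv ℝ Φ (y₁, z) (0, w) :=
    fun z w => by
      have : HasFDerivAt (fun z : Cot n => Φ (y₁, z)) _ z :=
        (hΦ.smooth.differentiable (by simp) (y₁, z)).hasFDerivAt.comp z
          (hasFDerivAt_prodMk_right y₁ z)
      rw [this.fderiv]
      rfl
  have hf₀d : ∀ q, fderiv ℝ (fun q : Fin n → ℝ => f 0 (y₁, q)) q =
      (fderiv ℝ (f 0) (y₁, q)).comp (ContinuousLinearMap.inr ℝ E (Fin n → ℝ)) := fun q =>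
    (((hf.contDiff 0 (Nat.zero_le _)).differentiable (by simp) (y₁, q)).hasFDerivAt.comp q
      (hasFDerivAt_prodMk_right y₁ q)).fderiv
  set Q : Cot n → ℝ := fun z => (Φ (y₁, z)).1 - f 0 (y₁, (Φ (y₁, z)).2.1) with hQdef
  have hQ : ContDiff ℝ ∞ Q := hφ.fst.sub (hf₀.comp hφ.snd.fst)
  have hline : Tendsto (fun t : ℝ => (y₁, t • (ev 0 : Fin n → ℝ))) (𝓝 0) (𝓝 (y₁, 0)) := by
    have : Continuous fun t : ℝ => (y₁, t • (ev 0 : Fin n → ℝ)) := by fun_prop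
    simpa using this.tendsto 0
  have hut : ∀ u : E × (Fin n → ℝ) → ℝ, ContDiff ℝ ∞ u →
      ContDiff ℝ ∞ fun t : ℝ => u (y₁, t • ev 0) := fun u hu =>
    hu.comp (contDiff_const.prodMk (contDiff_id.smul contDiff_const))
  have hQu : ∀ i, i + 1 ≤ n → ∀ u : E × (Fin n → ℝ) → ℝ,
      (∀ᶠ p in 𝓝 (y₁, (0 : Fin n → ℝ)),
        f (i + 1) (baseMap Φ (i + 1) p) - f 0 (baseMap Φ (i + 1) p) = co 0 p.2 ^ 2 * u p) →
      ∀ᶠ t : ℝ in 𝓝 0, Q (0, t • ev 0) = t ^ 2 * u (y₁, t • ev 0) := by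
    intro i hi u hu
    filter_upwards [hline.eventually hu, hline.eventually (hf.val (i + 1) hi)] with t h1 h2
    rw [h2] at h1
    simp only [baseMap, ell_smul_ev hn, map_smul, co_ev_self hn, smul_eq_mul, mul_one] at h1
    exact h1
  -- On the common fibre (0, t e₀) of all conormals, Q = t² u. So u at the centre is half the second
  -- derivative of Q, for every i.
  refine ⟨fderiv ℝ (fderiv ℝ Q) 0 (0, ev 0) (0, ev 0) / 2, ?_, ?_⟩
  · obtain ⟨u, hu, hu'⟩ := exists_eq_sq_mul_of_vanishing (e := ((0 : E), (ev 0 : Fin n → ℝ)))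
      (((hf.contDiff (0 + 1) hn).comp (contDiff_baseMap hΦ.smooth (0 + 1))).sub
        ((hf.contDiff 0 hn.le).comp (contDiff_baseMap hΦ.smooth (0 + 1))))
      (contDiff_co_snd 0) (fun p c => by simp [co_ev_self hn]) (by simp)
      (hf.vanishing_sub_zeroSection hΦ hn (ev 0))
    have h1 := hQu 0 hn u hu'
    have h2 := sndDeriv_eq_of_eq_sq_mul hQ (hut u hu) (w := (0, ev 0)) (by
      filter_upwards [h1] with t ht
      simpa using ht)
    rw [h2]
    obtain ⟨v, hv⟩ := hΦ.bijective_dbaseZero.2 (dbaseConormal Φ y₁ (ev 0))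
    -- If co 0 v were 0, the two base derivatives would agree on v, and injectivity would give v =
    -- ev 0.
    have hv0 : co 0 v ≠ 0 := by
      intro h0
      rw [← dbaseConormal_eq_of_co h0] at hv
      have := (hΦ.bijective_dbaseConormal hn).1 hv
      rw [this, co_ev_self hn] at h0
      exact one_ne_zero h0
    have hz : Tendsto (fun z : Cot n => (y₁, z)) (𝓝 0) (𝓝 (y₁, 0)) := hins.continuous.tendsto 0
    have hz' : Tendsto (fun x : Fin n → ℝ => (y₁, x)) (𝓝 0) (𝓝 (y₁, 0)) := by
      have : Continuous fun x : Fin n → ℝ => (y₁, x) := by fun_prop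
      exact this.tendsto 0
    have h3 := tangency_nondegenerate hφ hf₀ hΦ.cont hΦ.ne (v := v)
      (by
        filter_upwards [hz.eventually hΦ.contact] with z h w
        rw [hφd]
        exact h w)
      (by
        filter_upwards [hz'.eventually (hf.jet 0 (Nat.zero_le _))] with x hx
        rw [hf₀d]
        ext1 ν
        exact hx ν)
      (by
        rw [hφd, hφd, ← dbase_apply, ← dbase_apply]
        simpa [dbaseZero, dbaseConormal, co_ev_self hn] using hv)
      hv0 (hut u hu) h1
    intro h4
    apply h3
    linarith
  · intro i hi u hu hu'
    have h2 := sndDeriv_eq_of_eq_sq_mul hQ (hut u hu) (w := (0, ev 0)) (by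
      filter_upwards [hQu i hi u hu'] with t ht
      simpa using ht)
    rw [h2]
    simp

/-- The next square root exists. -/
theorem exists_isRoot [FiniteDimensional ℝ E]
    (hΦ : IsLocalFamily Φ k y₁) (hf : FrontData Φ y₁ f K)
    (hg0 : ∀ i ≤ n, g 0 i = fun q => -(ε * (f i q - f 0 q)))
    (hε : ε = 1 ∨ ε = -1) {L : ℝ} (hεL : 0 < ε * L)
    (hL : ∀ i, i + 1 ≤ n → ∀ u : E × (Fin n → ℝ) → ℝ, ContDiff ℝ ∞ u →
      (∀ᶠ p in 𝓝 (y₁, (0 : Fin n → ℝ)),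
        f (i + 1) (baseMap Φ (i + 1) p) - f 0 (baseMap Φ (i + 1) p) = co 0 p.2 ^ 2 * u p) →
      u (y₁, 0) = L)
    {a : ℕ} (hroot : ∀ a' < a, ∀ i, a' < i → i ≤ n → IsRoot Φ y₁ g a' i) {i : ℕ}
    (hai : a < i) (hi : i ≤ n) :
    ∃ G : E × (Fin n → ℝ) → ℝ, ContDiff ℝ ∞ G ∧ G (center Φ y₁) = 0 ∧
      (∀ᶠ q in 𝓝 (center Φ y₁), G q ^ 2 = g a a q - g a i q) ∧
      (∃ c : ℝ, ∀ w, fderiv ℝ G (center Φ y₁) (0, dbaseConormal Φ y₁ w) = c * co a w) ∧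
      0 < fderiv ℝ G (center Φ y₁) (0, dbaseZero Φ y₁ (ev a)) := by
  have hn : 0 < n := by omega
  have hF : ContDiff ℝ ∞ fun q => g a a q - g a i q :=
    (smooth_of_isRoot hf hg0 hroot le_rfl le_rfl (by omega)).sub
      (smooth_of_isRoot hf hg0 hroot le_rfl hai.le hi)
  cases a with
  | zero =>
    obtain ⟨j, rfl⟩ : ∃ j, i = j + 1 := ⟨i - 1, by omega⟩
    have hFe : (fun q => g 0 0 q - g 0 (j + 1) q) = fun q => ε * (f (j + 1) q - f 0 q) := by
      rw [hg0 0 (by omega), hg0 (j + 1) hi]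
      funext q
      ring
    have hεε : ε * ε = 1 := by rcases hε with rfl | rfl <;> norm_num
    have hsd : ∀ w, fderiv ℝ (fun p : E × (Fin n → ℝ) => co 0 p.2) (y₁, 0) (0, w) = co 0 w := by
      intro w
      have h1 : HasFDerivAt (fun p : E × (Fin n → ℝ) => co 0 p.2) _ (y₁, 0) :=
        (co (n := n) 0).hasFDerivAt.comp (y₁, (0 : Fin n → ℝ)) hasFDerivAt_snd
      rw [h1.fderiv]
      rfl
    rw [hFe] at hF
    obtain ⟨G, hG, hG0, hGF, c, hc, hGc⟩ := hf.exists_root_of_vanishing hΦ (a := 0) hi hF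
      (contDiff_co_snd 0) (fun p c => by simp [co_ev_self hn]) (by simp) hsd
      (by
        filter_upwards [hf.vanishing_sub_zeroSection hΦ hi (ev 0)] with p hp hs
        obtain ⟨h1, h2⟩ := hp hs
        refine ⟨by rw [h1, mul_zero], ?_⟩
        have hB := contDiff_baseMap hΦ.smooth (j + 1)
        have hd : DifferentiableAt ℝ
            (fun p => f (j + 1) (baseMap Φ (j + 1) p) - f 0 (baseMap Φ (j + 1) p)) p :=
          ((((hf.contDiff (j + 1) hi).comp hB).sub
            ((hf.contDiff 0 hn.le).comp hB)).differentiable (by simp)) p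
        rw [fderiv_const_mul hd]
        simp [h2])
      (by
        intro u hu hu'
        have := hL j hi (fun p => ε * u p) (contDiff_const.mul hu) (by
          filter_upwards [hu'] with p hp
          rw [show co 0 p.2 ^ 2 * (ε * u p) = ε * (co 0 p.2 ^ 2 * u p) by ring, ← hp, ← mul_assoc,
            hεε, one_mul])
        rwa [← this, ← mul_assoc, hεε, one_mul] at hεL)
    have hFe' : ∀ q, g 0 0 q - g 0 (j + 1) q = ε * (f (j + 1) q - f 0 q) := congrFun hFe
    have hne : fderiv ℝ G (center Φ y₁) (0, dbaseZero Φ y₁ (ev 0)) ≠ 0 := by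
      obtain ⟨r, hr⟩ := (hΦ.bijective_dbaseConormal hn).2 (dbaseZero Φ y₁ (ev 0))
      rw [← hr, hGc]
      refine mul_ne_zero hc.ne' fun h0 => ?_
      rw [dbaseConormal_eq_of_co h0] at hr
      rw [hΦ.bijective_dbaseZero.1 hr, co_ev_self hn] at h0
      exact one_ne_zero h0
    -- For a = 0 the sign of the root has to be chosen to meet the normalization along the zero
    -- section.
    rcases lt_or_gt_of_ne hne with hlt | hgt
    · have hnegd : fderiv ℝ (fun q => - G q) (center Φ y₁) = - fderiv ℝ G (center Φ y₁) :=
        fderiv_fun_neg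
      refine ⟨fun q => - G q, hG.neg, by simp [hG0], ?_, ⟨-c, fun w => ?_⟩, ?_⟩
      · filter_upwards [hGF] with q hq
        rw [neg_sq, hq, hFe']
      · rw [hnegd, neg_apply, hGc]
        ring
      · rw [hnegd, neg_apply]
        linarith
    · refine ⟨G, hG, hG0, ?_, ⟨c, hGc⟩, hgt⟩
      filter_upwards [hGF] with q hq
      rw [hq, hFe']
  | succ a =>
    obtain ⟨l, rfl⟩ : ∃ l, i = a + 1 + (l + 1) := ⟨i - (a + 1) - 1, by omega⟩
    obtain ⟨G, hG, hG0, hGF, c, hc, hGc⟩ := hf.exists_root_of_vanishing hΦ (a := a + 1)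
      (i := a + 1 + l) hi hF (contDiff_H_snd (l + 1) (a + 1))
      (fun p c => by simp [H_succ_add_smul_ev (show a + 1 < n by omega)])
      (by simp [H_zero_right]) (fderiv_H_snd l (a + 1))
      (vanishing_of_isRoot hΦ hf hg0 hi hroot le_rfl)
      (fun u hu hu' => pos_of_isRoot hΦ hf hg0 hi hroot hu hu')
    refine ⟨G, hG, hG0, hGF, ⟨c, hGc⟩, ?_⟩
    -- Here the index is a + 1 ≥ 1, so the two base derivatives agree on ev (a + 1) and the positive
    -- constant c already gives the right sign.
    rw [← dbaseConormal_eq_of_co (co_ev_of_ne (by omega)), hGc, co_ev_self (by omega), mul_one]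
    exact hc

/-- All square roots exist. -/
theorem exists_roots [FiniteDimensional ℝ E]
    (hΦ : IsLocalFamily Φ k y₁) (hf : FrontData Φ y₁ f K)
    (hε : ε = 1 ∨ ε = -1) {L : ℝ} (hεL : 0 < ε * L)
    (hL : ∀ i, i + 1 ≤ n → ∀ u : E × (Fin n → ℝ) → ℝ, ContDiff ℝ ∞ u →
      (∀ᶠ p in 𝓝 (y₁, (0 : Fin n → ℝ)),
        f (i + 1) (baseMap Φ (i + 1) p) - f 0 (baseMap Φ (i + 1) p) = co 0 p.2 ^ 2 * u p) →
      u (y₁, 0) = L) (m : ℕ) :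
    ∃ g : ℕ → ℕ → E × (Fin n → ℝ) → ℝ, (∀ i ≤ n, g 0 i = fun q => -(ε * (f i q - f 0 q))) ∧
      ∀ a < m, ∀ i, a < i → i ≤ n → IsRoot Φ y₁ g a i := by
  induction m with
  | zero => exact ⟨fun _ i q => -(ε * (f i q - f 0 q)), fun _ _ => rfl, fun a ha => absurd ha (by simp)⟩
  | succ m ih =>
    obtain ⟨g, hg0, hroot⟩ := ih
    have hex := fun i : ℕ => fun h : m < i ∧ i ≤ n =>
      exists_isRoot hΦ hf hg0 hε hεL hL hroot h.1 h.2
    choose! G hG using hex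
    refine ⟨fun a i => if a = m + 1 then G i else g a i, fun i hi => ?_, fun a ha i hai hi => ?_⟩
    · simpa using hg0 i hi
    · by_cases ham : a = m
      · subst ham
        obtain ⟨h1, h2, h3, h4, h5⟩ := hG i ⟨hai, hi⟩
        constructor
        · simpa using h1
        · simpa using h2
        · simpa using h3
        · simpa using h4
        · simpa using h5
      · have e2 : a ≠ m + 1 := by omega
        obtain ⟨h1, h2, h3, h4, h5⟩ := hroot a (by omega) i hai hi
        constructor
        · simpa [ham] using h1
        · simpa [ham] using h2
        · simpa [e2, ham] using h3
        · simpa [ham] using h4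
        · simpa [ham] using h5

/-- The normal form of the front functions of a local family: there are coordinates `X` on the
base in which the fronts of all pieces are the model ones. -/
theorem IsLocalFamily.exists_normalForm [FiniteDimensional ℝ E] (hΦ : IsLocalFamily Φ k y₁) :
    ∃ (ε : ℝ) (f₀ : E × (Fin n → ℝ) → ℝ) (X : E × (Fin n → ℝ) → Fin n → ℝ),
      (ε = 1 ∨ ε = -1) ∧ (n = 0 → ε = 1) ∧ ContDiff ℝ ∞ f₀ ∧ ContDiff ℝ ∞ X ∧
      (∀ᶠ p in 𝓝 (y₁, (0 : Fin n → ℝ)), f₀ (baseMap Φ 0 p) = (Φ (p.1, ell 0 p.2)).1) ∧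
      (∀ i ≤ n, ∀ᶠ p in 𝓝 (y₁, (0 : Fin n → ℝ)),
        ε * ((Φ (p.1, ell i p.2)).1 - f₀ (baseMap Φ i p)) = H i 0 (X (baseMap Φ i p)) ^ 2) ∧
      (∀ a < n, 0 < co a (fderiv ℝ X (center Φ y₁) (0, dbaseZero Φ y₁ (ev a)))) ∧
      Function.Injective fun w => fderiv ℝ X (center Φ y₁) (0, w) := by
  obtain ⟨f, K, hf⟩ := hΦ.exists_frontData
  rcases Nat.eq_zero_or_pos n with rfl | hn
  · refine ⟨1, f 0, fun _ => 0, Or.inl rfl, fun _ => rfl, hf.contDiff 0 le_rfl, contDiff_const,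
      hf.val 0 le_rfl, fun i hi => ?_, fun a ha => absurd ha (by simp),
      fun w w' _ => Subsingleton.elim _ _⟩
    obtain rfl : i = 0 := by omega
    filter_upwards [hf.val 0 le_rfl] with p hp
    rw [hp]
    simp [H_zero_left]
  obtain ⟨L, hL0, hL⟩ := hf.exists_tangency_coefficient hn hΦ
  obtain ⟨ε, hε, hεL⟩ : ∃ ε : ℝ, (ε = 1 ∨ ε = -1) ∧ 0 < ε * L := by
    rcases lt_or_gt_of_ne hL0 with h | h
    · exact ⟨-1, Or.inr rfl, by linarith⟩
    · exact ⟨1, Or.inl rfl, by linarith⟩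
  obtain ⟨g, hg0, hroot⟩ := exists_roots hΦ hf hε hεL hL n
  have hX : ContDiff ℝ ∞ fun q => fun j : Fin n => g (j + 1) (j + 1) q :=
    contDiff_pi.2 fun j => (hroot j j.isLt (j + 1) (by omega) (by omega)).smooth
  -- In the model g (a + 1) (a + 1) is H 1 a, the a-th coordinate.
  set X : E × (Fin n → ℝ) → Fin n → ℝ := fun q => fun j : Fin n => g (j + 1) (j + 1) q with hXdef
  have hcoX : ∀ a < n, ∀ q, co a (X q) = g (a + 1) (a + 1) q := fun a ha q => co_of_lt ha _
  have hXd : ∀ a < n, ∀ v, co a (fderiv ℝ X (center Φ y₁) v) =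
      fderiv ℝ (g (a + 1) (a + 1)) (center Φ y₁) v := by
    intro a ha v
    have h1 : HasFDerivAt (fun q => co a (X q)) _ (center Φ y₁) :=
      (co a).hasFDerivAt.comp _ (hX.differentiable (by simp) (center Φ y₁)).hasFDerivAt
    have h2 : (fun q => co a (X q)) = g (a + 1) (a + 1) := funext (hcoX a ha)
    rw [← h2, h1.fderiv]
    rfl
  -- The defining relation of a root, solved for the subtracted term, is the recursion H (l + 1) a =
  -- co a - H l (a + 1)².
  have hgH : ∀ l a, a + 1 + l ≤ n → ∀ᶠ q in 𝓝 (center Φ y₁),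
      g (a + 1) (a + 1 + l) q = H (l + 1) a (X q) := by
    intro l
    induction l with
    | zero =>
      intro a ha
      refine Eventually.of_forall fun q => ?_
      rw [H_succ, H_zero_left, hcoX a (by omega)]
      simp
    | succ l ih =>
      intro a ha
      filter_upwards [ih (a + 1) (by omega),
        (hroot (a + 1) (by omega) (a + 1 + (l + 1)) (by omega) ha).sq] with q h1 h2
      rw [H_succ, ← h1, hcoX a (by omega), show a + 1 + 1 + l = a + 1 + (l + 1) by omega, h2]
      ring
  refine ⟨ε, f 0, X, hε, fun h => absurd h hn.ne', hf.contDiff 0 (Nat.zero_le _), hX,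
    hf.val 0 (Nat.zero_le _), fun i hi => ?_, fun a ha => ?_, ?_⟩
  · cases i with
    | zero =>
      filter_upwards [hf.val 0 hi] with p hp
      rw [hp]
      simp [H_zero_left]
    | succ i =>
      have ht := tendsto_baseMap (y₁ := y₁) hΦ.smooth (i + 1)
      filter_upwards [hf.val (i + 1) hi, ht.eventually (hgH i 0 (by omega)),
        ht.eventually (hroot 0 hn (i + 1) (by omega) hi).sq] with p h1 h2 h3
      rw [← h2, show 0 + 1 + i = i + 1 by omega, h3, hg0 0 hn.le, hg0 (i + 1) hi, ← h1]
      ring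
  · rw [hXd a ha]
    exact (hroot a ha (a + 1) (by omega) (by omega)).pos
  · have hlin : ∀ w w' : Fin n → ℝ, fderiv ℝ X (center Φ y₁) (0, w) =
        fderiv ℝ X (center Φ y₁) (0, w') → w = w' := by
      intro w w' h
      obtain ⟨r, rfl⟩ := (hΦ.bijective_dbaseConormal hn).2 w
      obtain ⟨r', rfl⟩ := (hΦ.bijective_dbaseConormal hn).2 w'
      congr 1
      refine ext_co fun a ha => ?_
      have hr := hroot a ha (a + 1) (by omega) (by omega)
      obtain ⟨c, hc⟩ := hr.deriv
      have h1 : co a (fderiv ℝ X (center Φ y₁) (0, dbaseConormal Φ y₁ r)) =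
        co a (fderiv ℝ X (center Φ y₁) (0, dbaseConormal Φ y₁ r')) := by rw [h]
      rw [hXd a ha, hXd a ha, hc, hc] at h1
      refine mul_left_cancel₀ (fun h0 => ?_) h1
      have hp := hr.pos
      obtain ⟨s, hs⟩ := (hΦ.bijective_dbaseConormal hn).2 (dbaseZero Φ y₁ (ev a))
      rw [← hs, hc, h0, zero_mul] at hp
      exact lt_irrefl _ hp
    exact fun w w' h => hlin w w' h

end Roots

/-! ### Uniqueness of the normalizing germ. -/

section Uniqueness

variable {n : ℕ} {Y : Type*} [TopologicalSpace Y]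

/-- The coordinates `X` and the function `f₀` bring the front germs of the family `Φ`, for
parameters near `y₁`, to the normal form. -/
structure IsSolution (Φ : Y × Cot n → J1 n) (ε : ℝ) (f₀ : Y → (Fin n → ℝ) → ℝ)
    (X : Y → (Fin n → ℝ) → Fin n → ℝ) (y₁ : Y) : Prop where
  sign : ε = 1 ∨ ε = -1
  sign_zero : n = 0 → ε = 1
  zeroSection : ∀ᶠ p in 𝓝 (y₁, (0 : Fin n → ℝ)),
    f₀ p.1 (baseMap Φ 0 p).2 = (Φ (p.1, ell 0 p.2)).1
  pieces : ∀ i ≤ n, ∀ᶠ p in 𝓝 (y₁, (0 : Fin n → ℝ)),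
    ε * ((Φ (p.1, ell i p.2)).1 - f₀ p.1 (baseMap Φ i p).2) = H i 0 (X p.1 (baseMap Φ i p).2) ^ 2
  diff : ∀ᶠ q in 𝓝 (center Φ y₁), DifferentiableAt ℝ (X q.1) q.2
  cont : ContinuousAt (fun q : Y × (Fin n → ℝ) => X q.1 q.2) (center Φ y₁)
  cont_deriv : ContinuousAt (fun q : Y × (Fin n → ℝ) => fderiv ℝ (X q.1) q.2) (center Φ y₁)
  pos : ∀ a < n, 0 < co a (fderiv ℝ (X y₁) (center Φ y₁).2
    (fderiv ℝ (fun z => Φ (y₁, z)) 0 (ev a, 0)).2.1)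

/-- From h₁ = 0 comes x₁ = 0, and then hₗ₊₁ = x₁ - hₗ² shows that all the functions of the remaining
coordinates vanish. This fixes the image of the central point. -/
theorem eq_zero_of_forall_H_eq_zero {x : Fin n → ℝ} (h : ∀ i ≤ n, H i 0 x = 0) : x = 0 := by
  have key : ∀ b, ∀ l, b + l ≤ n → H l b x = 0 := by
    intro b
    induction b with
    | zero => exact fun l hl => h l (by omega)
    | succ b ih =>
      intro l hl
      have h1 := ih (l + 1) (by omega)
      have h2 := ih 1 (by omega)
      rw [H_succ] at h1 h2
      rw [H_zero_left] at h2
      have h3 : H l (b + 1) x ^ 2 = 0 := by linarith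
      simpa using h3
  refine ext_co fun a ha => ?_
  have := key a 1 (by omega)
  rw [H_succ, H_zero_left] at this
  simpa using this

variable {Φ : Y × Cot n → J1 n} {ε ε' : ℝ} {f₀ f₀' : Y → (Fin n → ℝ) → ℝ}
  {X X' : Y → (Fin n → ℝ) → Fin n → ℝ} {y₁ : Y}

/-- All pieces pass through the origin of T*ℝⁿ, so every hᵢ ∘ X vanishes at the central point. -/
theorem IsSolution.eventually_center (h : IsSolution Φ ε f₀ X y₁) :
    ∀ᶠ y in 𝓝 y₁, f₀ y (center Φ y).2 = (Φ (y, 0)).1 ∧ X y (center Φ y).2 = 0 := by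
  have ht : Tendsto (fun y : Y => (y, (0 : Fin n → ℝ))) (𝓝 y₁) (𝓝 (y₁, 0)) := by
    have : Continuous fun y : Y => (y, (0 : Fin n → ℝ)) := by fun_prop
    exact this.tendsto y₁
  have hp : ∀ᶠ y in 𝓝 y₁, ∀ i : Fin (n + 1), ε * ((Φ (y, ell i 0)).1 -
      f₀ y (baseMap Φ i (y, 0)).2) = H i 0 (X y (baseMap Φ i (y, 0)).2) ^ 2 :=
    eventually_all.2 fun i => ht.eventually (h.pieces i (by omega))
  filter_upwards [hp, ht.eventually h.zeroSection] with y h1 h2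
  simp only [ell_zero_right, baseMap_zero] at h1 h2
  refine ⟨h2, eq_zero_of_forall_H_eq_zero fun i hi => ?_⟩
  have := h1 ⟨i, by omega⟩
  simp only [h2, sub_self, mul_zero] at this
  exact pow_eq_zero_iff (two_ne_zero) |>.1 this.symm

/-- Being a solution is an open condition on the parameter. -/
theorem IsSolution.eventually (h : IsSolution Φ ε f₀ X y₁) (hc : ContinuousAt (center Φ) y₁)
    (hX : ∀ᶠ q in 𝓝 (center Φ y₁), ContinuousAt (fun q : Y × (Fin n → ℝ) => X q.1 q.2) q)
    (hX' : ∀ᶠ q in 𝓝 (center Φ y₁),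
      ContinuousAt (fun q : Y × (Fin n → ℝ) => fderiv ℝ (X q.1) q.2) q)
    (hΦ : ContinuousAt (fun y => fderiv ℝ (fun z => Φ (y, z)) 0) y₁) :
    ∀ᶠ y in 𝓝 y₁, IsSolution Φ ε f₀ X y := by
  have ht : Tendsto (fun y : Y => (y, (0 : Fin n → ℝ))) (𝓝 y₁) (𝓝 (y₁, 0)) := by
    have : Continuous fun y : Y => (y, (0 : Fin n → ℝ)) := by fun_prop
    exact this.tendsto y₁
  have hp : ∀ᶠ y in 𝓝 y₁, ∀ i : Fin (n + 1), ∀ᶠ p in 𝓝 (y, (0 : Fin n → ℝ)),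
      ε * ((Φ (p.1, ell i p.2)).1 - f₀ p.1 (baseMap Φ i p).2) =
        H i 0 (X p.1 (baseMap Φ i p).2) ^ 2 :=
    eventually_all.2 fun i => ht.eventually (h.pieces i (by omega)).eventually_nhds
  have hpos : ∀ᶠ y in 𝓝 y₁, ∀ a : Fin n, 0 < fderiv ℝ (X y) (center Φ y).2
      (fderiv ℝ (fun z => Φ (y, z)) 0 (ev a, 0)).2.1 a := by
    refine eventually_all.2 fun a => ?_
    have h1 : ContinuousAt (fun y => fderiv ℝ (X y) (center Φ y).2) y₁ :=
      ContinuousAt.comp (f := center Φ) (x := y₁) h.cont_deriv hc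
    have h2 : ContinuousAt (fun y => (fderiv ℝ (fun z => Φ (y, z)) 0 (ev (a : ℕ), 0)).2.1) y₁ :=
      (hΦ.clm_apply continuousAt_const).snd.fst
    have h3 : ContinuousAt (fun y => fderiv ℝ (X y) (center Φ y).2
        (fderiv ℝ (fun z => Φ (y, z)) 0 (ev (a : ℕ), 0)).2.1 a) y₁ :=
      (continuous_apply a).continuousAt.comp (h1.clm_apply h2)
    refine h3.eventually (lt_mem_nhds ?_)
    have := h.pos a a.2
    rwa [co_val] at this
  filter_upwards [ht.eventually h.zeroSection.eventually_nhds, hp, hc.eventually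
    h.diff.eventually_nhds, hc.eventually hX, hc.eventually hX', hpos] with y h1 h2 h3 h4 h5 h6
  refine ⟨h.sign, h.sign_zero, h1, fun i hi => h2 ⟨i, by omega⟩, h3, h4, h5, fun a ha => ?_⟩
  rw [co_of_lt ha]
  exact h6 ⟨a, ha⟩

/-- The normalizing coordinates are unique as germs. -/
theorem IsSolution.unique
    (hmap : ∀ i ≤ n, map (baseMap Φ i) (𝓝 (y₁, (0 : Fin n → ℝ))) = 𝓝 (center Φ y₁))
    (h : IsSolution Φ ε f₀ X y₁) (h' : IsSolution Φ ε' f₀' X' y₁) :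
    ε = ε' ∧ ∀ᶠ q in 𝓝 (center Φ y₁), f₀ q.1 q.2 = f₀' q.1 q.2 ∧ X q.1 q.2 = X' q.1 q.2 := by
  have hX0 : X y₁ (center Φ y₁).2 = 0 := h.eventually_center.self_of_nhds.2
  have hX0' : X' y₁ (center Φ y₁).2 = 0 := h'.eventually_center.self_of_nhds.2
  have hf : ∀ᶠ q in 𝓝 (center Φ y₁), f₀ q.1 q.2 = f₀' q.1 q.2 := by
    rw [← hmap 0 (Nat.zero_le _), eventually_map]
    filter_upwards [h.zeroSection, h'.zeroSection] with p h1 h2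
    exact h1.trans h2.symm
  have hsq : ∀ i ≤ n, ∀ᶠ q in 𝓝 (center Φ y₁),
      ε' * H i 0 (X q.1 q.2) ^ 2 = ε * H i 0 (X' q.1 q.2) ^ 2 := by
    intro i hi
    rw [← hmap i hi, eventually_map] at hf ⊢
    filter_upwards [h.pieces i hi, h'.pieces i hi, hf] with p h1 h2 h3
    have h3' : f₀ p.1 (baseMap Φ i p).2 = f₀' p.1 (baseMap Φ i p).2 := h3
    have e : (baseMap Φ i p).1 = p.1 := rfl
    rw [e, ← h1, ← h2, h3']
    ring
  have hsec : Tendsto (fun q : Fin n → ℝ => (y₁, q)) (𝓝 (center Φ y₁).2) (𝓝 (center Φ y₁)) := by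
    have : Continuous fun q : Fin n → ℝ => (y₁, q) := by fun_prop
    exact this.tendsto _
  -- Opposite signs would make a sum of two squares zero, hence the first coordinate constant,
  -- against `pos`. For n = 0 nothing determines ε, which is the reason for `sign_zero`.
  have hε : ε = ε' := by
    rcases Nat.eq_zero_or_pos n with hn | hn
    · rw [h.sign_zero hn, h'.sign_zero hn]
    by_contra hne
    have hzero : ∀ᶠ q in 𝓝 (center Φ y₁).2, co 0 (X y₁ q) = 0 := by
      filter_upwards [hsec.eventually (hsq 1 hn)] with q hq
      simp only [H_succ, H_zero_left, ne_eq, OfNat.ofNat_ne_zero, not_false_eq_true, zero_pow,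
        sub_zero] at hq
      have hneg : ε' = - ε := by
        rcases h.sign with h1 | h1 <;> rcases h'.sign with h2 | h2 <;> rw [h1, h2] at hne ⊢ <;>
          first | exact absurd rfl hne | norm_num
      have hε0 : ε ≠ 0 := by rcases h.sign with h1 | h1 <;> rw [h1] <;> norm_num
      have hsum : ε * (co 0 (X y₁ q) ^ 2 + co 0 (X' y₁ q) ^ 2) = 0 := by
        rw [hneg] at hq
        linarith
      have h1 := (mul_eq_zero.1 hsum).resolve_left hε0
      have h2 : co 0 (X y₁ q) ^ 2 = 0 := by
        linarith [sq_nonneg (co 0 (X y₁ q)), sq_nonneg (co 0 (X' y₁ q))]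
      simpa using h2
    have h1 : HasFDerivAt (fun q => co 0 (X y₁ q)) _ (center Φ y₁).2 :=
      (co 0).hasFDerivAt.comp _ (hsec.eventually h.diff).self_of_nhds.hasFDerivAt
    have h2 : HasFDerivAt (fun q => co 0 (X y₁ q)) (0 : (Fin n → ℝ) →L[ℝ] ℝ) (center Φ y₁).2 :=
      (hasFDerivAt_const (0 : ℝ) _).congr_of_eventuallyEq hzero
    have h3 := DFunLike.congr_fun (h1.unique h2)
      (fderiv ℝ (fun z => Φ (y₁, z)) 0 (ev 0, 0)).2.1
    exact (h.pos 0 hn).ne' h3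
  refine ⟨hε, ?_⟩
  subst hε
  have hε0 : ε ≠ 0 := by rcases h.sign with h | h <;> rw [h] <;> norm_num
  have hroot : ∀ a l, a < n → (∀ᶠ q in 𝓝 (center Φ y₁),
      H (l + 1) a (X q.1 q.2) ^ 2 = H (l + 1) a (X' q.1 q.2) ^ 2) →
      ∀ᶠ q in 𝓝 (center Φ y₁), H (l + 1) a (X q.1 q.2) = H (l + 1) a (X' q.1 q.2) := by
    intro a l ha hs
    have hdH := differentiable_H (n := n) (l + 1) a
    have hcH : Continuous (fderiv ℝ (H (n := n) (l + 1) a)) :=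
      (contDiff_H (l + 1) a).continuous_fderiv (by simp)
    -- D is the fibre differential of the sum of the two candidate roots. Both are positive on the
    -- same vector, so D is nonzero and the factor H ∘ X - H ∘ X' must vanish.
    let D : Y × (Fin n → ℝ) → (Fin n → ℝ) →L[ℝ] ℝ := fun q =>
      (fderiv ℝ (H (l + 1) a) (X q.1 q.2)).comp (fderiv ℝ (X q.1) q.2) +
        (fderiv ℝ (H (l + 1) a) (X' q.1 q.2)).comp (fderiv ℝ (X' q.1) q.2)
    have hDc : ContinuousAt D (center Φ y₁) :=
      ((hcH.continuousAt.comp h.cont).clm_comp h.cont_deriv).add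
        ((hcH.continuousAt.comp h'.cont).clm_comp h'.cont_deriv)
    have hD0 : D (center Φ y₁) ≠ 0 := by
      intro h0
      have e : (center Φ y₁).1 = y₁ := rfl
      have h1 := DFunLike.congr_fun h0 (fderiv ℝ (fun z => Φ (y₁, z)) 0 (ev a, 0)).2.1
      simp only [D, add_apply, ContinuousLinearMap.comp_apply, e, hX0, hX0',
        fderiv_H_of_eq_zero (H_zero_right (n := n) l (a + 1)), zero_apply] at h1
      linarith [h.pos a ha, h'.pos a ha]
    have := eventually_eq_zero_of_mul_eq_zero
      (C := fun y q => H (l + 1) a (X y q) + H (l + 1) a (X' y q))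
      (a := fun y q => H (l + 1) a (X y q) - H (l + 1) a (X' y q))
      (y₁ := y₁) (p₁ := (center Φ y₁).2) ?_ ?_ ?_
    · filter_upwards [this] with q hq
      exact sub_eq_zero.1 hq
    · filter_upwards [h.diff, h'.diff, hDc.eventually_ne hD0] with q h1 h2 h3
      have h4 : HasFDerivAt (fun x => H (l + 1) a (X q.1 x) + H (l + 1) a (X' q.1 x)) (D q) q.2 :=
        ((hdH (X q.1 q.2)).hasFDerivAt.comp q.2 h1.hasFDerivAt).add
          ((hdH (X' q.1 q.2)).hasFDerivAt.comp q.2 h2.hasFDerivAt)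
      rwa [h4.fderiv]
    · filter_upwards [h.diff, h'.diff] with q h1 h2
      exact ((hdH _).continuousAt.comp h1.continuousAt).sub
        ((hdH _).continuousAt.comp h2.continuousAt)
    · filter_upwards [hs] with q hq
      rw [← sub_eq_zero] at hq
      rw [← hq]
      ring
  have hall : ∀ a, ∀ l, a + l ≤ n → ∀ᶠ q in 𝓝 (center Φ y₁),
      H l a (X q.1 q.2) ^ 2 = H l a (X' q.1 q.2) ^ 2 := by
    intro a
    induction a with
    | zero =>
      intro l hl
      filter_upwards [hsq l (by omega)] with q hq
      exact mul_left_cancel₀ hε0 hq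
    | succ a ih =>
      intro l hl
      -- The case l = 0 identifies the a-th coordinates; with it, equality of the roots for l + 1
      -- leaves equality of the squares one index further.
      filter_upwards [hroot a l (by omega) (ih (l + 1) (by omega)),
        hroot a 0 (by omega) (ih 1 (by omega))] with q h1 h2
      rw [H_succ, H_succ] at h1
      rw [H_succ, H_succ, H_zero_left, H_zero_left] at h2
      linarith
  have hco : ∀ᶠ q in 𝓝 (center Φ y₁), ∀ a : Fin n, co a (X q.1 q.2) = co a (X' q.1 q.2) := by
    refine eventually_all.2 fun a => ?_
    filter_upwards [hroot a 0 a.isLt (hall a 1 (by omega))] with q h2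
    rw [H_succ, H_succ, H_zero_left, H_zero_left] at h2
    linarith
  filter_upwards [hf, hco] with q h1 h2
  exact ⟨h1, ext_co fun a ha => h2 ⟨a, ha⟩⟩

end Uniqueness

/-! ### From families over a manifold to local families in a chart. -/

section Charts

theorem nhds_le_map_of_right_inverse {A B : Type*} [TopologicalSpace A] [TopologicalSpace B]
    {F : A → B} {R : B → A} {a : A} {b : B} (hR : Tendsto R (𝓝 b) (𝓝 a))
    (h : ∀ᶠ x in 𝓝 b, F (R x) = x) : 𝓝 b ≤ map F (𝓝 a) := by
  intro s hs
  filter_upwards [hR.eventually (mem_map.1 hs), h] with x h1 h2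
  rw [← h2]
  exact h1

variable {n d : ℕ} {Y : Type*} [TopologicalSpace Y] [ChartedSpace (EuclideanSpace ℝ (Fin d)) Y]

/-- Families of maps with invertible derivative are locally surjective, uniformly in the
parameter. -/
theorem nhds_le_map_of_injective_fderiv {G : EuclideanSpace ℝ (Fin d) × (Fin n → ℝ) → Fin n → ℝ}
    (hG : ContDiff ℝ ∞ G) {y₁ : Y} {q₁ : Fin n → ℝ}
    (hinj : Function.Injective fun w => fderiv ℝ G (extChartAt (𝓡 d) y₁ y₁, q₁) (0, w)) :
    𝓝 (y₁, G (extChartAt (𝓡 d) y₁ y₁, q₁)) ≤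
      map (fun q : Y × (Fin n → ℝ) => (q.1, G (extChartAt (𝓡 d) y₁ q.1, q.2))) (𝓝 (y₁, q₁)) := by
  set e := extChartAt (𝓡 d) y₁ with he
  have hF : ContDiff ℝ ∞ fun p : EuclideanSpace ℝ (Fin d) × (Fin n → ℝ) => (p.1, G p) :=
    contDiff_fst.prodMk hG
  obtain ⟨K, hK, hKl, hKr⟩ := exists_contDiff_local_inverse hF (o := (e y₁, q₁)) (by
    rw [injective_iff_map_eq_zero]
    rintro ⟨α, w⟩ h
    have h1 : HasFDerivAt (fun p : EuclideanSpace ℝ (Fin d) × (Fin n → ℝ) => (p.1, G p)) _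
        (e y₁, q₁) := hasFDerivAt_fst.prodMk (hG.differentiable (by simp) _).hasFDerivAt
    rw [h1.fderiv, ContinuousLinearMap.prod_apply] at h
    obtain ⟨h2, h3⟩ := Prod.mk.inj h
    have h4 : α = 0 := h2
    subst h4
    have h5 : w = 0 := hinj (h3.trans
      (map_zero (fderiv ℝ G (e y₁, q₁))).symm)
    rw [h5]
    rfl)
  have hec : Tendsto (fun q : Y × (Fin n → ℝ) => (e q.1, q.2)) (𝓝 (y₁, G (e y₁, q₁)))
      (𝓝 (e y₁, G (e y₁, q₁))) :=
    (((continuousAt_extChartAt (I := 𝓡 d) y₁).tendsto.comp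
      (continuous_fst.tendsto (y₁, G (e y₁, q₁)))).prodMk_nhds (continuous_snd.tendsto _))
  have hKo : K (e y₁, G (e y₁, q₁)) = (e y₁, q₁) := hKl.self_of_nhds
  refine nhds_le_map_of_right_inverse (R := fun q => (q.1, (K (e q.1, q.2)).2)) ?_ ?_
  · refine (continuous_fst.tendsto _).prodMk_nhds ?_
    have h1 : Tendsto (fun p => (K p).2) (𝓝 (e y₁, G (e y₁, q₁))) (𝓝 q₁) := by
      have := (hK.snd.continuous).tendsto (e y₁, G (e y₁, q₁))
      rwa [hKo] at this
    exact h1.comp hec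
  · filter_upwards [hec.eventually hKr] with q hq
    obtain ⟨h1, h2⟩ := Prod.mk.inj hq
    have h3 : K (e q.1, q.2) = (e q.1, (K (e q.1, q.2)).2) := Prod.ext h1 rfl
    rw [← h3]
    exact Prod.ext rfl h2

variable [IsManifold (𝓡 d) ∞ Y]

/-- The base maps of a local family are local homeomorphisms over the parameter space. -/
def BaseMapsOpenAt (Φ : Y × Cot n → J1 n) (y₁ : Y) : Prop :=
  ∀ i ≤ n, map (baseMap Φ i) (𝓝 (y₁, (0 : Fin n → ℝ))) = 𝓝 (center Φ y₁)

/-- A solution of the normal form problem that depends smoothly on all variables. -/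
structure IsSmoothSolution (Φ : Y × Cot n → J1 n) (ε : ℝ) (f₀ : Y → (Fin n → ℝ) → ℝ)
    (X : Y → (Fin n → ℝ) → Fin n → ℝ) (y₁ : Y) : Prop extends IsSolution Φ ε f₀ X y₁ where
  smooth_f : ∀ᶠ q in 𝓝 (center Φ y₁), ContMDiffAt ((𝓡 d).prod 𝓘(ℝ, Fin n → ℝ)) 𝓘(ℝ, ℝ) ∞
    (fun q : Y × (Fin n → ℝ) => f₀ q.1 q.2) q
  smooth_X : ∀ᶠ q in 𝓝 (center Φ y₁), ContMDiffAt ((𝓡 d).prod 𝓘(ℝ, Fin n → ℝ))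
    𝓘(ℝ, Fin n → ℝ) ∞ (fun q : Y × (Fin n → ℝ) => X q.1 q.2) q
  diff_f : DifferentiableAt ℝ (f₀ y₁) (center Φ y₁).2
  inj : Function.Injective (fderiv ℝ (X y₁) (center Φ y₁).2)
  open_X : 𝓝 (y₁, (0 : Fin n → ℝ)) ≤
    map (fun q : Y × (Fin n → ℝ) => (q.1, X q.1 q.2)) (𝓝 (center Φ y₁))
  near : ∀ᶠ y in 𝓝 y₁, IsSolution Φ ε f₀ X y

/-- Solutions exist near every parameter. -/
theorem exists_isSmoothSolution {U : Set (Y × Cot n)} {φ : Y → Cot n → J1 n} (hU : IsOpen U)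
    (hU0 : ∀ y, (y, (0 : Cot n)) ∈ U)
    (hφ : ContMDiffOn ((𝓡 d).prod 𝓘(ℝ, Cot n)) 𝓘(ℝ, J1 n) ∞
      (fun a : Y × Cot n => φ a.1 a.2) U)
    (hW : ∀ y, IsWeinsteinEmbeddingOn (φ y) {z | (y, z) ∈ U})
    (hT : ∀ y, TransverseToFibersOn (φ y) {z | (y, z) ∈ U}) (y₁ : Y) :
    BaseMapsOpenAt (fun a : Y × Cot n => φ a.1 a.2) y₁ ∧
    ∃ ε f₀ X, IsSmoothSolution (d := d) (fun a : Y × Cot n => φ a.1 a.2) ε f₀ X y₁ := by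
  set e := extChartAt (𝓡 d) y₁ with he
  set Φ : Y × Cot n → J1 n := fun a => φ a.1 a.2 with hΦdef
  have hes : e.symm (e y₁) = y₁ := extChartAt_to_inv y₁
  have hesrc : ∀ᶠ y in 𝓝 y₁, e.symm (e y) = y := by
    filter_upwards [extChartAt_source_mem_nhds (I := 𝓡 d) y₁] with y hy
    exact e.left_inv hy
  have hetgt : ∀ᶠ y in 𝓝 (e y₁), y ∈ e.target := extChartAt_target_mem_nhds (I := 𝓡 d) y₁
  have hsymm : Tendsto (fun a : EuclideanSpace ℝ (Fin d) × Cot n => (e.symm a.1, a.2))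
      (𝓝 (e y₁, 0)) (𝓝 (y₁, 0)) := by
    refine Tendsto.prodMk_nhds ?_ (continuous_snd.tendsto _)
    have h1 : Tendsto e.symm (𝓝 (e y₁)) (𝓝 y₁) := by
      have := (continuousAt_extChartAt_symm (I := 𝓡 d) y₁).tendsto
      rwa [← he, hes] at this
    exact h1.comp (continuous_fst.tendsto _)
  have hfstt : Tendsto (Prod.fst : EuclideanSpace ℝ (Fin d) × Cot n → _) (𝓝 (e y₁, 0))
      (𝓝 (e y₁)) := continuous_fst.tendsto _
  have hΦ₁ : ∀ᶠ a in 𝓝 (e y₁, (0 : Cot n)),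
      ContDiffAt ℝ ∞ (fun a : EuclideanSpace ℝ (Fin d) × Cot n => φ (e.symm a.1) a.2) a := by
    filter_upwards [hsymm.eventually (hU.mem_nhds (hU0 y₁)), hfstt.eventually
      hetgt.eventually_nhds] with a h1 h2
    rw [← contMDiffAt_iff_contDiffAt]
    have h3 : ContMDiffAt ((𝓡 d).prod 𝓘(ℝ, Cot n)) 𝓘(ℝ, J1 n) ∞ Φ (e.symm a.1, a.2) :=
      hφ.contMDiffAt (hU.mem_nhds h1)
    have h4 : ContMDiffAt 𝓘(ℝ, EuclideanSpace ℝ (Fin d)) (𝓡 d) ∞ e.symm a.1 :=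
      (contMDiffOn_extChartAt_symm (I := 𝓡 d) y₁).contMDiffAt h2
    have h5 : ContMDiffAt 𝓘(ℝ, EuclideanSpace ℝ (Fin d) × Cot n) ((𝓡 d).prod 𝓘(ℝ, Cot n)) ∞
        (fun a : EuclideanSpace ℝ (Fin d) × Cot n => (e.symm a.1, a.2)) a :=
      (h4.comp a (contDiff_fst.contMDiff.contMDiffAt)).prodMk contDiff_snd.contMDiff.contMDiffAt
    exact h3.comp a h5
  -- Only the germ at the base point matters, so the family in the chart is replaced by a globally
  -- smooth representative.
  obtain ⟨Φ', hΦ', hΦe⟩ := exists_contDiff_eventuallyEq hΦ₁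
  have hfib : ∀ᶠ a in 𝓝 (e y₁, (0 : Cot n)), ∀ w,
      fderiv ℝ Φ' a (0, w) = fderiv ℝ (φ (e.symm a.1)) a.2 w := by
    filter_upwards [hΦe.eventually_nhds] with a ha w
    have h1 : (fun z => Φ' (a.1, z)) =ᶠ[𝓝 a.2] φ (e.symm a.1) := by
      have : Continuous fun z : Cot n => (a.1, z) := by fun_prop
      exact (this.tendsto a.2).eventually ha
    have h2 : HasFDerivAt (fun z => Φ' (a.1, z)) _ a.2 :=
      (hΦ'.differentiable (by simp) (a.1, a.2)).hasFDerivAt.comp a.2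
        (hasFDerivAt_prodMk_right a.1 a.2)
    rw [← h1.fderiv_eq, h2.fderiv]
    rfl
  have hfib0 : ∀ w, fderiv ℝ Φ' (e y₁, 0) (0, w) = fderiv ℝ (φ y₁) 0 w := by
    have := hfib.self_of_nhds
    rwa [hes] at this
  have hΦ0 : Φ' (e y₁, 0) = φ y₁ 0 := by
    have h1 : Φ' (e y₁, 0) = φ (e.symm (e y₁)) 0 := hΦe.self_of_nhds
    rw [h1, hes]
  -- The conformal factor is chosen separately for each parameter and need not be continuous in it.
  -- `IsLocalFamily` accordingly asks only for continuity in z at the fixed parameter y₁.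
  choose V F hVo hVim hFs hFne hFc using fun y => (hW y).contact
  have hlocal : IsLocalFamily Φ' (fun a => (F (e.symm a.1) (φ (e.symm a.1) a.2))⁻¹) (e y₁) := by
    refine ⟨hΦ', ?_, ?_, ?_, ?_⟩
    · filter_upwards [hΦe, hfib, hsymm.eventually (hU.mem_nhds (hU0 y₁))] with a h1 h2 h3 w
      have h4 := hFc (e.symm a.1) a.2 h3 w
      have h5 := hFne (e.symm a.1) _ (hVim _ (mem_image_of_mem _ h3))
      rw [h1, h2, ← h4, inv_mul_cancel_left₀ h5]
    · simp only [hes]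
      have h0 : φ y₁ 0 ∈ V y₁ := hVim _ (mem_image_of_mem _ (hU0 y₁))
      have h1 : ContinuousAt (F y₁) (φ y₁ 0) :=
        (hFs y₁).continuousOn.continuousAt ((hVo y₁).mem_nhds h0)
      have hUy : IsOpen {z | (y₁, z) ∈ U} := hU.preimage (by fun_prop)
      have h2 : ContinuousAt (φ y₁) 0 :=
        (hW y₁).smooth.continuousOn.continuousAt (hUy.mem_nhds (hU0 y₁))
      exact (ContinuousAt.comp (f := φ y₁) (x := (0 : Cot n)) h1 h2).inv₀ (hFne _ _ h0)
    · simp only [hes]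
      exact inv_ne_zero (hFne _ _ (hVim _ (mem_image_of_mem _ (hU0 y₁))))
    · intro i hi
      have htr := hT y₁ ⟨i, by omega⟩ 0 ⟨by
        have := ell_mem_lagPiece (⟨i, by omega⟩ : Fin (n + 1)) 0
        rwa [ell_zero_right] at this, hU0 y₁⟩
      -- Transversality says that the tangent space of the piece surjects onto the base. Both have
      -- dimension n, so this is the required injectivity.
      have hsurj : Function.Surjective
          ((dbase Φ' (e y₁)).comp (fderiv ℝ (ell i) 0)).toLinearMap := by
        intro v
        have hv : ((0, v, 0) : J1 n) ∈ (⊤ : Submodule ℝ (J1 n)) := trivial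
        rw [← htr] at hv
        obtain ⟨a, ha, b, hb, hab⟩ := Submodule.mem_sup.1 hv
        obtain ⟨t, ht, rfl⟩ := Submodule.mem_map.1 ha
        obtain ⟨w, rfl⟩ := tangentSpan_lagPiece_le _ ht
        refine ⟨w, ?_⟩
        have hb' : b.2.1 = 0 := hb
        have h1 := congrArg (fun q : J1 n => q.2.1) hab
        simp only [Prod.snd_add, Prod.fst_add, hb', add_zero] at h1
        change dbase Φ' (e y₁) (fderiv ℝ (ell i) 0 w) = v
        rw [dbase_apply, hfib0]
        exact h1
      exact LinearMap.injective_iff_surjective.2 hsurj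
  have hbig : ∀ i, ∀ᶠ p in 𝓝 (y₁, (0 : Fin n → ℝ)), Φ' (e p.1, ell i p.2) = Φ (p.1, ell i p.2) := by
    intro i
    have ht : Tendsto (fun p : Y × (Fin n → ℝ) => (e p.1, ell i p.2)) (𝓝 (y₁, 0))
        (𝓝 (e y₁, (0 : Cot n))) := by
      refine ((continuousAt_extChartAt (I := 𝓡 d) y₁).tendsto.comp
        (continuous_fst.tendsto (y₁, (0 : Fin n → ℝ)))).prodMk_nhds ?_
      have := ((contDiff_ell (n := n) i).continuous.comp continuous_snd).tendsto
        (y₁, (0 : Fin n → ℝ))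
      rw [Function.comp_apply, ell_zero_right] at this
      exact this
    have hf : Tendsto (Prod.fst : Y × (Fin n → ℝ) → Y) (𝓝 (y₁, 0)) (𝓝 y₁) :=
      continuous_fst.tendsto _
    filter_upwards [ht.eventually hΦe, hf.eventually hesrc] with p h1 h2
    rw [h1]
    simp only [h2, hΦdef]
  have hbase : ∀ i, ∀ᶠ p in 𝓝 (y₁, (0 : Fin n → ℝ)),
      baseMap Φ' i (e p.1, p.2) = (e p.1, (baseMap Φ i p).2) := by
    intro i
    filter_upwards [hbig i] with p hp
    simp only [baseMap, hp]
  have hchart : ∀ q₁ : Fin n → ℝ, ContinuousAt (fun q : Y × (Fin n → ℝ) => (e q.1, q.2)) (y₁, q₁) :=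
    fun q₁ => ((continuousAt_extChartAt (I := 𝓡 d) y₁).tendsto.comp
      (continuous_fst.tendsto (y₁, q₁))).prodMk_nhds (continuous_snd.tendsto _)
  have hcenter : center Φ' (e y₁) = (e y₁, (center Φ y₁).2) := by
    simp only [center, hΦ0, hΦdef]
  refine ⟨fun i hi => le_antisymm ?_ ?_, ?_⟩
  · rw [← baseMap_zero Φ i]
    have hell : Tendsto (fun p : Y × (Fin n → ℝ) => (baseMap Φ' i (e p.1, p.2)).2) (𝓝 (y₁, 0))
        (𝓝 (baseMap Φ i (y₁, 0)).2) := by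
      have h1 := ((contDiff_baseMap hΦ' i).snd.continuous.continuousAt).comp (hchart 0)
      have h2 := h1.tendsto
      simp only [Function.comp_apply] at h2
      rwa [(hbase i).self_of_nhds] at h2
    refine Tendsto.congr' ?_ ((continuous_fst.tendsto (y₁, (0 : Fin n → ℝ))).prodMk_nhds hell)
    filter_upwards [hbase i] with p hp
    rw [hp]
    rfl
  · have hinj : Function.Injective fun w =>
        fderiv ℝ (fun p => (baseMap Φ' i p).2) (extChartAt (𝓡 d) y₁ y₁, 0) (0, w) := by
      have h1 : HasFDerivAt (fun p => (baseMap Φ' i p).2) _ (e y₁, 0) :=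
        ((contDiff_baseMap hΦ' i).differentiable (by simp) (e y₁, 0)).hasFDerivAt.snd
      rw [← he, h1.fderiv]
      intro w w' h
      have h2 : ∀ w, ((ContinuousLinearMap.snd ℝ _ _).comp
          (fderiv ℝ (baseMap Φ' i) (e y₁, 0))) (0, w) = dbase Φ' (e y₁) (fderiv ℝ (ell i) 0 w) := by
        intro w
        rw [ContinuousLinearMap.comp_apply, fderiv_baseMap_zero hΦ']
        rfl
      simp only [h2] at h
      exact hlocal.transverse i hi h
    have h1 := nhds_le_map_of_injective_fderiv (Y := Y) (contDiff_baseMap hΦ' i).snd hinj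
    rw [← he] at h1
    have h2 : (y₁, (baseMap Φ' i (e y₁, 0)).2) = center Φ y₁ := by
      rw [baseMap_zero, hcenter]
      rfl
    rw [h2] at h1
    refine h1.trans (le_of_eq (Filter.map_congr ?_))
    filter_upwards [hbase i] with p hp
    rw [hp]
    rfl
  · obtain ⟨ε, f₀, X, hε, hε0, hf₀, hX, hzero, hpieces, hpos, hinj⟩ := hlocal.exists_normalForm
    have hXfib : ∀ (y : Y) (q : Fin n → ℝ), HasFDerivAt (fun q => X (e y, q))
        ((fderiv ℝ X (e y, q)).comp (ContinuousLinearMap.inr ℝ _ _)) q := fun y q =>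
      (hX.differentiable (by simp) (e y, q)).hasFDerivAt.comp q (hasFDerivAt_prodMk_right (e y) q)
    have hcsmooth : ∀ᶠ q in 𝓝 (center Φ y₁), ContMDiffAt ((𝓡 d).prod 𝓘(ℝ, Fin n → ℝ))
        𝓘(ℝ, EuclideanSpace ℝ (Fin d) × (Fin n → ℝ)) ∞
        (fun q : Y × (Fin n → ℝ) => (e q.1, q.2)) q := by
      have hf : Tendsto (Prod.fst : Y × (Fin n → ℝ) → Y) (𝓝 (center Φ y₁)) (𝓝 y₁) :=
        continuous_fst.tendsto _
      filter_upwards [hf.eventually (chart_source_mem_nhds (EuclideanSpace ℝ (Fin d)) y₁)] with q hq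
      exact ((contMDiffAt_extChartAt' hq).comp q contMDiffAt_fst).prodMk_space contMDiffAt_snd
    have hderiv : (fun q : Y × (Fin n → ℝ) => fderiv ℝ (fun q' => X (e q.1, q')) q.2) =
        fun q => (fderiv ℝ X (e q.1, q.2)).comp (ContinuousLinearMap.inr ℝ _ _) :=
      funext fun q => (hXfib q.1 q.2).fderiv
    have hccont : ∀ᶠ q in 𝓝 (center Φ y₁), ContinuousAt
        (fun q : Y × (Fin n → ℝ) => (e q.1, q.2)) q :=
      hcsmooth.mono fun q hq => hq.continuousAt
    have hsol : IsSolution Φ ε (fun y q => f₀ (e y, q)) (fun y q => X (e y, q)) y₁ := by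
      refine ⟨hε, hε0, ?_, fun i hi => ?_,
        Eventually.of_forall fun q => (hXfib q.1 q.2).differentiableAt, ?_, ?_, fun a ha => ?_⟩
      · filter_upwards [(hchart 0).eventually hzero, hbase 0, hbig 0] with p h1 h2 h3
        rw [h2] at h1
        rw [h1, h3]
      · filter_upwards [(hchart 0).eventually (hpieces i hi), hbase i, hbig i] with p h1 h2 h3
        rw [h2, h3] at h1
        exact h1
      · exact (hX.continuous.continuousAt).comp (hchart _)
      · rw [hderiv]
        exact ((hX.continuous_fderiv (by simp)).continuousAt.comp (hchart _)).clm_comp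
          continuousAt_const
      · have h1 := hpos a ha
        rw [(hXfib y₁ _).fderiv]
        rw [hcenter, dbaseZero, dbase_apply, hfib0] at h1
        exact h1
    refine ⟨ε, fun y q => f₀ (e y, q), fun y q => X (e y, q), ⟨hsol, ?_, ?_, ?_, ?_, ?_, ?_⟩⟩
    · filter_upwards [hcsmooth] with q hq
      exact (hf₀.contMDiff.contMDiffAt).comp q hq
    · filter_upwards [hcsmooth] with q hq
      exact (hX.contMDiff.contMDiffAt).comp q hq
    · exact ((hf₀.differentiable (by simp) (e y₁, (center Φ y₁).2)).hasFDerivAt.comp _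
        (hasFDerivAt_prodMk_right (e y₁) (center Φ y₁).2)).differentiableAt
    · rw [(hXfib y₁ _).fderiv]
      rw [hcenter] at hinj
      exact hinj
    · rw [hcenter] at hinj
      have h1 := nhds_le_map_of_injective_fderiv (Y := Y) (y₁ := y₁) hX hinj
      rw [← he] at h1
      have h2 : X (e y₁, (center Φ y₁).2) = 0 := by
        refine eq_zero_of_forall_H_eq_zero fun i hi => ?_
        have h3 := (hpieces i hi).self_of_nhds
        have h4 := hzero.self_of_nhds
        simp only [baseMap_zero, ell_zero_right] at h3 h4
        rw [h4, sub_self, mul_zero, hcenter] at h3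
        exact pow_eq_zero_iff two_ne_zero |>.1 h3.symm
      rw [h2] at h1
      exact h1
    · have hy0 : Tendsto (fun y : Y => (e y, (0 : Cot n))) (𝓝 y₁) (𝓝 (e y₁, 0)) :=
        (continuousAt_extChartAt (I := 𝓡 d) y₁).tendsto.prodMk_nhds tendsto_const_nhds
      refine hsol.eventually ?_ ?_ ?_ ?_
      · have h1 : ContinuousAt (fun y => (y, (Φ' (e y, 0)).2.1)) y₁ :=
          continuousAt_id.prodMk
            ((hΦ'.continuous.continuousAt.comp hy0).snd.fst)
        refine h1.congr ?_
        filter_upwards [hy0.eventually hΦe, hesrc] with y h2 h3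
        rw [h2, h3]
        rfl
      · filter_upwards [hccont] with q hq
        exact hX.continuous.continuousAt.comp hq
      · filter_upwards [hccont] with q hq
        rw [hderiv]
        exact ((hX.continuous_fderiv (by simp)).continuousAt.comp hq).clm_comp continuousAt_const
      · have h1 : ContinuousAt (fun y => (fderiv ℝ Φ' (e y, 0)).comp
            (ContinuousLinearMap.inr ℝ (EuclideanSpace ℝ (Fin d)) (Cot n))) y₁ :=
          ((hΦ'.continuous_fderiv (by simp)).continuousAt.comp hy0).clm_comp continuousAt_const
        refine h1.congr ?_
        filter_upwards [hy0.eventually hfib, hesrc] with y h2 h3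
        refine ContinuousLinearMap.ext fun w => ?_
        have := h2 w
        rw [h3] at this
        exact this

end Charts

/-! ### Gluing local families along a section. -/

section Gluing

variable {d : ℕ} {Y : Type*} [TopologicalSpace Y] [ChartedSpace (EuclideanSpace ℝ (Fin d)) Y]
  [IsManifold (𝓡 d) ∞ Y]
variable {F : Type} [NormedAddCommGroup F] [NormedSpace ℝ F]
variable {G : Type} [NormedAddCommGroup G] [NormedSpace ℝ G]

/-- The fibrewise derivative of a smooth family of maps is smooth. -/
theorem contMDiff_fiberDeriv {Ψ : Y × F → G}
    (hΨ : ContMDiff ((𝓡 d).prod 𝓘(ℝ, F)) 𝓘(ℝ, G) ∞ Ψ) :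
    ContMDiff ((𝓡 d).prod 𝓘(ℝ, F)) 𝓘(ℝ, F →L[ℝ] G) ∞
      (fun a : Y × F => fderiv ℝ (fun q => Ψ (a.1, q)) a.2) := by
  intro a
  have h1 : ContMDiffAt ((((𝓡 d).prod 𝓘(ℝ, F))).prod 𝓘(ℝ, F)) 𝓘(ℝ, G) ∞
      (Function.uncurry fun (a : Y × F) (q : F) => Ψ (a.1, q)) (a, a.2) := by
    have : ContMDiff ((((𝓡 d).prod 𝓘(ℝ, F))).prod 𝓘(ℝ, F)) ((𝓡 d).prod 𝓘(ℝ, F)) ∞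
        (fun b : (Y × F) × F => (b.1.1, b.2)) :=
      (contMDiff_fst.comp contMDiff_fst).prodMk contMDiff_snd
    exact (hΨ.comp this) _
  have h2 := ContMDiffAt.mfderiv (m := ∞) (fun (a : Y × F) (q : F) => Ψ (a.1, q)) Prod.snd h1
    contMDiffAt_snd (by simp)
  erw [inTangentCoordinates_model_space] at h2
  simp only [mfderiv_eq_fderiv] at h2
  exact h2

/-- Local families that agree near a section glue to a global one. -/
theorem exists_contMDiff_glue [FiniteDimensional ℝ F] [T2Space Y] [SecondCountableTopology Y]
    {s : Y → F} (hs : Continuous s) {Ψ : Y → Y × F → G}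
    (hΨ : ∀ y₁, ∀ᶠ a in 𝓝 (y₁, s y₁), ContMDiffAt ((𝓡 d).prod 𝓘(ℝ, F)) 𝓘(ℝ, G) ∞ (Ψ y₁) a)
    (hc : ∀ y₁, ∀ᶠ y in 𝓝 y₁, Ψ y₁ =ᶠ[𝓝 (y, s y)] Ψ y) :
    ∃ Θ : Y × F → G, ContMDiff ((𝓡 d).prod 𝓘(ℝ, F)) 𝓘(ℝ, G) ∞ Θ ∧
      ∀ y, Θ =ᶠ[𝓝 (y, s y)] Ψ y := by
  have : LocallyCompactSpace Y := ChartedSpace.locallyCompactSpace (EuclideanSpace ℝ (Fin d)) Y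
  have : ProperSpace F := FiniteDimensional.proper ℝ F
  have hO : ∀ y₁, ∃ O : Set (Y × F), IsOpen O ∧ (y₁, s y₁) ∈ O ∧
      (∀ a ∈ O, ContMDiffAt ((𝓡 d).prod 𝓘(ℝ, F)) 𝓘(ℝ, G) ∞ (Ψ y₁) a) ∧
      ∀ a ∈ O, Ψ y₁ =ᶠ[𝓝 (a.1, s a.1)] Ψ a.1 := by
    intro y₁
    have hf : Tendsto (Prod.fst : Y × F → Y) (𝓝 (y₁, s y₁)) (𝓝 y₁) := continuous_fst.tendsto _
    obtain ⟨O, hO, hOo, hOm⟩ := eventually_nhds_iff.1 ((hΨ y₁).and (hf.eventually (hc y₁)))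
    exact ⟨O, hOo, hOm, fun a ha => (hO a ha).1, fun a ha => (hO a ha).2⟩
  choose O hOo hOm hOs hOc using hO
  have hgraph : IsClosed {a : Y × F | a.2 = s a.1} :=
    isClosed_eq continuous_snd (hs.comp continuous_fst)
  -- The index `none` covers the complement of the section, where the values are irrelevant and 0 is
  -- used.
  let W : Option Y → Set (Y × F) := fun j => j.elim {a : Y × F | a.2 = s a.1}ᶜ O
  let g : Option Y → Y × F → G := fun j => j.elim 0 Ψ
  obtain ⟨ρ, hρ⟩ := SmoothPartitionOfUnity.exists_isSubordinate ((𝓡 d).prod 𝓘(ℝ, F))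
    (isClosed_univ (X := Y × F)) W
    (by rintro (_ | y); exacts [hgraph.isOpen_compl, hOo y])
    (by
      rintro ⟨y, q⟩ -
      by_cases hq : q = s y
      · exact mem_iUnion.2 ⟨some y, by subst hq; exact hOm y⟩
      · exact mem_iUnion.2 ⟨none, hq⟩)
  refine ⟨fun a => ∑ᶠ j, ρ j a • g j a, ρ.contMDiff_finsum_smul ?_, fun y => ?_⟩
  · rintro (_ | y) a ha
    · exact contMDiffAt_const
    · exact hOs y a (hρ (some y) ha)
  · have hfin : ∀ᶠ a in 𝓝 (y, s y), ∀ j ∈ ρ.fintsupport (y, s y), g j a = Ψ y a := by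
      refine (Filter.eventually_all_finset _).2 fun j hj => ?_
      rw [ρ.mem_fintsupport_iff] at hj
      have h1 := hρ j hj
      rcases j with _ | y'
      · exact absurd rfl h1
      · exact hOc y' _ h1
    filter_upwards [hfin, ρ.eventually_finsupport_subset (y, s y)] with a h1 h2
    have h3 : ∀ j, ρ j a • g j a = ρ j a • Ψ y a := by
      intro j
      by_cases hj : ρ j a = 0
      · rw [hj, zero_smul, zero_smul]
      · rw [h1 j (h2 ((ρ.mem_finsupport a).2 hj))]
    simp only [h3]
    rw [← finsum_smul' ?_, ρ.sum_eq_one (mem_univ a), one_smul]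
    exact (ρ.locallyFinite.point_finite a)

end Gluing

/-! ### Small perturbations of linear isomorphisms. -/

section Extension

variable {F : Type} [NormedAddCommGroup F] [NormedSpace ℝ F]

/-- A small smooth perturbation of a linear isomorphism is a diffeomorphism. -/
theorem exists_diffeomorph_of_perturbation [FiniteDimensional ℝ F] [Nontrivial F] (A : F ≃L[ℝ] F)
    {T : F → F} (hT : ContDiff ℝ ∞ T)
    (hb : ∀ v, ‖fderiv ℝ T v‖ * ‖(A.symm : F →L[ℝ] F)‖ ≤ 1 / 2) :
    ∃ ψ : F ≃ₘ[ℝ] F, ∀ v, ψ v = A v + T v := by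
  have hN : 0 < ‖(A.symm : F →L[ℝ] F)‖ := A.norm_symm_pos
  have hc : ∀ v, ‖fderiv ℝ T v‖ ≤ 1 / 2 * ‖(A.symm : F →L[ℝ] F)‖⁻¹ := fun v => by
    rw [← div_eq_mul_inv, le_div_iff₀ hN]
    exact hb v
  have hdT : Differentiable ℝ T := hT.differentiable (by simp)
  have happ : ApproximatesLinearOn (fun v => A v + T v) (A : F →L[ℝ] F) univ
      (1 / 2 * ‖(A.symm : F →L[ℝ] F)‖₊⁻¹) := by
    intro x _ y _
    have h1 := convex_univ.norm_image_sub_le_of_norm_fderiv_le (𝕜 := ℝ) (fun x _ => hdT x)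
      (fun x _ => hc x) (mem_univ y) (mem_univ x)
    have h2 : A x + T x - (A y + T y) - (A : F →L[ℝ] F) (x - y) = T x - T y := by
      rw [ContinuousLinearEquiv.coe_coe, map_sub]
      abel
    rw [h2]
    simpa using h1
  -- The Lipschitz constant of T is at most half of ‖A⁻¹‖⁻¹, below the threshold at which A + T
  -- remains a homeomorphism.
  let f : F ≃ₜ F := happ.toHomeomorph _ (Or.inr (by
    have : 0 < ‖(A.symm : F →L[ℝ] F)‖₊⁻¹ := inv_pos.2 A.nnnorm_symm_pos
    exact mul_lt_of_lt_one_left this (by norm_num [← NNReal.coe_lt_coe])))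
  have hf : ∀ v, f v = A v + T v := fun v => rfl
  have hfs : ContDiff ℝ ∞ f := A.contDiff.add hT
  have hinj : ∀ v, Function.Injective ((A : F →L[ℝ] F) + fderiv ℝ T v) := by
    intro v
    rw [injective_iff_map_eq_zero]
    intro w hw
    have h1 : A w = - fderiv ℝ T v w := eq_neg_of_add_eq_zero_left hw
    have h2 : ‖w‖ ≤ ‖(A.symm : F →L[ℝ] F)‖ * ‖A w‖ := by
      have := (A.symm : F →L[ℝ] F).le_opNorm (A w)
      simpa using this
    rw [h1, norm_neg] at h2
    have h3 := (fderiv ℝ T v).le_opNorm w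
    have h4 : ‖w‖ ≤ 1 / 2 * ‖w‖ :=
      calc ‖w‖ ≤ ‖(A.symm : F →L[ℝ] F)‖ * (‖fderiv ℝ T v‖ * ‖w‖) :=
            h2.trans (mul_le_mul_of_nonneg_left h3 hN.le)
        _ = (‖fderiv ℝ T v‖ * ‖(A.symm : F →L[ℝ] F)‖) * ‖w‖ := by ring
        _ ≤ _ := mul_le_mul_of_nonneg_right (hb v) (norm_nonneg w)
    have h5 := norm_nonneg w
    exact norm_eq_zero.1 (by linarith)
  have hfi : ContDiff ℝ ∞ f.symm := by
    refine f.contDiff_symm (f₀' := fun v => (LinearEquiv.ofInjectiveEndo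
      ((A : F →L[ℝ] F) + fderiv ℝ T v).toLinearMap (hinj v)).toContinuousLinearEquiv) ?_ hfs
    intro v
    exact A.hasFDerivAt.add (hdT v).hasFDerivAt
  exact ⟨⟨f.toEquiv, hfs.contMDiff, hfi.contMDiff⟩, hf⟩

/-- The derivative of a map cut off at scale `δ` is controlled by the derivative of the map. -/
theorem norm_fderiv_cutoff_le {χ : F → ℝ} (hχ : ContDiff ℝ ∞ χ) (hχ0 : ∀ v, 0 ≤ χ v)
    (hχ1 : ∀ v, χ v ≤ 1) (hχz : ∀ v, 2 ≤ ‖v‖ → χ v = 0) {C : ℝ} (hC : ∀ v, ‖fderiv ℝ χ v‖ ≤ C)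
    {S : F → F} (hS : ContDiff ℝ ∞ S) (hS0 : S 0 = 0) {δ η : ℝ} (hδ : 0 < δ) 
    (hη : ∀ v, ‖v‖ ≤ 2 * δ → ‖fderiv ℝ S v‖ ≤ η) (v : F) :
    ‖fderiv ℝ (fun v => χ (δ⁻¹ • v) • S v) v‖ ≤ (1 + 2 * C) * η := by
  have hC0 : 0 ≤ C := (norm_nonneg _).trans (hC 0)
  have hη0 : 0 ≤ η := (norm_nonneg _).trans (hη 0 (by simp [hδ.le]))
  rcases le_or_gt ‖v‖ (2 * δ) with hv | hv
  · have h1 : HasFDerivAt (fun v : F => χ (δ⁻¹ • v))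
        ((fderiv ℝ χ (δ⁻¹ • v)).comp (δ⁻¹ • ContinuousLinearMap.id ℝ F)) v :=
      (hχ.differentiable (by simp) _).hasFDerivAt.comp v ((hasFDerivAt_id v).const_smul δ⁻¹)
    have h2 := h1.smul (hS.differentiable (by simp) v).hasFDerivAt
    -- As S(0) = 0, the size of S on the disc is of order δ, which absorbs the factor δ⁻¹ from the
    -- derivative of the cutoff. The final bound does not involve δ.
    have hSv : ‖S v‖ ≤ η * (2 * δ) := by
      have h3 := (convex_closedBall (0 : F) (2 * δ)).norm_image_sub_le_of_norm_fderiv_le (𝕜 := ℝ)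
        (f := S) (C := η) (fun x _ => hS.differentiable (by simp) x)
        (fun x hx => hη x (by simpa using hx)) (x := 0) (y := v)
        (by simp [hδ.le]) (by simpa using hv)
      rw [hS0, sub_zero, sub_zero] at h3
      exact h3.trans (mul_le_mul_of_nonneg_left hv hη0)
    rw [HasFDerivAt.fderiv (f := fun v => χ (δ⁻¹ • v) • S v) h2]
    refine ContinuousLinearMap.opNorm_le_bound _ (by positivity) fun w => ?_
    have h4 : ‖χ (δ⁻¹ • v) • fderiv ℝ S v w‖ ≤ η * ‖w‖ := by
      rw [norm_smul, Real.norm_of_nonneg (hχ0 _)]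
      calc χ (δ⁻¹ • v) * ‖fderiv ℝ S v w‖ ≤ 1 * ‖fderiv ℝ S v w‖ :=
            mul_le_mul_of_nonneg_right (hχ1 _) (norm_nonneg _)
        _ ≤ η * ‖w‖ := by
            rw [one_mul]
            exact (fderiv ℝ S v).le_of_opNorm_le (hη v hv) w
    have h5 : ‖fderiv ℝ χ (δ⁻¹ • v) (δ⁻¹ • w) • S v‖ ≤ 2 * C * η * ‖w‖ := by
      rw [norm_smul, map_smul, norm_smul, Real.norm_of_nonneg (inv_pos.2 hδ).le]
      calc δ⁻¹ * ‖fderiv ℝ χ (δ⁻¹ • v) w‖ * ‖S v‖ ≤ δ⁻¹ * (C * ‖w‖) * (η * (2 * δ)) := by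
            gcongr
            exact (fderiv ℝ χ (δ⁻¹ • v)).le_of_opNorm_le (hC _) w
        _ = 2 * C * η * ‖w‖ := by field_simp
    calc ‖χ (δ⁻¹ • v) • fderiv ℝ S v w + fderiv ℝ χ (δ⁻¹ • v) (δ⁻¹ • w) • S v‖
        ≤ η * ‖w‖ + 2 * C * η * ‖w‖ := (norm_add_le _ _).trans (add_le_add h4 h5)
      _ = (1 + 2 * C) * η * ‖w‖ := by ring
  · have h1 : (fun v => χ (δ⁻¹ • v) • S v) =ᶠ[𝓝 v] fun _ => 0 := by
      filter_upwards [continuous_norm.continuousAt.eventually (lt_mem_nhds hv)] with u hu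
      rw [hχz, zero_smul]
      rw [norm_smul, Real.norm_of_nonneg (inv_pos.2 hδ).le, inv_mul_eq_div, le_div_iff₀ hδ]
      exact hu.le
    rw [h1.fderiv_eq, fderiv_const_apply, norm_zero]
    positivity

end Extension

/-! ### Extension of families of germs to families of diffeomorphisms. -/

section FamilyExtension

variable {d : ℕ} {Y : Type*} [TopologicalSpace Y] [ChartedSpace (EuclideanSpace ℝ (Fin d)) Y]
  [IsManifold (𝓡 d) ∞ Y] [T2Space Y] [SecondCountableTopology Y]
variable {F : Type} [NormedAddCommGroup F]

/-- A condition that holds near the zero section `Y × {0}` holds on a disc bundle of smoothly varying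
radius. -/
theorem exists_contMDiff_radius {P : Y × F → Prop} (hP : ∀ y, ∀ᶠ a in 𝓝 (y, (0 : F)), P a) :
    ∃ δ : Y → ℝ, ContMDiff (𝓡 d) 𝓘(ℝ, ℝ) ∞ δ ∧ (∀ y, 0 < δ y) ∧
      ∀ y v, ‖v‖ ≤ 2 * δ y → P (y, v) := by
  have : LocallyCompactSpace Y := ChartedSpace.locallyCompactSpace (EuclideanSpace ℝ (Fin d)) Y
  -- The admissible radii at each point form an interval, and some constant radius is admissible
  -- near each point. This is what selection by a partition of unity needs.
  obtain ⟨δ, hδ⟩ := exists_contMDiffMap_forall_mem_convex_of_local_const (I := 𝓡 d) (n := ⊤)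
    (t := fun y => {r : ℝ | 0 < r ∧ ∀ v, ‖v‖ ≤ 2 * r → P (y, v)}) (fun y => by
      refine OrdConnected.convex ⟨fun a ha b hb r hr => ⟨ha.1.trans_le hr.1, fun v hv => ?_⟩⟩
      exact hb.2 v (hv.trans (by linarith [hr.2]))) (fun y => by
      obtain ⟨p, hp, q, hq, hpq⟩ := eventually_prod_iff.1 ((nhds_prod_eq (x := y) (y := (0 : F))) ▸ hP y)
      obtain ⟨r, hr, hrq⟩ := Metric.eventually_nhds_iff.1 hq
      refine ⟨r / 3, ?_⟩
      filter_upwards [hp] with y' hy'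
      refine ⟨by positivity, fun v hv => hpq hy' (hrq ?_)⟩
      rw [dist_zero_right]
      linarith)
  exact ⟨δ, δ.contMDiff, fun y => (hδ y).1, fun y => (hδ y).2⟩

variable [NormedSpace ℝ F] [FiniteDimensional ℝ F] [Nontrivial F]

/-- A smooth family of germs of diffeomorphisms along a section extends to a smooth family of
diffeomorphisms, which is the identity wherever the germs are, near a closed set. -/
theorem exists_family_diffeomorph {Ψ : Y × F → F} {s : Y → F} {K K' : Set Y}
    (hΨ : ContMDiff ((𝓡 d).prod 𝓘(ℝ, F)) 𝓘(ℝ, F) ∞ Ψ) (hs : ContMDiff (𝓡 d) 𝓘(ℝ, F) ∞ s)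
    (hΨ0 : ∀ y, Ψ (y, s y) = 0)
    (hinj : ∀ y, Function.Injective (fderiv ℝ (fun q => Ψ (y, q)) (s y)))
    (hK : IsClosed K) (hK' : IsOpen K') (hKK' : K ⊆ K')
    (hid : ∀ y ∈ K', Ψ =ᶠ[𝓝 (y, s y)] Prod.snd) :
    ∃ ψ : Y → F ≃ₘ[ℝ] F,
      ContMDiff ((𝓡 d).prod 𝓘(ℝ, F)) 𝓘(ℝ, F) ∞ (fun a : Y × F => ψ a.1 a.2) ∧
      (∀ y, (fun a : Y × F => ψ a.1 a.2) =ᶠ[𝓝 (y, s y)] Ψ) ∧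
      ∀ᶠ y in 𝓝ˢ K, ∀ q, ψ y q = q := by
  have : LocallyCompactSpace Y := ChartedSpace.locallyCompactSpace (EuclideanSpace ℝ (Fin d)) Y
  -- The remainder is made to vanish on the discs over closure V. Near points of closure V this
  -- holds because it lies in K', and elsewhere the condition is empty on an open set.
  obtain ⟨V, hV, hKV, hVK'⟩ := normal_exists_closure_subset hK hK' hKK'
  set A : Y → F →L[ℝ] F := fun y => fderiv ℝ (fun q => Ψ (y, q)) (s y) with hAdef
  have hsec : ContMDiff (𝓡 d) ((𝓡 d).prod 𝓘(ℝ, F)) ∞ (fun y => (y, s y)) := contMDiff_id.prodMk hs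
  have hA : ContMDiff (𝓡 d) 𝓘(ℝ, F →L[ℝ] F) ∞ A := (contMDiff_fiberDeriv hΨ).comp hsec
  -- The remainder after the linear part A has zero derivative at the centre, so its cutoff on a
  -- small disc is a small perturbation of A.
  set S : Y × F → F := fun a => Ψ (a.1, s a.1 + a.2) - A a.1 a.2 with hSdef
  have hfst : ContMDiff ((𝓡 d).prod 𝓘(ℝ, F)) (𝓡 d) ∞ (Prod.fst : Y × F → Y) := contMDiff_fst
  have hshift : ContMDiff ((𝓡 d).prod 𝓘(ℝ, F)) ((𝓡 d).prod 𝓘(ℝ, F)) ∞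
      (fun a : Y × F => (a.1, s a.1 + a.2)) :=
    hfst.prodMk (ContMDiff.add (hs.comp hfst) contMDiff_snd)
  have hS : ContMDiff ((𝓡 d).prod 𝓘(ℝ, F)) 𝓘(ℝ, F) ∞ S :=
    ContMDiff.sub (hΨ.comp hshift) (ContMDiff.clm_apply (hA.comp hfst) contMDiff_snd)
  have hfibmap : ∀ y : Y, ContMDiff 𝓘(ℝ, F) ((𝓡 d).prod 𝓘(ℝ, F)) ∞ (fun v : F => (y, v)) :=
    fun y => contMDiff_const.prodMk contMDiff_id
  have hΨf : ∀ y, ContDiff ℝ ∞ (fun q => Ψ (y, q)) :=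
    fun y => contMDiff_iff_contDiff.1 (hΨ.comp (hfibmap y))
  have hSf : ∀ y, ContDiff ℝ ∞ (fun v => S (y, v)) :=
    fun y => contMDiff_iff_contDiff.1 (hS.comp (hfibmap y))
  have hS0 : ∀ y, S (y, 0) = 0 := fun y => by simp [hSdef, hΨ0]
  have hdS0 : ∀ y, fderiv ℝ (fun v => S (y, v)) 0 = 0 := by
    intro y
    have h1 : HasFDerivAt (fun v => Ψ (y, s y + v)) (A y) 0 := by
      have h2 : HasFDerivAt (fun q => Ψ (y, q)) (A y) (s y + 0) := by
        rw [add_zero]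
        exact ((hΨf y).differentiable (by simp) _).hasFDerivAt
      exact (h2.comp 0 ((hasFDerivAt_id (0 : F)).const_add (s y)))
    have h3 : HasFDerivAt (fun v => S (y, v)) (A y - A y) 0 := h1.sub (A y).hasFDerivAt
    rw [h3.fderiv, sub_self]
  let Ae : Y → F ≃L[ℝ] F := fun y =>
    (LinearEquiv.ofInjectiveEndo (A y).toLinearMap (hinj y)).toContinuousLinearEquiv
  have hAe : ∀ y, (Ae y : F →L[ℝ] F) = A y := fun y => rfl
  have hinv : Continuous fun y => ContinuousLinearMap.inverse (A y) := by
    have : CompleteSpace F := FiniteDimensional.complete ℝ F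
    refine continuous_iff_continuousAt.2 fun y => ?_
    have h1 : ContinuousAt ContinuousLinearMap.inverse (A y) :=
      (contDiffAt_map_inverse (n := 0) (Ae y)).continuousAt
    exact h1.comp hA.continuous.continuousAt
  let χ : ContDiffBump (0 : F) := ⟨1, 2, one_pos, one_lt_two⟩
  have hχs : ContDiff ℝ ∞ χ := χ.contDiff
  have hχz : ∀ v : F, 2 ≤ ‖v‖ → χ v = 0 := fun v hv => χ.zero_of_le_dist (by simpa using hv)
  obtain ⟨C, hC⟩ := (χ.hasCompactSupport.fderiv (𝕜 := ℝ)).exists_bound_of_continuous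
    (hχs.continuous_fderiv (by simp))
  have hC0 : 0 ≤ C := (norm_nonneg _).trans (hC 0)
  have hdS := contMDiff_fiberDeriv hS
  have hP : ∀ y, ∀ᶠ a in 𝓝 (y, (0 : F)),
      ((1 + 2 * C) * (‖fderiv ℝ (fun v => S (a.1, v)) a.2‖ *
        ‖ContinuousLinearMap.inverse (A a.1)‖) < 1 / 2) ∧ (a.1 ∈ closure V → S a = 0) := by
    intro y
    refine Eventually.and ?_ ?_
    · have h1 : Continuous fun a : Y × F => (1 + 2 * C) * (‖fderiv ℝ (fun v => S (a.1, v)) a.2‖ *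
          ‖ContinuousLinearMap.inverse (A a.1)‖) :=
        continuous_const.mul (hdS.continuous.norm.mul (hinv.comp continuous_fst).norm)
      refine h1.continuousAt.eventually (gt_mem_nhds ?_)
      simp [hdS0]
    · have hf : Tendsto (Prod.fst : Y × F → Y) (𝓝 (y, 0)) (𝓝 y) := continuous_fst.tendsto _
      by_cases hy : y ∈ closure V
      · have h1 : Tendsto (fun a : Y × F => (a.1, s a.1 + a.2)) (𝓝 (y, 0)) (𝓝 (y, s y)) := by
          have := hshift.continuous.tendsto (y, (0 : F))
          simpa using this
        filter_upwards [h1.eventually (hid y (hVK' hy)), hf.eventually (hK'.mem_nhds (hVK' hy))]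
          with a h2 h3 _
        have h4 := hid a.1 h3
        have h5 : s a.1 = 0 := by
          rw [← hΨ0 a.1, h4.self_of_nhds]
        have h6 : (fun q => Ψ (a.1, q)) =ᶠ[𝓝 (s a.1)] id := by
          have : Continuous fun q : F => (a.1, q) := by fun_prop
          exact (this.tendsto (s a.1)).eventually h4
        have h7 : A a.1 = ContinuousLinearMap.id ℝ F := by
          rw [hAdef]
          simp only [h6.fderiv_eq, fderiv_id]
        change Ψ (a.1, s a.1 + a.2) - A a.1 a.2 = 0
        rw [h2, h5, h7]
        simp
      · filter_upwards [hf.eventually (isClosed_closure.isOpen_compl.mem_nhds hy)] with a ha ha'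
        exact absurd ha' ha
  obtain ⟨δ, hδs, hδ, hδP⟩ := exists_contMDiff_radius (d := d) hP
  set T : Y × F → F := fun a => χ ((δ a.1)⁻¹ • a.2) • S a with hTdef
  have hδi : ContMDiff (𝓡 d) 𝓘(ℝ, ℝ) ∞ (fun y => (δ y)⁻¹) := hδs.inv₀ fun y => (hδ y).ne'
  have hT : ContMDiff ((𝓡 d).prod 𝓘(ℝ, F)) 𝓘(ℝ, F) ∞ T :=
    (hχs.contMDiff.comp ((hδi.comp hfst).smul contMDiff_snd)).smul hS
  have hTf : ∀ y, ContDiff ℝ ∞ (fun v => T (y, v)) :=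
    fun y => contMDiff_iff_contDiff.1 (hT.comp (hfibmap y))
  have hTb : ∀ y v, ‖fderiv ℝ (fun v => T (y, v)) v‖ * ‖((Ae y).symm : F →L[ℝ] F)‖ ≤ 1 / 2 := by
    intro y v
    have hN : 0 < ‖((Ae y).symm : F →L[ℝ] F)‖ := (Ae y).norm_symm_pos
    have hinvA : ContinuousLinearMap.inverse (A y) = ((Ae y).symm : F →L[ℝ] F) := by
      rw [← hAe, ContinuousLinearMap.inverse_equiv]
    have h1 := norm_fderiv_cutoff_le hχs χ.nonneg' (fun _ => χ.le_one) hχz hC (hSf y) (hS0 y) (hδ y)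
      (η := (1 / 2) / ((1 + 2 * C) * ‖((Ae y).symm : F →L[ℝ] F)‖)) (fun v hv => by
        have h2 := (hδP y v hv).1
        simp only [hinvA] at h2
        rw [le_div_iff₀ (by positivity)]
        linarith) v
    rw [← le_div_iff₀ hN]
    refine h1.trans (le_of_eq ?_)
    field_simp
  have hT' : ∀ y, ContDiff ℝ ∞ (fun q => T (y, q - s y) - A y (s y)) := fun y =>
    ((hTf y).comp (contDiff_id.sub contDiff_const)).sub contDiff_const
  choose ψ hψ using fun y => exists_diffeomorph_of_perturbation (Ae y) (hT' y) (fun v => by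
    rw [fderiv_sub_const, fderiv_comp_sub (f := fun v => T (y, v))]
    exact hTb y _)
  have hψ' : ∀ y q, ψ y q = A y (q - s y) + T (y, q - s y) := by
    intro y q
    rw [hψ, map_sub]
    change A y q + _ = _
    abel
  refine ⟨ψ, ?_, fun y => ?_, ?_⟩
  · simp only [hψ']
    have h1 : ContMDiff ((𝓡 d).prod 𝓘(ℝ, F)) 𝓘(ℝ, F) ∞ (fun a : Y × F => a.2 - s a.1) :=
      contMDiff_snd.sub (hs.comp hfst)
    exact ((hA.comp hfst).clm_apply h1).add (hT.comp (hfst.prodMk h1))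
  · have h1 : Continuous fun a : Y × F => ‖a.2 - s a.1‖ :=
      (continuous_snd.sub (hs.continuous.comp continuous_fst)).norm
    have h2 : ∀ᶠ a in 𝓝 (y, s y), ‖a.2 - s a.1‖ < δ a.1 :=
      h1.continuousAt.eventually_lt (hδs.continuous.comp continuous_fst).continuousAt
        (by simpa using hδ y)
    filter_upwards [h2] with a ha
    have h3 : χ ((δ a.1)⁻¹ • (a.2 - s a.1)) = 1 := by
      refine χ.one_of_mem_closedBall ?_
      rw [mem_closedBall_zero_iff, norm_smul, Real.norm_of_nonneg (inv_pos.2 (hδ _)).le,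
        inv_mul_eq_div, div_le_iff₀ (hδ _)]
      exact (one_mul (δ a.1)).symm ▸ ha.le
    rw [hψ']
    simp [hTdef, h3, hSdef]
  · refine mem_nhdsSet_iff_exists.2 ⟨V, hV, hKV, fun y hy q => ?_⟩
    -- Over V the germ is the identity, so s = 0 and A = id, and the remainder vanishes on the whole
    -- disc that carries the cutoff.
    have h4 := hid y (hVK' (subset_closure hy))
    have h5 : s y = 0 := by
      rw [← hΨ0 y, h4.self_of_nhds]
    have h6 : (fun q => Ψ (y, q)) =ᶠ[𝓝 (s y)] id := by
      have : Continuous fun q : F => (y, q) := by fun_prop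
      exact (this.tendsto (s y)).eventually h4
    have h7 : A y = ContinuousLinearMap.id ℝ F := by
      rw [hAdef]
      simp only [h6.fderiv_eq, fderiv_id]
    have h8 : T (y, q) = 0 := by
      rcases le_or_gt ‖q‖ (2 * δ y) with hq | hq
      · simp [hTdef, (hδP y q hq).2 (subset_closure hy)]
      · have : χ ((δ y)⁻¹ • q) = 0 := by
          refine hχz _ ?_
          rw [norm_smul, Real.norm_of_nonneg (inv_pos.2 (hδ _)).le, inv_mul_eq_div,
            le_div_iff₀ (hδ _)]
          exact hq.le
        simp [hTdef, this]
    rw [hψ', h5, sub_zero, h7, h8, add_zero]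
    rfl

end FamilyExtension

/-! ### The standard embedding is already in normal form. -/

section Standard

variable {n : ℕ}

theorem stdEmbedding_eq (z : Cot n) :
    stdEmbedding n z = (co 0 z.2 ^ 2 / 4, z.1 - (co 0 z.2 / 2) • ev 0, z.2) := by
  cases n with
  | zero => exact Prod.ext (by simp [stdEmbedding, co]) (Subsingleton.elim _ _)
  | succ m =>
    have h0 : co 0 z.2 = z.2 0 := co_of_lt (Nat.succ_pos m) z.2
    have h1 : (ev 0 : Fin (m + 1) → ℝ) = Pi.single 0 1 := ev_val (0 : Fin (m + 1))
    refine Prod.ext (by simp [stdEmbedding, h0]) (Prod.ext ?_ rfl)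
    funext k
    simp only [stdEmbedding, h0, h1, Pi.sub_apply, Pi.smul_apply, smul_eq_mul]
    by_cases hk : k = 0
    · subst hk
      simp
    · simp [Function.update_of_ne hk, Pi.single_eq_of_ne hk]

/-- For i ≥ 1 the image has base point w - (H(w) + w₁/2) e₀, where H takes the value -w₁/2, and x₀ =
p₁²/4 = w₁²/4 is its square. For i = 0 both sides vanish. -/
theorem fst_stdEmbedding_ell {i : ℕ} (hi : i ≤ n) (w : Fin n → ℝ) :
    (stdEmbedding n (ell i w)).1 = H i 0 (stdEmbedding n (ell i w)).2.1 ^ 2 := by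
  simp only [stdEmbedding_eq]
  cases i with
  | zero => simp [ell, H_zero_left]
  | succ i =>
    have hn : 0 < n := by omega
    have h1 : co 0 (ell (i + 1) w).2 = co 0 w := by
      have h2 := fderiv_H_ev (l := i) hn w
      have h3 : (ev 0 : Fin n → ℝ) = Pi.single ⟨0, hn⟩ 1 := ev_val (⟨0, hn⟩ : Fin n)
      rw [h3] at h2
      rw [co_of_lt hn]
      simp [ell, gradVec, h2]
    have h4 : (ell (i + 1) w).1 - (co 0 w / 2) • ev 0 =
        w + (-(H (i + 1) 0 w + co 0 w / 2)) • ev 0 := by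
      simp only [ell]
      module
    rw [h1, h4, H_succ_add_smul_ev hn]
    ring

/-- On the zero section the base projection of the standard embedding is the identity. This yields
the normalization `pos` for X = id. -/
theorem fderiv_stdEmbedding_zero (v : Fin n → ℝ) :
    (fderiv ℝ (stdEmbedding n) 0 (v, 0)).2.1 = v := by
  have hd : DifferentiableAt ℝ (stdEmbedding n) 0 := by
    have : stdEmbedding n = fun z => (co 0 z.2 ^ 2 / 4, z.1 - (co 0 z.2 / 2) • ev 0, z.2) :=
      funext stdEmbedding_eq
    rw [this]
    fun_prop
  have h1 : HasFDerivAt (fun x : Fin n → ℝ => (stdEmbedding n (x, 0)).2.1)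
      ((ContinuousLinearMap.fst ℝ _ _).comp ((ContinuousLinearMap.snd ℝ _ _).comp
        ((fderiv ℝ (stdEmbedding n) 0).comp
          (ContinuousLinearMap.inl ℝ (Fin n → ℝ) (Fin n → ℝ))))) 0 := by
    have h2 : HasFDerivAt (fun x : Fin n → ℝ => ((x, 0) : Cot n))
        (ContinuousLinearMap.inl ℝ (Fin n → ℝ) (Fin n → ℝ)) 0 := hasFDerivAt_prodMk_left 0 0
    have h5 : HasFDerivAt (stdEmbedding n ∘ fun x : Fin n → ℝ => ((x, 0) : Cot n)) _ 0 :=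
      HasFDerivAt.comp (f := fun x : Fin n → ℝ => ((x, 0) : Cot n)) 0 hd.hasFDerivAt h2
    exact h5.snd.fst
  have h3 : (fun x : Fin n → ℝ => (stdEmbedding n (x, 0)).2.1) = id := by
    funext x
    simp [stdEmbedding_eq]
  rw [h3] at h1
  have h4 := h1.unique (hasFDerivAt_id 0)
  exact congrArg (fun L : (Fin n → ℝ) →L[ℝ] (Fin n → ℝ) => L v) h4

/-- Where the family is the standard one, the identity brings the fronts to the normal form. -/
theorem isSolution_of_eventuallyEq_stdEmbedding {Y : Type*} [TopologicalSpace Y]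
    {Φ : Y × Cot n → J1 n} {y₁ : Y}
    (h : ∀ᶠ a in 𝓝 (y₁, (0 : Cot n)), Φ a = stdEmbedding n a.2) :
    IsSolution Φ 1 (fun _ _ => 0) (fun _ q => q) y₁ := by
  have hell : ∀ i, ∀ᶠ p in 𝓝 (y₁, (0 : Fin n → ℝ)),
      Φ (p.1, ell i p.2) = stdEmbedding n (ell i p.2) := by
    intro i
    have h1 : Continuous fun p : Y × (Fin n → ℝ) => (p.1, ell i p.2) :=
      continuous_fst.prodMk ((contDiff_ell i).continuous.comp continuous_snd)
    have h2 := h1.tendsto (y₁, 0)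
    simp only [ell_zero_right] at h2
    exact h2.eventually h
  refine ⟨Or.inl rfl, fun _ => rfl, ?_, fun i hi => ?_, ?_, ?_, ?_, fun a ha => ?_⟩
  · filter_upwards [hell 0] with p hp
    rw [hp, fst_stdEmbedding_ell (Nat.zero_le n), H_zero_left]
    simp
  · filter_upwards [hell i] with p hp
    simp only [baseMap, hp]
    rw [fst_stdEmbedding_ell hi]
    ring
  · exact Eventually.of_forall fun q => differentiableAt_id
  · exact continuous_snd.continuousAt
  · simp only [fderiv_fun_id]
    exact continuousAt_const
  · have h1 : (fun z => Φ (y₁, z)) =ᶠ[𝓝 0] stdEmbedding n := by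
      have : Continuous fun z : Cot n => (y₁, z) := by fun_prop
      exact (this.tendsto 0).eventually h
    rw [h1.fderiv_eq, fderiv_fun_id, ContinuousLinearMap.id_apply, fderiv_stdEmbedding_zero,
      co_ev_self ha]
    exact one_pos

end Standard

/-! ### The straightening map of the front space. -/

section Normalization

variable {n d : ℕ} {Y : Type*} [TopologicalSpace Y] [ChartedSpace (EuclideanSpace ℝ (Fin d)) Y]

/-- The change of coordinates of the front space defined by a solution. -/
def straighten (ε : ℝ) (f₀ : Y → (Fin n → ℝ) → ℝ) (X : Y → (Fin n → ℝ) → Fin n → ℝ)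
    (a : Y × FrontSpace n) : FrontSpace n :=
  (ε * (a.2.1 - f₀ a.1 a.2.2), X a.1 a.2.2)

variable {Φ : Y × Cot n → J1 n} {ε ε' : ℝ} {f₀ f₀' : Y → (Fin n → ℝ) → ℝ}
  {X X' : Y → (Fin n → ℝ) → Fin n → ℝ} {y₁ : Y}

theorem tendsto_center (Φ : Y × Cot n → J1 n) (y₁ : Y) :
    Tendsto (fun a : Y × FrontSpace n => (a.1, a.2.2)) (𝓝 (y₁, frontProj (Φ (y₁, 0))))
      (𝓝 (center Φ y₁)) := by
  have : Continuous fun a : Y × FrontSpace n => (a.1, a.2.2) := by fun_prop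
  exact this.tendsto _

/-- Uniqueness of the germ of (ε, f₀, X). It makes the local straightenings glue, and makes them the
identity where the family is standard. -/
theorem straighten_eventuallyEq (hb : BaseMapsOpenAt Φ y₁) (h : IsSolution Φ ε f₀ X y₁)
    (h' : IsSolution Φ ε' f₀' X' y₁) :
    straighten ε f₀ X =ᶠ[𝓝 (y₁, frontProj (Φ (y₁, 0)))] straighten ε' f₀' X' := by
  obtain ⟨rfl, h2⟩ := IsSolution.unique hb h h'
  filter_upwards [(tendsto_center Φ y₁).eventually h2] with a ha
  simp only [straighten, ha.1, ha.2]

theorem IsSmoothSolution.contMDiffAt_straighten (h : IsSmoothSolution (d := d) Φ ε f₀ X y₁) :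
    ∀ᶠ a in 𝓝 (y₁, frontProj (Φ (y₁, 0))),
      ContMDiffAt ((𝓡 d).prod 𝓘(ℝ, FrontSpace n)) 𝓘(ℝ, FrontSpace n) ∞ (straighten ε f₀ X) a := by
  have hm : ContMDiff ((𝓡 d).prod 𝓘(ℝ, FrontSpace n)) ((𝓡 d).prod 𝓘(ℝ, Fin n → ℝ)) ∞
      (fun a : Y × FrontSpace n => (a.1, a.2.2)) :=
    contMDiff_fst.prodMk (contDiff_snd.contMDiff.comp contMDiff_snd)
  have h0 : ContMDiff ((𝓡 d).prod 𝓘(ℝ, FrontSpace n)) 𝓘(ℝ, ℝ) ∞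
      (fun a : Y × FrontSpace n => a.2.1) := contDiff_fst.contMDiff.comp contMDiff_snd
  filter_upwards [(tendsto_center Φ y₁).eventually h.smooth_f,
    (tendsto_center Φ y₁).eventually h.smooth_X] with a h1 h2
  have h3 := ContMDiffAt.comp a h1 (hm a)
  have h4 := ContMDiffAt.comp a h2 (hm a)
  exact (contMDiffAt_const.mul ((h0 a).sub h3)).prodMk_space h4

/-- The differential is block triangular, with diagonal blocks ε ≠ 0 and the injective dX. -/
theorem IsSmoothSolution.injective_fderiv_straighten (h : IsSmoothSolution (d := d) Φ ε f₀ X y₁) :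
    Function.Injective (fderiv ℝ (fun q => straighten ε f₀ X (y₁, q)) (frontProj (Φ (y₁, 0)))) := by
  have hε : ε ≠ 0 := by
    rcases h.sign with rfl | rfl <;> norm_num
  have hX : HasFDerivAt (X y₁) _ (frontProj (Φ (y₁, 0))).2 := h.diff.self_of_nhds.hasFDerivAt
  have hf : HasFDerivAt (f₀ y₁) _ (frontProj (Φ (y₁, 0))).2 := h.diff_f.hasFDerivAt
  have hs : HasFDerivAt (Prod.snd : FrontSpace n → _)
      (ContinuousLinearMap.snd ℝ ℝ (Fin n → ℝ)) (frontProj (Φ (y₁, 0))) := hasFDerivAt_snd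
  have h1 : HasFDerivAt (fun q => straighten ε f₀ X (y₁, q)) _ (frontProj (Φ (y₁, 0))) :=
    ((hasFDerivAt_fst.sub (hf.comp _ hs)).const_mul ε).prodMk (hX.comp _ hs)
  rw [h1.fderiv, injective_iff_map_eq_zero]
  rintro ⟨r, v⟩ hv
  obtain ⟨h2, h3⟩ := Prod.mk.inj hv
  have hv0 : v = 0 := h.inj (h3.trans (map_zero _).symm)
  subst hv0
  have h4 : ε * (r - fderiv ℝ (f₀ y₁) (frontProj (Φ (y₁, 0))).2 0) = 0 := h2
  rw [map_zero, sub_zero] at h4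
  rw [(mul_eq_zero.1 h4).resolve_left hε]
  rfl

theorem IsSolution.straighten_zero (h : IsSolution Φ ε f₀ X y₁) :
    straighten ε f₀ X (y₁, frontProj (Φ (y₁, 0))) = 0 := by
  obtain ⟨h1, h2⟩ := h.eventually_center.self_of_nhds
  refine Prod.ext ?_ h2
  change ε * ((Φ (y₁, 0)).1 - f₀ y₁ (center Φ y₁).2) = 0
  rw [h1, sub_self, mul_zero]

end Normalization

/-! ### Comparison of front germs with the model germ. -/

section FrontGerms

variable {n d : ℕ} {Y : Type*} [TopologicalSpace Y] [ChartedSpace (EuclideanSpace ℝ (Fin d)) Y]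
variable {φ : Y → Cot n → J1 n} {ε : ℝ} {f₀ : Y → (Fin n → ℝ) → ℝ}
  {X : Y → (Fin n → ℝ) → Fin n → ℝ} {y₁ : Y} {ψ : Y → FrontSpace n → FrontSpace n}

/-- In the straightened coordinates the front of the `i`-th piece is the graph of `hᵢ²`. -/
theorem IsSolution.eventually_image_eq (h : IsSolution (fun a : Y × Cot n => φ a.1 a.2) ε f₀ X y₁)
    (hφ : ContinuousAt (fun a : Y × Cot n => φ a.1 a.2) (y₁, 0))
    (hψ : (fun a : Y × FrontSpace n => ψ a.1 a.2) =ᶠ[𝓝 (y₁, frontProj (φ y₁ 0))]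
      straighten ε f₀ X) {i : ℕ} (hi : i ≤ n) :
    ∀ᶠ p in 𝓝 (y₁, (0 : Fin n → ℝ)), ψ p.1 (frontProj (φ p.1 (ell i p.2))) =
      (H i 0 (X p.1 (baseMap (fun a : Y × Cot n => φ a.1 a.2) i p).2) ^ 2,
        X p.1 (baseMap (fun a : Y × Cot n => φ a.1 a.2) i p).2) := by
  have h1 : Tendsto (fun p : Y × (Fin n → ℝ) => (p.1, ell i p.2)) (𝓝 (y₁, 0)) (𝓝 (y₁, 0)) := by
    have : Continuous fun p : Y × (Fin n → ℝ) => (p.1, ell i p.2) :=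
      continuous_fst.prodMk ((contDiff_ell i).continuous.comp continuous_snd)
    have := this.tendsto (y₁, 0)
    rwa [ell_zero_right] at this
  have h2 : Tendsto (fun p : Y × (Fin n → ℝ) => φ p.1 (ell i p.2)) (𝓝 (y₁, 0)) (𝓝 (φ y₁ 0)) :=
    hφ.tendsto.comp h1
  have hproj : Continuous (frontProj (n := n)) :=
    continuous_fst.prodMk (continuous_fst.comp continuous_snd)
  have h3 : Tendsto (fun p : Y × (Fin n → ℝ) => (p.1, frontProj (φ p.1 (ell i p.2))))
      (𝓝 (y₁, 0)) (𝓝 (y₁, frontProj (φ y₁ 0))) :=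
    (continuous_fst.tendsto _).prodMk_nhds ((hproj.tendsto _).comp h2)
  filter_upwards [h3.eventually hψ, h.pieces i hi] with p h4 h5
  rw [h4]
  exact Prod.ext h5 rfl

/-- The front is taken into the model. -/
theorem IsSolution.eventually_mem_modelFront
    (h : IsSolution (fun a : Y × Cot n => φ a.1 a.2) ε f₀ X y₁)
    (hφ : ContinuousAt (fun a : Y × Cot n => φ a.1 a.2) (y₁, 0))
    (hψ : (fun a : Y × FrontSpace n => ψ a.1 a.2) =ᶠ[𝓝 (y₁, frontProj (φ y₁ 0))]
      straighten ε f₀ X) :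
    ∀ᶠ a in 𝓝 (y₁, (0 : Cot n)), a.2 ∈ extLag n → ψ a.1 (frontProj (φ a.1 a.2)) ∈ modelFront n := by
  have h1 : ∀ᶠ a in 𝓝 (y₁, (0 : Cot n)), ∀ i : Fin (n + 1),
      ψ a.1 (frontProj (φ a.1 (ell i (lam i a.2)))) ∈ modelFront n := by
    refine eventually_all.2 fun i => ?_
    have h2 : Tendsto (fun a : Y × Cot n => (a.1, lam i a.2)) (𝓝 (y₁, 0)) (𝓝 (y₁, 0)) := by
      have : Continuous fun a : Y × Cot n => (a.1, lam i a.2) := by fun_prop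
      have := this.tendsto (y₁, 0)
      rwa [map_zero] at this
    filter_upwards [h2.eventually (h.eventually_image_eq hφ hψ (i := i) (by omega))] with a ha
    rw [ha]
    exact mem_modelFront_iff.2 ⟨i, by omega, rfl⟩
  filter_upwards [h1] with a ha hmem
  obtain ⟨i, hi, w, hw⟩ := mem_extLag_iff.1 hmem
  have h3 := ha ⟨i, by omega⟩
  simp only [hw, lam_ell hi] at h3
  rw [hw]
  exact h3

/-- The front of every neighbourhood of the origin covers the model near the origin. -/
theorem IsSmoothSolution.eventually_mem_image_front
    (h : IsSmoothSolution (d := d) (fun a : Y × Cot n => φ a.1 a.2) ε f₀ X y₁)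
    (hb : BaseMapsOpenAt (fun a : Y × Cot n => φ a.1 a.2) y₁)
    (hφ : ContinuousAt (fun a : Y × Cot n => φ a.1 a.2) (y₁, 0))
    (hψ : (fun a : Y × FrontSpace n => ψ a.1 a.2) =ᶠ[𝓝 (y₁, frontProj (φ y₁ 0))]
      straighten ε f₀ X) {W : Set (Cot n)} (hW : W ∈ 𝓝 0) :
    ∀ᶠ a in 𝓝 (y₁, (0 : FrontSpace n)), a.2 ∈ modelFront n → a.2 ∈ ψ a.1 '' front (φ a.1) W := by
  have h1 : ∀ᶠ a in 𝓝 (y₁, (0 : FrontSpace n)), ∀ i : Fin (n + 1),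
      a.2.1 = H i 0 a.2.2 ^ 2 → a.2 ∈ ψ a.1 '' front (φ a.1) W := by
    refine eventually_all.2 fun i => ?_
    have hi : (i : ℕ) ≤ n := by omega
    -- The base map and X are both open over the parameters at the points in question, so their
    -- composition reaches every nearby value with parameters near the origin of ⁿLᵢ.
    have hopen : 𝓝 (y₁, (0 : Fin n → ℝ)) ≤ map (fun p : Y × (Fin n → ℝ) =>
        (p.1, X p.1 (baseMap (fun a : Y × Cot n => φ a.1 a.2) i p).2)) (𝓝 (y₁, 0)) := by
      refine h.open_X.trans ?_
      rw [← hb i hi, map_map]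
      exact le_rfl
    have hell : ∀ᶠ p in 𝓝 (y₁, (0 : Fin n → ℝ)), ell i p.2 ∈ W := by
      have : Continuous fun p : Y × (Fin n → ℝ) => ell (i : ℕ) p.2 :=
        (contDiff_ell i).continuous.comp continuous_snd
      have := this.tendsto (y₁, 0)
      rw [ell_zero_right] at this
      exact this.eventually hW
    have h2 := image_mem_map (m := fun p : Y × (Fin n → ℝ) =>
      (p.1, X p.1 (baseMap (fun a : Y × Cot n => φ a.1 a.2) i p).2))
      (hell.and (h.toIsSolution.eventually_image_eq hφ hψ hi))
    have ht : Tendsto (fun a : Y × FrontSpace n => (a.1, a.2.2)) (𝓝 (y₁, 0)) (𝓝 (y₁, 0)) := by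
      have : Continuous fun a : Y × FrontSpace n => (a.1, a.2.2) := by fun_prop
      exact this.tendsto (y₁, 0)
    filter_upwards [ht.eventually (hopen h2)] with a ha hq
    obtain ⟨p, ⟨hp1, hp2⟩, hp3⟩ := ha
    obtain ⟨h3, h4⟩ := Prod.mk.inj hp3
    rw [h3] at hp2
    refine ⟨frontProj (φ a.1 (ell i p.2)), mem_image_of_mem _ (mem_image_of_mem _
      ⟨mem_extLag_iff.2 ⟨i, hi, p.2, rfl⟩, hp1⟩), ?_⟩
    rw [hp2]
    rw [h3] at h4
    rw [h4]
    exact Prod.ext hq.symm rfl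
  filter_upwards [h1] with a ha hmem
  obtain ⟨i, hi, h2⟩ := mem_modelFront_iff.1 hmem
  exact ha ⟨i, by omega⟩ h2

/-- A family that straightens the fronts takes the front germs to the germ of the model. -/
theorem takesFrontGermsToModel_of_isSmoothSolution [LocallyCompactSpace Y]
    {ε : Y → ℝ} {f₀ : Y → Y → (Fin n → ℝ) → ℝ} {X : Y → Y → (Fin n → ℝ) → Fin n → ℝ}
    (h : ∀ y, IsSmoothSolution (d := d) (fun a : Y × Cot n => φ a.1 a.2) (ε y) (f₀ y) (X y) y)
    (hb : ∀ y, BaseMapsOpenAt (fun a : Y × Cot n => φ a.1 a.2) y)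
    (hφ : ∀ y, ContinuousAt (fun a : Y × Cot n => φ a.1 a.2) (y, 0))
    (hψ : ∀ y, (fun a : Y × FrontSpace n => ψ a.1 a.2) =ᶠ[𝓝 (y, frontProj (φ y 0))]
      straighten (ε y) (f₀ y) (X y)) :
    TakesFrontGermsToModel φ ψ := by
  refine ⟨fun y => (hψ y).self_of_nhds.trans (h y).toIsSolution.straighten_zero, fun y₀ => ?_⟩
  have h1 := (h y₀).toIsSolution.eventually_mem_modelFront (hφ y₀) (hψ y₀)
  rw [nhds_prod_eq] at h1
  obtain ⟨p, hp, q, hq, hpq⟩ := eventually_prod_iff.1 h1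
  -- Compactness of N gives one neighbourhood O on which covering holds for all parameters in N. The
  -- other inclusion fixes the bound on W beforehand.
  obtain ⟨N, hN, hNp, hNc⟩ := local_compact_nhds hp
  refine ⟨N, hN, {z | q z}, hq, fun W hW hWq => ?_⟩
  have h2 : ∀ᶠ x in 𝓝 (0 : FrontSpace n), ∀ y ∈ N,
      x ∈ modelFront n → x ∈ ψ y '' front (φ y) W := by
    refine hNc.eventually_forall_of_forall_eventually fun y _ => ?_
    have := (h y).eventually_mem_image_front (hb y) (hφ y) (hψ y) hW
    have ht : Tendsto (fun a : FrontSpace n × Y => (a.2, a.1)) (𝓝 (0, y)) (𝓝 (y, 0)) :=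
      continuous_swap.tendsto (0, y)
    exact ht.eventually this
  refine ⟨_, h2, fun y hy => Subset.antisymm ?_ ?_⟩
  · rintro x ⟨⟨_, ⟨_, ⟨z, hz, rfl⟩, rfl⟩, rfl⟩, hx⟩
    exact ⟨hpq (hNp hy) (hWq hz.2) hz.1, hx⟩
  · rintro x ⟨hx, hxO⟩
    exact ⟨hxO y hy hx, hxO⟩

end FrontGerms

/-! ### Assembly of the theorem. -/

section Main

/-- The parametric statement. -/
theorem exists_family_straightening {n d : ℕ} {Y : Type*} [TopologicalSpace Y]
    [ChartedSpace (EuclideanSpace ℝ (Fin d)) Y] [IsManifold (𝓡 d) ∞ Y] [T2Space Y]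
    [SecondCountableTopology Y] {U : Set (Y × Cot n)} {φ : Y → Cot n → J1 n} {K : Set Y}
    (hU : IsOpen U) (hU0 : ∀ y, (y, (0 : Cot n)) ∈ U)
    (hφ : ContMDiffOn ((𝓡 d).prod 𝓘(ℝ, Cot n)) 𝓘(ℝ, J1 n) ∞
      (fun a : Y × Cot n => φ a.1 a.2) U)
    (hW : ∀ y, IsWeinsteinEmbeddingOn (φ y) {z | (y, z) ∈ U})
    (hT : ∀ y, TransverseToFibersOn (φ y) {z | (y, z) ∈ U}) (hK : IsClosed K)
    (hstd : ∀ᶠ a : Y × Cot n in 𝓝ˢ (K ×ˢ {(0 : Cot n)}), φ a.1 a.2 = stdEmbedding n a.2) :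
    ∃ ψ : Y → FrontSpace n ≃ₘ[ℝ] FrontSpace n,
      ContMDiff ((𝓡 d).prod 𝓘(ℝ, FrontSpace n)) 𝓘(ℝ, FrontSpace n) ∞
        (fun a : Y × FrontSpace n => ψ a.1 a.2) ∧
      TakesFrontGermsToModel φ (fun y => ψ y) ∧ ∀ᶠ y in 𝓝ˢ K, ∀ q, ψ y q = q := by
  have : LocallyCompactSpace Y := ChartedSpace.locallyCompactSpace (EuclideanSpace ℝ (Fin d)) Y
  have hb := fun y => (exists_isSmoothSolution hU hU0 hφ hW hT y).1
  choose ε f₀ X hsol using fun y => (exists_isSmoothSolution hU hU0 hφ hW hT y).2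
  have hφ0 : ∀ y, ContMDiffAt ((𝓡 d).prod 𝓘(ℝ, Cot n)) 𝓘(ℝ, J1 n) ∞
      (fun a : Y × Cot n => φ a.1 a.2) (y, 0) := fun y => hφ.contMDiffAt (hU.mem_nhds (hU0 y))
  have hsec : ContMDiff (𝓡 d) ((𝓡 d).prod 𝓘(ℝ, Cot n)) ∞ (fun y : Y => (y, (0 : Cot n))) :=
    contMDiff_id.prodMk contMDiff_const
  have hproj : ContDiff ℝ ∞ (frontProj (n := n)) :=
    contDiff_fst.prodMk (contDiff_fst.comp contDiff_snd)
  have hs : ContMDiff (𝓡 d) 𝓘(ℝ, FrontSpace n) ∞ (fun y => frontProj (φ y 0)) := fun y =>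
    (hproj.contMDiff.contMDiffAt).comp y (ContMDiffAt.comp y (hφ0 y) (hsec y))
  -- By openness the solution found at y still solves the problem at nearby y', where uniqueness
  -- identifies it with the solution chosen at y'.
  obtain ⟨Ψ, hΨ, hΨe⟩ := exists_contMDiff_glue hs.continuous
    (Ψ := fun y => straighten (ε y) (f₀ y) (X y)) (fun y => (hsol y).contMDiffAt_straighten)
    (fun y => (hsol y).near.mono fun y' hy' =>
      straighten_eventuallyEq (hb y') hy' (hsol y').toIsSolution)
  have hfib : ∀ y, (fun q => Ψ (y, q)) =ᶠ[𝓝 (frontProj (φ y 0))]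
      fun q => straighten (ε y) (f₀ y) (X y) (y, q) := by
    intro y
    have : Continuous fun q : FrontSpace n => (y, q) := by fun_prop
    exact (this.tendsto _).eventually (hΨe y)
  let K' : Set Y := {y | ∀ᶠ a : Y × Cot n in 𝓝 (y, (0 : Cot n)), φ a.1 a.2 = stdEmbedding n a.2}
  have hK' : IsOpen K' := (isOpen_setOfPred_eventually_nhds
    (p := fun a : Y × Cot n => φ a.1 a.2 = stdEmbedding n a.2)).preimage hsec.continuous
  obtain ⟨ψ, hψs, hψe, hψK⟩ := exists_family_diffeomorph hΨ hs (K := K) (K' := K')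
    (fun y => (hΨe y).self_of_nhds.trans (hsol y).toIsSolution.straighten_zero)
    (fun y => by
      rw [(hfib y).fderiv_eq]
      exact (hsol y).injective_fderiv_straighten)
    hK hK'
    (fun y hy => (eventually_nhdsSet_iff_forall.1 hstd) (y, 0) ⟨hy, rfl⟩)
    -- Over K' the triple (1, 0, id) is a solution as well, so by uniqueness the glued germ is the
    -- identity.
    (fun y hy => by
      have h1 := straighten_eventuallyEq (hb y) (hsol y).toIsSolution
        (isSolution_of_eventuallyEq_stdEmbedding (Φ := fun a : Y × Cot n => φ a.1 a.2) hy)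
      refine (hΨe y).trans (h1.trans (Eventually.of_forall fun a => ?_))
      simp [straighten])
  exact ⟨ψ, hψs, takesFrontGermsToModel_of_isSmoothSolution hsol hb
    (fun y => (hφ0 y).continuousAt) (fun y => (hψe y).trans (hΨe y)), hψK⟩

/-- The statement for a single embedding, as a family over a point. -/
theorem exists_straightening {n : ℕ} {U : Set (Cot n)} {φ : Cot n → J1 n} (hU : IsOpen U)
    (hU0 : (0 : Cot n) ∈ U) (hW : IsWeinsteinEmbeddingOn φ U) (hT : TransverseToFibersOn φ U) :
    ∃ ψ : FrontSpace n ≃ₘ[ℝ] FrontSpace n, TakesFrontGermToModel φ ψ := by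
  obtain ⟨ψ, -, ⟨h1, h2⟩, -⟩ := exists_family_straightening (n := n) (d := 0)
    (Y := EuclideanSpace ℝ (Fin 0)) (U := Prod.snd ⁻¹' U) (φ := fun _ => φ) (K := ∅)
    (hU.preimage continuous_snd) (fun _ => hU0)
    (ContMDiffOn.comp (t := U) hW.smooth.contMDiffOn contMDiff_snd.contMDiffOn fun _ h => h)
    (fun _ => hW) (fun _ => hT) isClosed_empty (by simp)
  obtain ⟨N, hN, W₀, hW₀, h3⟩ := h2 0
  refine ⟨ψ 0, h1 0, W₀, hW₀, fun W hW hWW => ?_⟩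
  obtain ⟨O, hO, h4⟩ := h3 W hW hWW
  exact ⟨O, hO, h4 0 (mem_of_mem_nhds hN)⟩

end Main

end ArborealFront

theorem mainTheorem5 (n : ℕ) :
    -- a single (germ at `0` of a) Weinstein hypersurface embedding
    (∀ (U : Set (ArborealFront.Cot n)) (φ : ArborealFront.Cot n → ArborealFront.J1 n),
      IsOpen U → (0 : ArborealFront.Cot n) ∈ U →
      ArborealFront.IsWeinsteinEmbeddingOn φ U →
      ArborealFront.TransverseToFibersOn φ U →
      ∃ ψ : ArborealFront.FrontSpace n ≃ₘ[ℝ] ArborealFront.FrontSpace n,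
        ArborealFront.TakesFrontGermToModel φ ψ) ∧
    -- families over a manifold `Y`, relative to a closed subset `K`
    (∀ (d : ℕ) (Y : Type*) [TopologicalSpace Y] [ChartedSpace (EuclideanSpace ℝ (Fin d)) Y]
      [IsManifold (𝓡 d) ∞ Y] [T2Space Y] [SecondCountableTopology Y]
      (U : Set (Y × ArborealFront.Cot n)) (φ : Y → ArborealFront.Cot n → ArborealFront.J1 n)
      (K : Set Y),
      IsOpen U → (∀ y, (y, (0 : ArborealFront.Cot n)) ∈ U) →
      ContMDiffOn ((𝓡 d).prod 𝓘(ℝ, ArborealFront.Cot n)) 𝓘(ℝ, ArborealFront.J1 n) ∞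
        (fun a : Y × ArborealFront.Cot n => φ a.1 a.2) U →
      (∀ y, ArborealFront.IsWeinsteinEmbeddingOn (φ y) {z | (y, z) ∈ U}) →
      (∀ y, ArborealFront.TransverseToFibersOn (φ y) {z | (y, z) ∈ U}) →
      IsClosed K →
      (∀ᶠ a : Y × ArborealFront.Cot n in 𝓝ˢ (K ×ˢ {(0 : ArborealFront.Cot n)}),
        φ a.1 a.2 = ArborealFront.stdEmbedding n a.2) →
      ∃ ψ : Y → ArborealFront.FrontSpace n ≃ₘ[ℝ] ArborealFront.FrontSpace n,
        ContMDiff ((𝓡 d).prod 𝓘(ℝ, ArborealFront.FrontSpace n)) 𝓘(ℝ, ArborealFront.FrontSpace n) ∞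
          (fun a : Y × ArborealFront.FrontSpace n => ψ a.1 a.2) ∧
        ArborealFront.TakesFrontGermsToModel φ (fun y => ψ y) ∧
        ∀ᶠ y in 𝓝ˢ K, ∀ q, ψ y q = q) := by
  exact ⟨fun _ _ hU hU0 hW hT => ArborealFront.exists_straightening hU hU0 hW hT,
    fun _ _ _ _ _ _ _ _ _ _ hU hU0 hφ hW hT hK hstd =>
      ArborealFront.exists_family_straightening hU hU0 hφ hW hT hK hstd⟩
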